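/- Let $d\in\mathbb N$, $1\le p\le 2$, $\|x\|=\|x\|_p$ on $\mathbb R^d$, and let $\|\xi\|_*=\max_{\|z\|_p\le 1}\langle \xi,z\rangle$ be the conjugate norm. **Feasible set and prox mapping.** Let $\mathcal X\subset\mathbb R^d$ be compact and convex, and let $\omega:\mathcal X\to\mathbb R$ be $1$-strongly convex with respect to $\|\cdot\|$, with a continuous selection $x\mapsto\omega'(x)\in\partial\omega(x)$ of subgradients on $\mathcal X$. Put $V(x,y)=\omega(y)-\omega(x)-\langle\omega'(x),y-x\rangle$, $D^2=\max_{x,y\in\mathcal X}V(x,y)$ and $P_x(\xi)=\arg\min_{y\in\mathcal X}\{V(x,y)+\langle\xi,y\rangle\}$. **Noise.** Let $(Z_t)_{t\ge 0}$ be a time-homogeneous Markov chain on a Polish space $\mathsf Z$ with transition kernel $Q$, invariant distribution $\pi$ and an arbitrary initial distribution (for instance $\pi$). Assume it is uniformly geometrically ergodic with mixing time $\tau_{\rm mix}\in\mathbb N$, $\tau_{\rm mix}\ge 1$: for some constant $K$, $$|Q^t(z,A)-\pi(A)|\le K\,(1/2)^{t/\tau_{\rm mix}}\qquad\text{for all }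 t\ge 1,\ z\in\mathsf Z,\ A\subseteq\mathsf Z \text{ measurable}.$$ **Operator.** Let $F:\mathcal X\to\mathbb R^d$ be $L$-Lipschitz, $\|F(x)-F(y)\|_*\le L\|x-y\|$ with $L>0$, and monotone, $\langle F(x)-F(y),x-y\rangle\ge 0$ for all $x,y\in\mathcal X$. Let $F(x,z)$ be a (jointly measurable) noisy oracle with $\mathbb E_{Z\sim\pi}[F(x,Z)]=F(x)$ and $\|F(x,z)-F(x)\|_*^2\le\sigma^2$ for all $x\in\mathcal X$, $z\in\mathsf Z$. **Algorithm (Markovian Mirror-Prox with batching).** Let $\gamma>0$, let $B,M\ge 1$ be integers, $x^0\in\mathcal X$, $N_0=0$, and let $J_0,J_1,\dots$ be independent of each other and of $(Z_t)$, with $\mathbb P(J_t=k)=2^{-k}$ for $k=1,2,\dots$. For $t=0,1,2,\dots$ set $$g^{t+1/2}=\frac1B\sum_{i=1}^B F(x^t,Z_{N_t+i}),\qquad x^{t+1/2}=P_{x^t}(\gamma g^{t+1/2}),\qquad N_{t+1/2}=N_t+B,$$ $$g^t_j=\frac{1}{2^jB}\sum_{i=1}^{2^jB}F(x^{t+1/2},Z_{N_{t+1/2}+i}),\qquad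 g^t=g^t_0+\begin{cases}2^{J_t}\,(g^t_{J_t}-g^t_{J_t-1}),&2^{J_t}\le M,\\0,&\text{otherwise,}\end{cases}$$ $$x^{t+1}=P_{x^t}(\gamma g^t),\qquad N_{t+1}=N_{t+1/2}+2^{J_t}B.$$ **Claim.** There is a constant $C>0$ depending only on $K$ such that, whenever $0<\gamma\le 1/(2L)$, for every integer $T\ge 1$ the average $\widehat x^T=\frac1T\sum_{t=0}^{T-1}x^{t+1/2}$ satisfies $$\mathbb E\Big[\max_{u\in\mathcal X}\langle F(u),\widehat x^T-u\rangle\Big]\le C\left(\frac{D^2}{\gamma T}+(1+\log d)\,\gamma\,\tau_{\rm mix}B^{-1}\Big(\frac TM+\log M\Big)\sigma^2\right),$$ where the random variable inside the expectation is integrable (and $\log 0:=0$ if $d=0$). -/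

import Mathlib

open MeasureTheory ProbabilityTheory
open scoped BigOperators

namespace MMP

noncomputable section

/-- The `ℓ_p` norm on `ℝ^d` (used for real `1 ≤ p`). -/
def pNorm {d : ℕ} (p : ℝ) (x : Fin d → ℝ) : ℝ :=
  (∑ i, |x i| ^ p) ^ (1 / p)

/-- The conjugate norm `‖ξ‖_* = max {⟨ξ, z⟩ : ‖z‖_p ≤ 1}`. -/
def dualNorm {d : ℕ} (p : ℝ) (ξ : Fin d → ℝ) : ℝ :=
  sSup {r | ∃ z : Fin d → ℝ, pNorm p z ≤ 1 ∧ r = ξ ⬝ᵥ z}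

/-- `w` is a distance generating function on `X`: it is `1`-strongly convex on `X` with respect to
the `ℓ_p` norm, and `dw` is a continuous selection of subgradients of `w` relative to `X`
(lower semicontinuity of `w` on `X` follows from these properties). -/
structure IsMirrorMap {d : ℕ} (p : ℝ) (X : Set (Fin d → ℝ)) (w : (Fin d → ℝ) → ℝ)
    (dw : (Fin d → ℝ) → (Fin d → ℝ)) : Prop where
  strongConvex : ∀ x ∈ X, ∀ y ∈ X, ∀ a b : ℝ, 0 ≤ a → 0 ≤ b → a + b = 1 →
    w (a • x + b • y) + a * b / 2 * pNorm p (x - y) ^ 2 ≤ a * w x + b * w y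
  subgradient : ∀ x ∈ X, ∀ y ∈ X, w x + dw x ⬝ᵥ (y - x) ≤ w y
  continuousOn : ContinuousOn dw X

/-- The Bregman divergence `V(x, y) = w(y) - w(x) - ⟨w'(x), y - x⟩`. -/
def bregman {d : ℕ} (w : (Fin d → ℝ) → ℝ) (dw : (Fin d → ℝ) → (Fin d → ℝ))
    (x y : Fin d → ℝ) : ℝ :=
  w y - w x - dw x ⬝ᵥ (y - x)

/-- `D² = max {V(x, y) : x, y ∈ X}`. -/
def diamSq {d : ℕ} (X : Set (Fin d → ℝ)) (w : (Fin d → ℝ) → ℝ)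
    (dw : (Fin d → ℝ) → (Fin d → ℝ)) : ℝ :=
  sSup {r | ∃ x ∈ X, ∃ y ∈ X, r = bregman w dw x y}

/-- The prox mapping `P_x(ξ) = argmin {V(x, y) + ⟨ξ, y⟩ : y ∈ X}`. For compact convex nonempty `X`
and a mirror map `w` the minimizer exists and is unique. -/
def prox {d : ℕ} (X : Set (Fin d → ℝ)) (w : (Fin d → ℝ) → ℝ)
    (dw : (Fin d → ℝ) → (Fin d → ℝ)) (x ξ : Fin d → ℝ) : Fin d → ℝ :=
  Classical.epsilon fun y => y ∈ X ∧ IsMinOn (fun y' => bregman w dw x y' + ξ ⬝ᵥ y') X y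

/-- The merit function `Err_VI(x) = max {⟨F(u), x - u⟩ : u ∈ X}`. -/
def errVI {d : ℕ} (X : Set (Fin d → ℝ)) (F : (Fin d → ℝ) → (Fin d → ℝ))
    (x : Fin d → ℝ) : ℝ :=
  sSup {r | ∃ u ∈ X, r = F u ⬝ᵥ (x - u)}

/-- The mean of the oracle over the batch `z_{N+1}, …, z_{N+n}` at the point `x`. -/
def batchMean {d : ℕ} {S : Type*} (G : (Fin d → ℝ) → S → (Fin d → ℝ)) (z : ℕ → S)
    (N n : ℕ) (x : Fin d → ℝ) : Fin d → ℝ :=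
  (n : ℝ)⁻¹ • ∑ i ∈ Finset.Icc 1 n, G x (z (N + i))

/-- The multilevel estimator at `x`, built from the samples following `z_N`, at the random
level `J`: `g_0 + 2^J (g_J - g_{J-1})` if `2^J ≤ M` and `g_0` otherwise, where `g_j` is the mean
over a batch of size `2^j B`. -/
def multilevel {d : ℕ} {S : Type*} (G : (Fin d → ℝ) → S → (Fin d → ℝ)) (z : ℕ → S)
    (B M N J : ℕ) (x : Fin d → ℝ) : Fin d → ℝ :=
  batchMean G z N B x +
    if 2 ^ J ≤ M then
      (2 : ℝ) ^ J • (batchMean G z N (2 ^ J * B) x - batchMean G z N (2 ^ (J - 1) * B) x)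
    else 0

/-- The extrapolation step `x^{t+1/2} = P_{x^t}(γ g^{t+1/2})` from `x = x^t` and `N = N_t`. -/
def halfStep {d : ℕ} {S : Type*} (X : Set (Fin d → ℝ)) (w : (Fin d → ℝ) → ℝ)
    (dw : (Fin d → ℝ) → (Fin d → ℝ)) (G : (Fin d → ℝ) → S → (Fin d → ℝ)) (γ : ℝ) (B : ℕ)
    (z : ℕ → S) (x : Fin d → ℝ) (N : ℕ) : Fin d → ℝ :=
  prox X w dw x (γ • batchMean G z N B x)

/-- The state `(x^t, N_t)` of Markovian Mirror-Prox with batching, run on the noise sequence `z`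
and the levels `j`, started at `x0` with `N_0 = 0`. -/
def iter {d : ℕ} {S : Type*} (X : Set (Fin d → ℝ)) (w : (Fin d → ℝ) → ℝ)
    (dw : (Fin d → ℝ) → (Fin d → ℝ)) (G : (Fin d → ℝ) → S → (Fin d → ℝ)) (γ : ℝ) (B M : ℕ)
    (x0 : Fin d → ℝ) (z : ℕ → S) (j : ℕ → ℕ) : ℕ → (Fin d → ℝ) × ℕ
  | 0 => (x0, 0)
  | t + 1 =>
    let x := (iter X w dw G γ B M x0 z j t).1
    let N := (iter X w dw G γ B M x0 z j t).2
    let xh := halfStep X w dw G γ B z x N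
    (prox X w dw x (γ • multilevel G z B M (N + B) (j t) xh), N + B + 2 ^ (j t) * B)

/-- The point `x^{t+1/2}`. -/
def halfIter {d : ℕ} {S : Type*} (X : Set (Fin d → ℝ)) (w : (Fin d → ℝ) → ℝ)
    (dw : (Fin d → ℝ) → (Fin d → ℝ)) (G : (Fin d → ℝ) → S → (Fin d → ℝ)) (γ : ℝ) (B M : ℕ)
    (x0 : Fin d → ℝ) (z : ℕ → S) (j : ℕ → ℕ) (t : ℕ) : Fin d → ℝ :=
  halfStep X w dw G γ B z (iter X w dw G γ B M x0 z j t).1 (iter X w dw G γ B M x0 z j t).2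

/-- The averaged iterate `(1/T) ∑_{t < T} x^{t+1/2}`. -/
def avgIter {d : ℕ} {S : Type*} (X : Set (Fin d → ℝ)) (w : (Fin d → ℝ) → ℝ)
    (dw : (Fin d → ℝ) → (Fin d → ℝ)) (G : (Fin d → ℝ) → S → (Fin d → ℝ)) (γ : ℝ) (B M : ℕ)
    (x0 : Fin d → ℝ) (z : ℕ → S) (j : ℕ → ℕ) (T : ℕ) : Fin d → ℝ :=
  (T : ℝ)⁻¹ • ∑ t ∈ Finset.range T, halfIter X w dw G γ B M x0 z j t

/-- `Z` is a time-homogeneous Markov chain with transition kernel `κ`: the conditional law of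
`Z_{n+1}` given `(Z_0, …, Z_n)` is `κ(Z_n, ·)`. The law of `Z_0` is arbitrary. -/
structure IsMarkovChain {S Ω : Type*} [MeasurableSpace S] [MeasurableSpace Ω]
    (κ : Kernel S S) (Z : ℕ → Ω → S) (μ : Measure Ω) : Prop where
  measurable : ∀ n, Measurable (Z n)
  markov : ∀ n : ℕ, HasCondDistrib (Z (n + 1)) (fun ω (i : Fin (n + 1)) => Z i ω)
    (κ.comap (fun h : Fin (n + 1) → S => h (Fin.last n)) (measurable_pi_apply _)) μ

/-- `κ` is uniformly geometrically ergodic with invariant law `π` and mixing time `τ`: the total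
variation distance of `κ^t(z, ·)` to `π` is at most `K (1/2)^(t/τ)`, uniformly in the initial
state `z`. (This makes `π` the only invariant probability measure.) -/
structure IsUniformlyErgodic {S : Type*} [MeasurableSpace S] (κ : Kernel S S) (π : Measure S)
    (τ : ℕ) (K : ℝ) : Prop where
  invariant : κ.Invariant π
  mixing : ∀ t : ℕ, 1 ≤ t → ∀ z : S, ∀ A : Set S, MeasurableSet A →
    |((κ ^ t) z).real A - π.real A| ≤ K * (1 / 2 : ℝ) ^ ((t : ℝ) / (τ : ℝ))

/-- `J_0, J_1, …` are independent with `P(J_t = k) = 2^{-k}`, `k = 1, 2, …`. -/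
structure IsGeomLevels {Ω : Type*} [MeasurableSpace Ω] (J : ℕ → Ω → ℕ) (μ : Measure Ω) :
    Prop where
  measurable : ∀ t, Measurable (J t)
  law : ∀ t k : ℕ, 1 ≤ k → μ.real {ω | J t ω = k} = (1 / 2 : ℝ) ^ k
  indep : iIndepFun J μ

end

end MMP

/-! Monotonicity and the mirror-prox argument bound ⟨F(u), x^{t+1/2} - u⟩ by telescoping Bregman
terms, γ times squared oracle errors, and the pairing of F(x^{t+1/2}) - g^t with x^{t+1/2} - u. The
maximum over u is taken inside the expectation, so u depends on all the noise and this pairing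
cannot be averaged directly. A ghost mirror descent sequence v^t, driven by the same errors, absorbs
the part with v^t - u at the price of a second D² and one more squared error
(`IsMirrorMap.mirrorProx_step`, `mul_errVI_avgIter_le`). What remains is the pairing with x^{t+1/2}
- v^t, a vector that does not involve the level J_t.

Variance. The mean of n consecutive samples at a point determined by the earlier path has mean
square error at most Λ/n, with Λ of order (1 + log d) τ σ². Up to a factor e the conjugate norm is
an ℓ_q norm with 2 ≤ q ≤ 2(1 + log d), and its square is smooth with constant of order q
(`exists_pNorm_equiv_dualNorm`, `pNorm_sq_smooth`). Along every τ-th sample the distance to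
stationarity decays like 2^{-k}, so truncated solutions of the Poisson equation for κ^τ are
uniformly bounded; adding one to the partial sum turns each transition into a centred perturbation.
Cauchy–Schwarz over the τ residue classes then gives `integral_dualNorm_sum_sq_le`.

Multilevel estimator. Level k carries the weight 4^k in the square, a batch error of order Λ/(2^k B)
and the probability 2^{-k}. Every level thus costs order Λ/B, and there are about log M of them. In
the pairing with x^{t+1/2} - v^t, averaging over J_t telescopes the levels exactly to the error of
the largest batch, whose size exceeds MB/2 (`integral_levelErr_dotProduct`). Young's inequality with
weight γT bounds this by D²/(γT) + γTΛ/(MB), so only second moments are needed, and no separate bias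
estimate.

The sampling times N_t are random, but they are functions of the levels alone. The levels are
independent of the chain, so the moment bounds are proved with the levels frozen, where N_t is a
constant, and are then integrated by Fubini. -/

namespace MMP

/-! ### The ℓ_p norm, its conjugate, and smoothness of the squared ℓ_q norm -/

section Norms

variable {d : ℕ} {p : ℝ}

lemma pNorm_nonneg (x : Fin d → ℝ) : 0 ≤ pNorm p x :=
  Real.rpow_nonneg (Finset.sum_nonneg fun _ _ => Real.rpow_nonneg (abs_nonneg _) _) _

lemma sum_abs_rpow_nonneg (x : Fin d → ℝ) : 0 ≤ ∑ i, |x i| ^ p :=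
  Finset.sum_nonneg fun _ _ => Real.rpow_nonneg (abs_nonneg _) _

lemma pNorm_add_le (hp : 1 ≤ p) (x y : Fin d → ℝ) : pNorm p (x + y) ≤ pNorm p x + pNorm p y :=
  Real.Lp_add_le _ _ _ hp

lemma pNorm_smul (hp : 1 ≤ p) (c : ℝ) (x : Fin d → ℝ) : pNorm p (c • x) = |c| * pNorm p x := by
  have hp0 : p ≠ 0 := by linarith
  simp only [pNorm, Pi.smul_apply, smul_eq_mul, abs_mul]
  simp_rw [Real.mul_rpow (abs_nonneg _) (abs_nonneg _)]
  rw [← Finset.mul_sum, Real.mul_rpow (by positivity) (sum_abs_rpow_nonneg x),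
    ← Real.rpow_mul (abs_nonneg _),
    mul_one_div_cancel hp0, Real.rpow_one]

lemma pNorm_neg (x : Fin d → ℝ) : pNorm p (-x) = pNorm p x := by
  simp [pNorm]

lemma pNorm_sub_comm (x y : Fin d → ℝ) : pNorm p (x - y) = pNorm p (y - x) := by
  rw [← neg_sub, pNorm_neg]

lemma pNorm_rpow (hp : 1 ≤ p) (x : Fin d → ℝ) : pNorm p x ^ p = ∑ i, |x i| ^ p := by
  rw [pNorm, ← Real.rpow_mul (sum_abs_rpow_nonneg x), one_div_mul_cancel (by linarith),
    Real.rpow_one]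

lemma pNorm_zero (hp : 1 ≤ p) : pNorm p (0 : Fin d → ℝ) = 0 := by
  simpa using pNorm_smul hp 0 (0 : Fin d → ℝ)

lemma abs_apply_le_pNorm (hp : 1 ≤ p) (x : Fin d → ℝ) (i : Fin d) : |x i| ≤ pNorm p x := by
  have h : |x i| ^ p ≤ pNorm p x ^ p := by
    rw [pNorm_rpow hp]
    exact Finset.single_le_sum (f := fun i => |x i| ^ p)
      (fun _ _ => Real.rpow_nonneg (abs_nonneg _) _) (Finset.mem_univ i)
  exact (Real.rpow_le_rpow_iff (abs_nonneg _) (pNorm_nonneg x) (by linarith)).1 h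

lemma eq_of_pNorm_sub_eq_zero (hp : 1 ≤ p) {x y : Fin d → ℝ} (h : pNorm p (x - y) = 0) :
    x = y := by
  ext i
  have := abs_apply_le_pNorm hp (x - y) i
  rw [h] at this
  have := abs_nonpos_iff.1 this
  simpa [sub_eq_zero] using this

lemma pNorm_le_one_iff (hp : 1 ≤ p) (x : Fin d → ℝ) : pNorm p x ≤ 1 ↔ ∑ i, |x i| ^ p ≤ 1 := by
  rw [← pNorm_rpow hp, ← Real.rpow_le_rpow_iff (pNorm_nonneg x) zero_le_one (by linarith : 0 < p),
    Real.one_rpow]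

lemma continuous_pNorm (hp : 1 ≤ p) : Continuous (pNorm p : (Fin d → ℝ) → ℝ) := by
  unfold pNorm
  refine Continuous.rpow_const (continuous_finsetSum _ fun i _ => ?_) fun _ =>
    Or.inr (by positivity)
  exact Continuous.rpow_const (by fun_prop) fun _ => Or.inr (by positivity)

lemma bddAbove_dualNorm (hp : 1 ≤ p) (ξ : Fin d → ℝ) :
    BddAbove {r | ∃ z : Fin d → ℝ, pNorm p z ≤ 1 ∧ r = ξ ⬝ᵥ z} := by
  refine ⟨∑ i, |ξ i|, ?_⟩
  rintro r ⟨z, hz, rfl⟩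
  refine Finset.sum_le_sum fun i _ => (le_abs_self _).trans ?_
  rw [abs_mul]
  exact mul_le_of_le_one_right (abs_nonneg _) ((abs_apply_le_pNorm hp z i).trans hz)

lemma dotProduct_le_dualNorm (hp : 1 ≤ p) (ξ : Fin d → ℝ) {z : Fin d → ℝ} (hz : pNorm p z ≤ 1) :
    ξ ⬝ᵥ z ≤ dualNorm p ξ :=
  le_csSup (bddAbove_dualNorm hp ξ) ⟨z, hz, rfl⟩

lemma dualNorm_le (hp : 1 ≤ p) {ξ : Fin d → ℝ} {c : ℝ} (h : ∀ z, pNorm p z ≤ 1 → ξ ⬝ᵥ z ≤ c) :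
    dualNorm p ξ ≤ c := by
  refine csSup_le ⟨0, 0, ?_, by simp⟩ ?_
  · rw [pNorm_zero hp]; exact zero_le_one
  · rintro r ⟨z, hz, rfl⟩; exact h z hz

lemma dualNorm_nonneg (hp : 1 ≤ p) (ξ : Fin d → ℝ) : 0 ≤ dualNorm p ξ := by
  simpa using dotProduct_le_dualNorm hp ξ (z := 0) (by rw [pNorm_zero hp]; exact zero_le_one)

lemma dotProduct_le (hp : 1 ≤ p) (ξ z : Fin d → ℝ) : ξ ⬝ᵥ z ≤ dualNorm p ξ * pNorm p z := by
  rcases (pNorm_nonneg (p := p) z).eq_or_lt with h | h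
  · have : z = 0 := eq_of_pNorm_sub_eq_zero hp (by rw [sub_zero, ← h])
    subst this
    simp [pNorm_zero hp]
  · have := dotProduct_le_dualNorm hp ξ (z := (pNorm p z)⁻¹ • z)
      (by rw [pNorm_smul hp, abs_of_pos (inv_pos.2 h), inv_mul_cancel₀ h.ne'])
    rw [dotProduct_smul, smul_eq_mul, inv_mul_le_iff₀ h] at this
    linarith

lemma dualNorm_add_le (hp : 1 ≤ p) (ξ η : Fin d → ℝ) :
    dualNorm p (ξ + η) ≤ dualNorm p ξ + dualNorm p η :=
  dualNorm_le hp fun z hz => by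
    rw [add_dotProduct]
    exact add_le_add (dotProduct_le_dualNorm hp ξ hz) (dotProduct_le_dualNorm hp η hz)

lemma dualNorm_smul_le (hp : 1 ≤ p) (c : ℝ) (ξ : Fin d → ℝ) :
    dualNorm p (c • ξ) ≤ |c| * dualNorm p ξ :=
  dualNorm_le hp fun z hz => by
    have h : (c • ξ) ⬝ᵥ z = ξ ⬝ᵥ (c • z) := by rw [smul_dotProduct, dotProduct_smul]
    rw [h]
    refine (dotProduct_le hp _ _).trans ?_
    rw [pNorm_smul hp]
    nlinarith [mul_le_mul_of_nonneg_left hz (mul_nonneg (dualNorm_nonneg hp ξ) (abs_nonneg c))]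

lemma dualNorm_neg (hp : 1 ≤ p) (ξ : Fin d → ℝ) : dualNorm p (-ξ) = dualNorm p ξ := by
  have h : ∀ η : Fin d → ℝ, dualNorm p (-η) ≤ dualNorm p η := fun η => by
    simpa using dualNorm_smul_le hp (-1) η
  exact le_antisymm (h ξ) (by simpa using h (-ξ))

lemma dualNorm_sub_comm (hp : 1 ≤ p) (ξ η : Fin d → ℝ) :
    dualNorm p (ξ - η) = dualNorm p (η - ξ) := by
  rw [← neg_sub, dualNorm_neg hp]

lemma dualNorm_zero (hp : 1 ≤ p) : dualNorm p (0 : Fin d → ℝ) = 0 :=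
  le_antisymm (dualNorm_le hp fun z _ => by simp) (dualNorm_nonneg hp 0)

lemma dualNorm_sum_le (hp : 1 ≤ p) {ι : Type*} (s : Finset ι) (f : ι → Fin d → ℝ) :
    dualNorm p (∑ i ∈ s, f i) ≤ ∑ i ∈ s, dualNorm p (f i) := by
  classical
  induction s using Finset.induction_on with
  | empty => simp [dualNorm_zero hp]
  | insert a s ha ih =>
    rw [Finset.sum_insert ha, Finset.sum_insert ha]
    exact (dualNorm_add_le hp _ _).trans (by gcongr)

lemma abs_apply_le_dualNorm (hp : 1 ≤ p) (ξ : Fin d → ℝ) (i : Fin d) :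
    |ξ i| ≤ dualNorm p ξ := by
  have hz : pNorm p (Pi.single i (1 : ℝ) : Fin d → ℝ) ≤ 1 := by
    rw [pNorm_le_one_iff hp, Finset.sum_eq_single i]
    · simp
    · intro j _ hj
      rw [Pi.single_eq_of_ne hj, abs_zero, Real.zero_rpow (by linarith)]
    · simp
  refine abs_le'.2 ⟨?_, ?_⟩
  · simpa using dotProduct_le_dualNorm hp ξ hz
  · simpa [dualNorm_neg hp] using dotProduct_le_dualNorm hp (-ξ) hz

lemma dualNorm_le_mul_norm (hp : 1 ≤ p) (ξ : Fin d → ℝ) : dualNorm p ξ ≤ d * ‖ξ‖ := by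
  refine dualNorm_le hp fun z hz => ?_
  have : ∀ i ∈ Finset.univ, ξ i * z i ≤ ‖ξ‖ := fun i _ => by
    refine (le_abs_self _).trans ?_
    rw [abs_mul]
    exact (mul_le_of_le_one_right (abs_nonneg _) ((abs_apply_le_pNorm hp z i).trans hz)).trans
      (norm_le_pi_norm ξ i)
  simpa [dotProduct] using Finset.sum_le_card_nsmul _ _ _ this

lemma continuous_dualNorm (hp : 1 ≤ p) : Continuous (dualNorm p : (Fin d → ℝ) → ℝ) := by
  refine (LipschitzWith.of_le_add_mul d fun ξ η => ?_).continuous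
  have := dualNorm_add_le hp (ξ - η) η
  rw [sub_add_cancel] at this
  have h := dualNorm_le_mul_norm hp (ξ - η)
  rw [dist_eq_norm]
  push_cast
  linarith

lemma abs_rpow_eq_sq_rpow (x q : ℝ) : |x| ^ q = (x ^ 2) ^ (q / 2) := by
  rw [← sq_abs, ← Real.rpow_natCast, ← Real.rpow_mul (abs_nonneg _)]
  congr 1
  push_cast
  ring

/-- From 1 + s ≤ e^s and cosh r ≤ exp(r²/2), the left side is at most 2 exp(q² t²/2) = 2 (exp(q
t²))^{q/2}; on [0, 1] moreover e^r ≤ 1 + 2r. -/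
lemma two_point_of_small {q t : ℝ} (hq : 2 ≤ q) (ht : q * t ^ 2 ≤ 1) :
    |1 + t| ^ q + |1 - t| ^ q ≤ 2 * (1 + 2 * q * t ^ 2) ^ (q / 2) := by
  have ht1 : |t| ≤ 1 := by
    rw [← sq_le_one_iff_abs_le_one]; nlinarith [sq_nonneg t]
  obtain ⟨h1, h2⟩ := abs_le.1 ht1
  have key : ∀ s : ℝ, -1 ≤ s → |1 + s| ^ q ≤ Real.exp (q * s) := fun s hs => by
    rw [abs_of_nonneg (by linarith), mul_comm, Real.exp_mul]
    exact Real.rpow_le_rpow (by linarith) (by linarith [Real.add_one_le_exp s]) (by linarith)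
  have hc : Real.exp (q * t) + Real.exp (q * -t) ≤ 2 * Real.exp ((q * t) ^ 2 / 2) := by
    have := Real.cosh_le_exp_half_sq (q * t)
    rw [Real.cosh_eq] at this
    rw [mul_neg]
    linarith
  have he : Real.exp ((q * t) ^ 2 / 2) ≤ (1 + 2 * q * t ^ 2) ^ (q / 2) := by
    have hs : Real.exp (q * t ^ 2) ≤ 1 + 2 * q * t ^ 2 := by
      have h0 : 0 ≤ q * t ^ 2 := by positivity
      have := Real.abs_exp_sub_one_sub_id_le (x := q * t ^ 2) (by rwa [abs_of_nonneg h0])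
      have := (abs_le.1 this).2
      nlinarith
    calc Real.exp ((q * t) ^ 2 / 2) = Real.exp (q * t ^ 2) ^ (q / 2) := by
          rw [← Real.exp_mul]; congr 1; ring
      _ ≤ _ := Real.rpow_le_rpow (Real.exp_pos _).le hs (by linarith)
  have a1 := key t h1
  have a2 := key (-t) (by linarith)
  rw [← sub_eq_add_neg] at a2
  linarith

/-- When q b² ≤ a², homogeneity reduces to `two_point_of_small`. Otherwise |a| ≤ √q |b|, and then (a
+ b)² and (a - b)² are each at most a² + 2 q b², so the two terms can be bounded separately. -/
lemma two_point {q : ℝ} (hq : 2 ≤ q) (a b : ℝ) :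
    |a + b| ^ q + |a - b| ^ q ≤ 2 * (a ^ 2 + 2 * q * b ^ 2) ^ (q / 2) := by
  rcases le_or_gt (q * b ^ 2) (a ^ 2) with h | h
  · rcases eq_or_ne a 0 with rfl | ha
    · have hb : b = 0 := by
        have : q * b ^ 2 ≤ 0 := by simpa using h
        have : b ^ 2 ≤ 0 := by nlinarith [sq_nonneg b]
        exact pow_eq_zero_iff two_ne_zero |>.1 (le_antisymm this (sq_nonneg b))
      subst hb
      simp [Real.zero_rpow (show q ≠ 0 by linarith), Real.zero_rpow (show q / 2 ≠ 0 by linarith)]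
    · have ha2 : 0 < a ^ 2 := by positivity
      have := two_point_of_small (q := q) (t := b / a) hq (by
        rw [div_pow, ← mul_div_assoc, div_le_one ha2]; exact h)
      have e1 : a + b = a * (1 + b / a) := by field_simp
      have e2 : a - b = a * (1 - b / a) := by field_simp
      have e3 : a ^ 2 + 2 * q * b ^ 2 = a ^ 2 * (1 + 2 * q * (b / a) ^ 2) := by field_simp
      rw [e1, e2, e3, abs_mul, abs_mul, Real.mul_rpow (abs_nonneg _) (abs_nonneg _),
        Real.mul_rpow (abs_nonneg _) (abs_nonneg _), Real.mul_rpow ha2.le (by positivity),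
        ← abs_rpow_eq_sq_rpow]
      have hpos : 0 ≤ |a| ^ q := by positivity
      nlinarith [mul_le_mul_of_nonneg_left this hpos]
  · set s := Real.sqrt q with hs
    have hs2 : s ^ 2 = q := Real.sq_sqrt (by linarith)
    -- The later inequality 2√q + 1 ≤ 2q needs √q ≥ (1 + √3)/2 ≈ 1.37.
    have hs1 : 1.4 ≤ s := Real.le_sqrt_of_sq_le (by norm_num; linarith)
    have hab : |a| ≤ s * |b| := by
      refine abs_le_of_sq_le_sq' ?_ (by positivity) |>.2
      rw [mul_pow, sq_abs, sq_abs, hs2]; exact h.le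
    have hm : 2 * (|a| * |b|) + b ^ 2 ≤ 2 * q * b ^ 2 := by
      have h1 : |a| * |b| ≤ s * b ^ 2 := by
        rw [← sq_abs b]; nlinarith [abs_nonneg b]
      have h2 : (2 * s + 1) * b ^ 2 ≤ 2 * q * b ^ 2 := by
        refine mul_le_mul_of_nonneg_right ?_ (sq_nonneg b)
        nlinarith
      linarith
    have hp : (a + b) ^ 2 ≤ a ^ 2 + 2 * q * b ^ 2 := by
      have := le_abs_self (a * b); rw [abs_mul] at this; nlinarith
    have hn : (a - b) ^ 2 ≤ a ^ 2 + 2 * q * b ^ 2 := by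
      have := neg_abs_le (a * b); rw [abs_mul] at this; nlinarith
    rw [abs_rpow_eq_sq_rpow, abs_rpow_eq_sq_rpow]
    have := Real.rpow_le_rpow (sq_nonneg _) hp (show 0 ≤ q / 2 by linarith)
    have := Real.rpow_le_rpow (sq_nonneg _) hn (show 0 ≤ q / 2 by linarith)
    linarith

/-- The two-point inequality of type 2 for the `ℓ_q` norm, `q ≥ 2`. -/
lemma pNorm_two_point {q : ℝ} (hq : 2 ≤ q) (x y : Fin d → ℝ) :
    pNorm q (x + y) ^ 2 + pNorm q (x - y) ^ 2 ≤ 2 * (pNorm q x ^ 2 + 2 * q * pNorm q y ^ 2) := by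
  have hq1 : 1 ≤ q := by linarith
  have hh : 1 ≤ q / 2 := by linarith
  have hsq : ∀ v : Fin d → ℝ, pNorm (q / 2) (fun i => v i ^ 2) = pNorm q v ^ 2 := fun v => by
    have h1 : ∀ i, |v i ^ 2| ^ (q / 2) = |v i| ^ q := fun i => by
      rw [abs_of_nonneg (sq_nonneg (v i)), abs_rpow_eq_sq_rpow (v i)]
    simp only [pNorm, h1]
    rw [← Real.rpow_natCast, ← Real.rpow_mul (sum_abs_rpow_nonneg v)]
    congr 1
    push_cast
    field_simp
  set R := pNorm q x ^ 2 + 2 * q * pNorm q y ^ 2 with hR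
  have hR0 : 0 ≤ R := by positivity
  -- Minkowski's inequality for the vectors of squares in ℓ_{q/2}, available because q ≥ 2;
  -- convexity of r^{q/2} later returns from q-th powers to squares.
  have hmink : pNorm (q / 2) (fun i => x i ^ 2 + 2 * q * y i ^ 2) ≤ R := by
    have := pNorm_add_le hh (fun i => x i ^ 2) ((2 * q) • fun i => y i ^ 2)
    rw [pNorm_smul hh, hsq, hsq, abs_of_nonneg (by linarith)] at this
    exact this
  have hsum : pNorm q (x + y) ^ q + pNorm q (x - y) ^ q ≤ 2 * R ^ (q / 2) := by
    rw [pNorm_rpow hq1, pNorm_rpow hq1, ← Finset.sum_add_distrib]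
    calc _ ≤ ∑ i, 2 * (x i ^ 2 + 2 * q * y i ^ 2) ^ (q / 2) :=
          Finset.sum_le_sum fun i _ => two_point hq (x i) (y i)
      _ = 2 * pNorm (q / 2) (fun i => x i ^ 2 + 2 * q * y i ^ 2) ^ (q / 2) := by
          rw [pNorm_rpow hh, Finset.mul_sum]
          refine Finset.sum_congr rfl fun i _ => ?_
          rw [abs_of_nonneg (by positivity)]
      _ ≤ _ := by
          gcongr
          exact pNorm_nonneg _
  have hmean := (convexOn_rpow hh).2 (Set.mem_Ici.2 (sq_nonneg (pNorm q (x + y))))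
    (Set.mem_Ici.2 (sq_nonneg (pNorm q (x - y)))) (by norm_num : (0 : ℝ) ≤ 1 / 2)
    (by norm_num : (0 : ℝ) ≤ 1 / 2) (by norm_num)
  simp only [smul_eq_mul] at hmean
  rw [← abs_rpow_eq_sq_rpow, ← abs_rpow_eq_sq_rpow, abs_of_nonneg (pNorm_nonneg _),
    abs_of_nonneg (pNorm_nonneg _)] at hmean
  have := (Real.rpow_le_rpow_iff (by positivity) hR0 (by linarith : 0 < q / 2)).1
    (hmean.trans (by linarith))
  linarith

/-- Hölder's inequality is sharp: the `ℓ_q` norm is attained on the unit ball of the conjugate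
norm. -/
lemma exists_dotProduct_eq_pNorm {q : ℝ} (hpq : p.HolderConjugate q) (ξ : Fin d → ℝ) :
    ∃ z : Fin d → ℝ, pNorm p z ≤ 1 ∧ ξ ⬝ᵥ z = pNorm q ξ := by
  obtain ⟨g, hg, hgs⟩ :=
    (NNReal.isGreatest_Lp Finset.univ (fun i => Real.nnabs (ξ i)) hpq.symm).1
  refine ⟨fun i => SignType.sign (ξ i) * g i, ?_, ?_⟩
  · rw [pNorm_le_one_iff hpq.lt.le]
    have hg' : ∑ i, (g i : ℝ) ^ p ≤ 1 := by
      have : ∑ i, g i ^ p ≤ 1 := hg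
      exact_mod_cast this
    refine (Finset.sum_le_sum fun i _ => ?_).trans hg'
    refine Real.rpow_le_rpow (abs_nonneg _) ?_ hpq.nonneg
    rw [abs_mul, abs_of_nonneg (g i).coe_nonneg]
    refine mul_le_of_le_one_left (g i).coe_nonneg ?_
    rcases lt_trichotomy (ξ i) 0 with h | h | h <;> simp [h]
  · have h := congrArg (fun r : NNReal => (r : ℝ)) hgs
    simp only [NNReal.coe_sum, NNReal.coe_mul, NNReal.coe_rpow, Real.coe_nnabs] at h
    rw [pNorm, ← h, dotProduct]
    refine Finset.sum_congr rfl fun i _ => ?_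
    rw [← mul_assoc, mul_comm (ξ i), sign_mul_self]

/-- Smoothness of the squared `ℓ_q` norm, `q ≥ 2`. -/
lemma pNorm_sq_smooth {q : ℝ} (hq : 2 ≤ q) (x : Fin d → ℝ) :
    ∃ g : Fin d → ℝ, ∀ y : Fin d → ℝ,
      pNorm q (x + y) ^ 2 ≤ pNorm q x ^ 2 + g ⬝ᵥ y + 4 * q * pNorm q y ^ 2 := by
  have hq1 : 1 < q := by linarith
  have hpq := (Real.HolderConjugate.conjExponent hq1).symm
  obtain ⟨z, hz, hxz⟩ := exists_dotProduct_eq_pNorm hpq x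
  have hle : ∀ v : Fin d → ℝ, v ⬝ᵥ z ≤ pNorm q v := fun v => by
    refine (Real.inner_le_Lp_mul_Lq Finset.univ v z hpq.symm).trans ?_
    exact mul_le_of_le_one_right (pNorm_nonneg v) hz
  -- As z norms x, the vector 2‖x‖z is a subgradient of the squared norm at x. Hence ‖x - y‖² ≥ ‖x‖²
  -- - ⟨g, y⟩, and the two-point inequality turns this lower bound into an upper bound for ‖x + y‖².
  refine ⟨(2 * pNorm q x) • z, fun y => ?_⟩
  have h1 := pNorm_two_point hq x y
  have h2 := hle (x - y)
  rw [sub_dotProduct, hxz] at h2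
  rw [smul_dotProduct, smul_eq_mul, dotProduct_comm z y]
  nlinarith [sq_nonneg (pNorm q x - pNorm q (x - y)),
    mul_le_mul_of_nonneg_left h2 (pNorm_nonneg (p := q) x)]

lemma pNorm_le_one_of_le {p' : ℝ} (hp : 1 ≤ p) (hpp : p ≤ p') {z : Fin d → ℝ}
    (hz : pNorm p z ≤ 1) : pNorm p' z ≤ 1 := by
  rw [pNorm_le_one_iff (hp.trans hpp)]
  refine (Finset.sum_le_sum fun i _ => ?_).trans ((pNorm_le_one_iff hp z).1 hz)
  exact Real.rpow_le_rpow_of_exponent_ge' (abs_nonneg _) ((abs_apply_le_pNorm hp z i).trans hz)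
    (by linarith) hpp

lemma pNorm_le_card_rpow_mul {p' : ℝ} (hp : 1 ≤ p) (hpp : p ≤ p') (z : Fin d → ℝ) :
    pNorm p z ≤ (d : ℝ) ^ (1 / p - 1 / p') * pNorm p' z := by
  have hp0 : 0 < p := by linarith
  have hp0' : 0 < p' := by linarith
  have h := Real.rpow_sum_le_const_mul_sum_rpow Finset.univ (fun i => |z i| ^ p)
    ((one_le_div hp0).2 hpp)
  have h2 : ∀ i, (|z i| ^ p) ^ (p' / p) = |z i| ^ p' := fun i => by
    rw [← Real.rpow_mul (abs_nonneg _)]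
    congr 1
    field_simp
  have h3 : ∀ i, |(|z i| ^ p)| = |z i| ^ p := fun i => abs_of_nonneg (by positivity)
  simp only [h3, h2, Finset.card_univ, Fintype.card_fin] at h
  have h4 := Real.rpow_le_rpow (Real.rpow_nonneg (sum_abs_rpow_nonneg z) _) h
    (by positivity : 0 ≤ 1 / p')
  rw [← Real.rpow_mul (sum_abs_rpow_nonneg z),
    Real.mul_rpow (by positivity) (sum_abs_rpow_nonneg z), ← Real.rpow_mul (by positivity)] at h4
  have e1 : p' / p * (1 / p') = 1 / p := by field_simp
  have e2 : (p' / p - 1) * (1 / p') = 1 / p - 1 / p' := by field_simp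
  rwa [e1, e2] at h4

/-- The conjugate norm of `ℓ_p` is equivalent, with an absolute constant, to an `ℓ_q` norm with
`q` of order at most `1 + log d`. -/
lemma exists_pNorm_equiv_dualNorm (d : ℕ) {p : ℝ} (hp : 1 ≤ p) (hp2 : p ≤ 2) :
    ∃ q : ℝ, 2 ≤ q ∧ q ≤ 2 * (1 + Real.log d) ∧ ∀ ξ : Fin d → ℝ,
      dualNorm p ξ ≤ pNorm q ξ ∧ pNorm q ξ ≤ Real.exp 1 * dualNorm p ξ := by
  have hlog : 0 ≤ Real.log d := Real.log_natCast_nonneg d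
  have main : ∀ q p' : ℝ, p'.HolderConjugate q → p ≤ p' →
      (d : ℝ) ^ (1 / p - 1 / p') ≤ Real.exp 1 → ∀ ξ : Fin d → ℝ,
      dualNorm p ξ ≤ pNorm q ξ ∧ pNorm q ξ ≤ Real.exp 1 * dualNorm p ξ := by
    intro q p' hpq hpp hd ξ
    constructor
    · refine dualNorm_le hp fun z hz => ?_
      refine (Real.inner_le_Lp_mul_Lq Finset.univ ξ z hpq.symm).trans ?_
      exact mul_le_of_le_one_right (pNorm_nonneg ξ) (pNorm_le_one_of_le hp hpp hz)
    · obtain ⟨z, hz, hξ⟩ := exists_dotProduct_eq_pNorm hpq ξ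
      rw [← hξ]
      refine (dotProduct_le hp ξ z).trans ?_
      have h1 : pNorm p z ≤ Real.exp 1 := by
        refine (pNorm_le_card_rpow_mul hp hpp z).trans ?_
        calc _ ≤ Real.exp 1 * 1 := mul_le_mul hd hz (pNorm_nonneg z) (Real.exp_pos 1).le
          _ = _ := mul_one _
      nlinarith [mul_le_mul_of_nonneg_left h1 (dualNorm_nonneg hp ξ)]
  -- For q₀ ≥ log d (and d ≥ 1) the comparison factor d^{1/q₀} is at most e; the floor 2 keeps the
  -- smoothness of the squared norm.
  set q₀ : ℝ := max 2 (Real.log d) with hq₀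
  have h2q : 2 ≤ q₀ := le_max_left _ _
  have hq₀le : q₀ ≤ 2 * (1 + Real.log d) := max_le (by linarith) (by linarith)
  have hc := Real.HolderConjugate.conjExponent (show 1 < q₀ by linarith)
  rcases le_total p q₀.conjExponent with h | h
  · refine ⟨q₀, h2q, hq₀le, main q₀ _ hc.symm h ?_⟩
    rcases Nat.eq_zero_or_pos d with rfl | hd
    · have : (1 : ℝ) ≤ Real.exp 1 := Real.one_le_exp zero_le_one
      rcases eq_or_ne (1 / p - 1 / q₀.conjExponent) 0 with h0 | h0
      · rw [h0, Real.rpow_zero]; exact this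
      · rw [Nat.cast_zero, Real.zero_rpow h0]; linarith
    · have hd' : (0 : ℝ) < d := by exact_mod_cast hd
      rw [Real.rpow_def_of_pos hd', Real.exp_le_exp]
      have h1 : 1 / p - 1 / q₀.conjExponent ≤ 1 / q₀ := by
        have := hc.inv_add_inv_eq_one
        have h3 : 1 / p ≤ 1 := by rw [div_le_one (by linarith)]; exact hp
        simp only [one_div] at *
        linarith
      calc Real.log d * (1 / p - 1 / q₀.conjExponent) ≤ Real.log d * (1 / q₀) := by gcongr
        _ = Real.log d / q₀ := by ring
        _ ≤ 1 := by rw [div_le_one (by linarith)]; exact le_max_right _ _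
  -- Here the exponent conjugate to p already lies in [2, q₀], so the conjugate norm is itself an
  -- ℓ_q norm and the comparison factor is 1.
  · have hp1 : 1 < p := hc.symm.lt.trans_le h
    have hcp := Real.HolderConjugate.conjExponent hp1
    have hinv := hcp.inv_add_inv_eq_one
    have hinv₀ := hc.inv_add_inv_eq_one
    have hpos := hcp.symm.pos
    have a1 : p⁻¹ ≤ q₀.conjExponent⁻¹ := inv_anti₀ hc.symm.pos h
    refine ⟨p.conjExponent, ?_, le_trans ?_ hq₀le, main _ p hcp le_rfl ?_⟩
    · have : (2 : ℝ)⁻¹ ≤ p⁻¹ := inv_anti₀ (by linarith) hp2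
      exact (inv_le_inv₀ hpos two_pos).1 (by linarith)
    · exact (inv_le_inv₀ (by linarith) hpos).1 (by linarith)
    · rw [sub_self, Real.rpow_zero]; exact Real.one_le_exp zero_le_one

end Norms

/-! ### Bregman divergence, prox mapping and one mirror-prox step -/

section MirrorMap

variable {d : ℕ} {p : ℝ} {X : Set (Fin d → ℝ)} {w : (Fin d → ℝ) → ℝ}
  {dw : (Fin d → ℝ) → (Fin d → ℝ)}

lemma bregman_three_point (x y u : Fin d → ℝ) :
    bregman w dw x u - bregman w dw y u - bregman w dw x y = (dw y - dw x) ⬝ᵥ (u - y) := by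
  simp only [bregman, sub_dotProduct, dotProduct_sub]
  ring

lemma bregman_self (x : Fin d → ℝ) : bregman w dw x x = 0 := by simp [bregman]

/-- Strong convexity on the segment, combined with the subgradient inequality at x and divided by b,
gives the bound with a factor 1 - b; then b → 0. -/
lemma IsMirrorMap.half_sq_le_bregman (hw : IsMirrorMap p X w dw) (hX : Convex ℝ X)
    {x y : Fin d → ℝ} (hx : x ∈ X) (hy : y ∈ X) :
    pNorm p (x - y) ^ 2 / 2 ≤ bregman w dw x y := by
  have h : ∀ b ∈ Set.Ioc (0 : ℝ) 1, (1 - b) * (pNorm p (x - y) ^ 2 / 2) ≤ bregman w dw x y := by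
    rintro b ⟨hb0, hb1⟩
    have hmem := hX hx hy (sub_nonneg.2 hb1) hb0.le (by ring)
    have h1 := hw.strongConvex x hx y hy (1 - b) b (sub_nonneg.2 hb1) hb0.le (by ring)
    have h2 := hw.subgradient x hx _ hmem
    have e : (1 - b) • x + b • y - x = b • (y - x) := by module
    rw [e, dotProduct_smul, smul_eq_mul] at h2
    refine le_of_mul_le_mul_left ?_ hb0
    rw [bregman]
    nlinarith
  have ht : Filter.Tendsto (fun b : ℝ => (1 - b) * (pNorm p (x - y) ^ 2 / 2))
      (nhdsWithin 0 (Set.Ioi 0)) (nhds ((1 - 0) * (pNorm p (x - y) ^ 2 / 2))) :=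
    (Continuous.tendsto (by fun_prop) _).mono_left nhdsWithin_le_nhds
  rw [sub_zero, one_mul] at ht
  exact le_of_tendsto ht (Filter.eventually_of_mem (Ioc_mem_nhdsGT one_pos) h)

/-- The subgradient inequality at x bounds w(y) from below and the one at y bounds it from above;
both bounds tend to w(x), the upper one by continuity of `dw`. -/
lemma IsMirrorMap.continuousOn_map (hw : IsMirrorMap p X w dw) : ContinuousOn w X := by
  intro x hx
  have hsub : Filter.Tendsto (fun y : Fin d → ℝ => y - x) (nhdsWithin x X) (nhds 0) := by
    have : Filter.Tendsto (fun y : Fin d → ℝ => y - x) (nhds x) (nhds (x - x)) :=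
      Continuous.tendsto (by fun_prop) x
    rw [sub_self] at this
    exact this.mono_left nhdsWithin_le_nhds
  have hl : Filter.Tendsto (fun y => w x + dw x ⬝ᵥ (y - x)) (nhdsWithin x X) (nhds (w x)) := by
    have : Continuous fun v : Fin d → ℝ => w x + dw x ⬝ᵥ v := by
      simp only [dotProduct]; fun_prop
    simpa [Function.comp_def, -dotProduct_sub] using (this.tendsto 0).comp hsub
  have hu : Filter.Tendsto (fun y => w x + dw y ⬝ᵥ (y - x)) (nhdsWithin x X) (nhds (w x)) := by
    have hc : Continuous fun q : (Fin d → ℝ) × (Fin d → ℝ) => w x + q.1 ⬝ᵥ q.2 := by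
      simp only [dotProduct]; fun_prop
    simpa [Function.comp_def, -dotProduct_sub] using (hc.tendsto (dw x, 0)).comp
      ((hw.continuousOn x hx).tendsto.prodMk_nhds hsub)
  refine tendsto_of_tendsto_of_tendsto_of_le_of_le' hl hu ?_ ?_
  · filter_upwards [self_mem_nhdsWithin] with y hy using hw.subgradient x hx y hy
  · filter_upwards [self_mem_nhdsWithin] with y hy
    have := hw.subgradient y hy x hx
    rw [← neg_sub y x, dotProduct_neg] at this
    linarith

/-- As w need not be differentiable, minimality is tested with the subgradient at the moved point y
+ s(u - y), which bounds the increase of w from above. Continuity of `dw` then lets s → 0 and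
produces the selected subgradient at y. -/
lemma IsMirrorMap.vi_of_isMinOn (hw : IsMirrorMap p X w dw) (hX : Convex ℝ X)
    {x ξ y u : Fin d → ℝ} (hy : y ∈ X) (hu : u ∈ X)
    (hmin : IsMinOn (fun y' => bregman w dw x y' + ξ ⬝ᵥ y') X y) :
    0 ≤ (ξ + dw y - dw x) ⬝ᵥ (u - y) := by
  have hmem : ∀ s ∈ Set.Ioc (0 : ℝ) 1, y + s • (u - y) ∈ X := fun s hs =>
    hX.add_smul_sub_mem hy hu ⟨hs.1.le, hs.2⟩
  have h : ∀ s ∈ Set.Ioc (0 : ℝ) 1, 0 ≤ (ξ + dw (y + s • (u - y)) - dw x) ⬝ᵥ (u - y) := by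
    intro s hs
    have h1 : bregman w dw x y + ξ ⬝ᵥ y ≤
        bregman w dw x (y + s • (u - y)) + ξ ⬝ᵥ (y + s • (u - y)) := hmin (hmem s hs)
    have h2 := hw.subgradient _ (hmem s hs) y hy
    have e : y - (y + s • (u - y)) = -(s • (u - y)) := by abel
    rw [e, dotProduct_neg, dotProduct_smul, smul_eq_mul] at h2
    refine nonneg_of_mul_nonneg_right (a := s) ?_ hs.1
    simp only [bregman, dotProduct_add, dotProduct_sub, dotProduct_smul, smul_eq_mul,
      sub_dotProduct, add_dotProduct] at *
    linarith
  have hc : Filter.Tendsto (fun s : ℝ => y + s • (u - y)) (nhdsWithin 0 (Set.Ioi 0))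
      (nhdsWithin y X) := by
    refine tendsto_nhdsWithin_iff.2 ⟨?_, Filter.eventually_of_mem (Ioc_mem_nhdsGT one_pos) hmem⟩
    have : Filter.Tendsto (fun s : ℝ => y + s • (u - y)) (nhds 0) (nhds (y + (0 : ℝ) • (u - y))) :=
      Continuous.tendsto (by fun_prop) _
    rw [zero_smul, add_zero] at this
    exact this.mono_left nhdsWithin_le_nhds
  have hc2 : Continuous fun v : Fin d → ℝ => (ξ + v - dw x) ⬝ᵥ (u - y) := by
    simp only [dotProduct]; fun_prop
  exact ge_of_tendsto ((hc2.tendsto (dw y)).comp ((hw.continuousOn y hy).tendsto.comp hc))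
    (Filter.eventually_of_mem (Ioc_mem_nhdsGT one_pos) h)

lemma IsMirrorMap.prox_spec (hw : IsMirrorMap p X w dw) (hX : IsCompact X) (hne : X.Nonempty)
    (x ξ : Fin d → ℝ) :
    prox X w dw x ξ ∈ X ∧
      IsMinOn (fun y' => bregman w dw x y' + ξ ⬝ᵥ y') X (prox X w dw x ξ) := by
  have hc : ContinuousOn (fun y' => bregman w dw x y' + ξ ⬝ᵥ y') X := by
    have h1 : Continuous fun y' : Fin d → ℝ => ξ ⬝ᵥ y' := by simp only [dotProduct]; fun_prop
    have h2 : Continuous fun y' : Fin d → ℝ => dw x ⬝ᵥ (y' - x) := by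
      simp only [dotProduct]; fun_prop
    exact ((hw.continuousOn_map.sub continuousOn_const).sub h2.continuousOn).add h1.continuousOn
  obtain ⟨y, hy⟩ := hX.exists_isMinOn hne hc
  exact Classical.epsilon_spec (p := fun y => y ∈ X ∧
    IsMinOn (fun y' => bregman w dw x y' + ξ ⬝ᵥ y') X y) ⟨y, hy⟩

variable (hw : IsMirrorMap p X w dw) (hXc : IsCompact X) (hX : Convex ℝ X) (hp : 1 ≤ p)
include hw hXc

lemma IsMirrorMap.prox_mem {x ξ : Fin d → ℝ} (hx : x ∈ X) : prox X w dw x ξ ∈ X :=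
  (hw.prox_spec hXc ⟨x, hx⟩ x ξ).1

include hX

lemma IsMirrorMap.dotProduct_prox_sub_le {x u : Fin d → ℝ} (ξ : Fin d → ℝ) (hx : x ∈ X)
    (hu : u ∈ X) :
    ξ ⬝ᵥ (prox X w dw x ξ - u) ≤ bregman w dw x u - bregman w dw (prox X w dw x ξ) u -
      bregman w dw x (prox X w dw x ξ) := by
  obtain ⟨h1, h2⟩ := hw.prox_spec hXc ⟨x, hx⟩ x ξ
  have h := hw.vi_of_isMinOn hX h1 hu h2
  rw [bregman_three_point]
  simp only [dotProduct_sub, sub_dotProduct, add_dotProduct] at *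
  linarith

include hp

/-- The two optimality conditions are added, and the symmetrised Bregman divergence dominates ‖y -
y'‖². The estimate makes the prox mapping, defined by choice, continuous and hence measurable. -/
lemma IsMirrorMap.pNorm_prox_sub_le {x x' : Fin d → ℝ} (ξ ξ' : Fin d → ℝ) (hx : x ∈ X)
    (hx' : x' ∈ X) :
    pNorm p (prox X w dw x ξ - prox X w dw x' ξ') ≤ dualNorm p ((ξ - dw x) - (ξ' - dw x')) := by
  obtain ⟨h1, h2⟩ := hw.prox_spec hXc ⟨x, hx⟩ x ξ
  obtain ⟨h1', h2'⟩ := hw.prox_spec hXc ⟨x', hx'⟩ x' ξ'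
  set y := prox X w dw x ξ
  set y' := prox X w dw x' ξ'
  have a := hw.vi_of_isMinOn hX h1 h1' h2
  have a' := hw.vi_of_isMinOn hX h1' h1 h2'
  have b := hw.half_sq_le_bregman hX h1 h1'
  have b' := hw.half_sq_le_bregman hX h1' h1
  have c := dotProduct_le hp ((ξ - dw x) - (ξ' - dw x')) (y' - y)
  rw [pNorm_sub_comm y' y] at b' c
  simp only [bregman, dotProduct_sub, sub_dotProduct, add_dotProduct] at *
  rcases (pNorm_nonneg (p := p) (y - y')).eq_or_lt with h0 | h0
  · rw [← h0]; exact dualNorm_nonneg hp _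
  · refine le_of_mul_le_mul_right ?_ h0
    nlinarith

lemma IsMirrorMap.measurable_prox {A : Type*} [MeasurableSpace A] {f g : A → Fin d → ℝ}
    (hf : Measurable f) (hfX : ∀ a, f a ∈ X) (hg : Measurable g) :
    Measurable fun a => prox X w dw (f a) (g a) := by
  have hc : Continuous fun q : X × (Fin d → ℝ) => prox X w dw q.1 q.2 := by
    rw [continuous_iff_continuousAt]
    rintro ⟨⟨x, hx⟩, ξ⟩
    have hdw : Continuous fun q : X × (Fin d → ℝ) => q.2 - dw q.1 :=
      continuous_snd.sub ((continuousOn_iff_continuous_domRestrict.1 hw.continuousOn).comp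
        continuous_fst)
    have hb : Filter.Tendsto (fun q : X × (Fin d → ℝ) =>
        dualNorm p ((q.2 - dw q.1) - (ξ - dw x))) (nhds (⟨x, hx⟩, ξ)) (nhds 0) := by
      have hc : Continuous fun q : X × (Fin d → ℝ) => dualNorm p ((q.2 - dw q.1) - (ξ - dw x)) :=
        (continuous_dualNorm hp).comp (hdw.sub continuous_const)
      simpa [dualNorm_zero hp] using hc.tendsto ((⟨x, hx⟩ : X), ξ)
    refine tendsto_pi_nhds.2 fun i => ?_
    rw [tendsto_iff_dist_tendsto_zero]
    refine squeeze_zero (fun _ => dist_nonneg) (fun q => ?_) hb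
    have h1 := abs_apply_le_pNorm hp (prox X w dw q.1 q.2 - prox X w dw x ξ) i
    have h2 := hw.pNorm_prox_sub_le hXc hX hp q.2 ξ q.1.2 hx
    rw [Pi.sub_apply, ← Real.dist_eq] at h1
    exact h1.trans h2
  have hm : Measurable fun a => ((⟨f a, hfX a⟩ : X), g a) :=
    Measurable.prodMk (hf.subtype_mk) hg
  have := hc.measurable.comp hm
  exact this

omit hX hp in
lemma IsMirrorMap.bregman_le_diamSq {x y : Fin d → ℝ} (hx : x ∈ X) (hy : y ∈ X) :
    bregman w dw x y ≤ diamSq X w dw := by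
  have hc : ContinuousOn (fun q : (Fin d → ℝ) × (Fin d → ℝ) => bregman w dw q.1 q.2)
      (X ×ˢ X) := by
    have h1 : ContinuousOn (fun q : (Fin d → ℝ) × (Fin d → ℝ) => dw q.1) (X ×ˢ X) :=
      hw.continuousOn.comp continuousOn_fst fun q hq => hq.1
    have h2 : ContinuousOn (fun q : (Fin d → ℝ) × (Fin d → ℝ) => w q.1) (X ×ˢ X) :=
      hw.continuousOn_map.comp continuousOn_fst fun q hq => hq.1
    have h3 : ContinuousOn (fun q : (Fin d → ℝ) × (Fin d → ℝ) => w q.2) (X ×ˢ X) :=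
      hw.continuousOn_map.comp continuousOn_snd fun q hq => hq.2
    have h4 : Continuous fun q : (Fin d → ℝ) × (Fin d → ℝ) => q.1 ⬝ᵥ q.2 := by
      simp only [dotProduct]; fun_prop
    exact (h3.sub h2).sub (h4.comp_continuousOn
      (h1.prodMk (continuous_snd.sub continuous_fst).continuousOn))
  obtain ⟨R, hR⟩ := (hXc.prod hXc).bddAbove_image hc
  refine le_csSup ⟨R, ?_⟩ ⟨x, hx, y, hy, rfl⟩
  rintro r ⟨x', hx', y', hy', rfl⟩
  exact hR ⟨(x', y'), ⟨hx', hy'⟩, rfl⟩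

omit hp in
lemma IsMirrorMap.pNorm_sub_sq_le {x y : Fin d → ℝ} (hx : x ∈ X) (hy : y ∈ X) :
    pNorm p (x - y) ^ 2 ≤ 2 * diamSq X w dw := by
  linarith [hw.half_sq_le_bregman hX hx hy, hw.bregman_le_diamSq hXc hx hy]

omit hp hX in
lemma IsMirrorMap.diamSq_nonneg (hne : X.Nonempty) : 0 ≤ diamSq X w dw := by
  obtain ⟨x, hx⟩ := hne
  simpa [bregman_self] using hw.bregman_le_diamSq hXc hx hx

/-- One step of mirror-prox with inexact operator values `g₁`, `g`, coupled with a ghost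
sequence `v` driven by the error of `g`. -/
lemma IsMirrorMap.mirrorProx_step {F : (Fin d → ℝ) → (Fin d → ℝ)} {L γ : ℝ} (hL : 0 < L)
    (hF : ∀ x ∈ X, ∀ y ∈ X, dualNorm p (F x - F y) ≤ L * pNorm p (x - y))
    (hmono : ∀ x ∈ X, ∀ y ∈ X, 0 ≤ (F x - F y) ⬝ᵥ (x - y)) (hγ : 0 < γ) (hγL : γ ≤ 1 / (2 * L))
    {x v u h g₁ g : Fin d → ℝ} (hx : x ∈ X) (hv : v ∈ X) (hu : u ∈ X)
    (hh : h = prox X w dw x (γ • g₁)) :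
    γ * (F u ⬝ᵥ (h - u)) ≤
      (bregman w dw x u - bregman w dw (prox X w dw x (γ • g)) u) +
      (bregman w dw v u - bregman w dw (prox X w dw v (γ • (F h - g))) u) +
      3 * γ ^ 2 * (dualNorm p (g - F h) ^ 2 + dualNorm p (g₁ - F x) ^ 2) +
      γ * ((F h - g) ⬝ᵥ (h - v)) := by
  have hhX : h ∈ X := hh ▸ hw.prox_mem hXc hx
  have hx'X : prox X w dw x (γ • g) ∈ X := hw.prox_mem hXc hx
  have hv'X : prox X w dw v (γ • (F h - g)) ∈ X := hw.prox_mem hXc hv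
  -- The main step is tested against u, the extrapolation step against the output x' of the main
  -- step, and the ghost step against u. The leftovers γ⟨g - g₁, h - x'⟩ and γ⟨F h - g, v - v'⟩ are
  -- absorbed by the strong convexity terms `s1`, `s2`, `s3`.
  have i1 := hw.dotProduct_prox_sub_le hXc hX (γ • g) hx hu
  have i2 := hw.dotProduct_prox_sub_le hXc hX (γ • g₁) hx hx'X
  have i3 := hw.dotProduct_prox_sub_le hXc hX (γ • (F h - g)) hv hu
  rw [← hh] at i2
  set x' := prox X w dw x (γ • g)
  set v' := prox X w dw v (γ • (F h - g))
  have s1 := hw.half_sq_le_bregman hX hhX hx'X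
  have s2 := hw.half_sq_le_bregman hX hx hhX
  have s3 := hw.half_sq_le_bregman hX hv hv'X
  have m := hmono h hhX u hu
  have c1 := dotProduct_le hp (g - g₁) (h - x')
  have c2 := dotProduct_le hp (F h - g) (v - v')
  have n1 : dualNorm p (g - g₁) ≤ dualNorm p (g - F h) + L * pNorm p (x - h) +
      dualNorm p (g₁ - F x) := by
    have e : g - g₁ = (g - F h) + ((F h - F x) + (F x - g₁)) := by abel
    rw [e]
    have := hF h hhX x hx
    rw [pNorm_sub_comm] at this
    linarith [dualNorm_add_le hp (g - F h) ((F h - F x) + (F x - g₁)),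
      dualNorm_add_le hp (F h - F x) (F x - g₁), dualNorm_sub_comm hp (F x) g₁]
  rw [dualNorm_sub_comm hp (F h) g] at c2
  have P := pNorm_nonneg (p := p) (h - x')
  have Q := pNorm_nonneg (p := p) (x - h)
  set a := dualNorm p (g - F h)
  set b := dualNorm p (g₁ - F x)
  set P' := pNorm p (h - x')
  set Q' := pNorm p (x - h)
  set R' := pNorm p (v - v')
  -- With this step size the Lipschitz part γ L Q' P' is paid for by P'²/2 + Q'²/2 alone.
  have hgl : γ * L ≤ 1 / 2 := by
    rw [le_div_iff₀ (by positivity)] at hγL; linarith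
  have k1 : γ * ((g - g₁) ⬝ᵥ (h - x')) ≤ 2 * γ ^ 2 * (a ^ 2 + b ^ 2) + P' ^ 2 / 2 + Q' ^ 2 / 2 := by
    have : γ * ((g - g₁) ⬝ᵥ (h - x')) ≤ γ * ((a + L * Q' + b) * P') := by
      refine mul_le_mul_of_nonneg_left (c1.trans ?_) hγ.le
      exact mul_le_mul_of_nonneg_right n1 P
    have t1 : (γ * L) * (Q' * P') ≤ 1 / 2 * (Q' * P') :=
      mul_le_mul_of_nonneg_right hgl (mul_nonneg Q P)
    nlinarith [sq_nonneg (Q' - P'), sq_nonneg (γ * (a + b) - P' / 2), sq_nonneg (γ * (a - b)),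
      sq_nonneg Q']
  have k2 : γ * ((F h - g) ⬝ᵥ (v - v')) ≤ γ ^ 2 * a ^ 2 / 2 + R' ^ 2 / 2 := by
    have := mul_le_mul_of_nonneg_left c2 hγ.le
    nlinarith [sq_nonneg (γ * a - R')]
  have mm := mul_nonneg hγ.le m
  simp only [dotProduct_sub, sub_dotProduct, smul_dotProduct, smul_eq_mul, mul_sub] at *
  have := mul_nonneg (sq_nonneg γ) (sq_nonneg a)
  have := mul_nonneg (sq_nonneg γ) (sq_nonneg b)
  linarith

end MirrorMap

/-! ### Continuity of the merit function -/

section Merit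

variable {d : ℕ} {p : ℝ} {X : Set (Fin d → ℝ)} {F : (Fin d → ℝ) → (Fin d → ℝ)} {L : ℝ}

lemma exists_dualNorm_le_of_lipschitz (hp : 1 ≤ p) (hX : IsCompact X) (hL : 0 < L)
    (hF : ∀ x ∈ X, ∀ y ∈ X, dualNorm p (F x - F y) ≤ L * pNorm p (x - y)) {x₀ : Fin d → ℝ}
    (hx₀ : x₀ ∈ X) : ∃ R, 0 ≤ R ∧ ∀ x ∈ X, dualNorm p (F x) ≤ R := by
  have hc : Continuous fun x : Fin d → ℝ => pNorm p (x - x₀) :=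
    (continuous_pNorm hp).comp (by fun_prop)
  obtain ⟨R, hR⟩ := hX.bddAbove_image hc.continuousOn
  have hle : ∀ x ∈ X, dualNorm p (F x) ≤ L * R + dualNorm p (F x₀) := fun x hx => by
    have h1 := dualNorm_add_le hp (F x - F x₀) (F x₀)
    rw [sub_add_cancel] at h1
    have h2 := mul_le_mul_of_nonneg_left (hR ⟨x, hx, rfl⟩) hL.le
    linarith [hF x hx x₀ hx₀]
  exact ⟨_, (dualNorm_nonneg hp _).trans (hle x₀ hx₀), hle⟩

lemma continuousOn_of_lipschitz (hp : 1 ≤ p)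
    (hF : ∀ x ∈ X, ∀ y ∈ X, dualNorm p (F x - F y) ≤ L * pNorm p (x - y)) :
    ContinuousOn F X := by
  intro x hx
  refine continuousWithinAt_pi.2 fun i => ?_
  rw [ContinuousWithinAt, tendsto_iff_dist_tendsto_zero]
  have hc : Filter.Tendsto (fun y => L * pNorm p (y - x)) (nhdsWithin x X) (nhds 0) := by
    have : Continuous fun y => L * pNorm p (y - x) :=
      continuous_const.mul ((continuous_pNorm hp).comp (by fun_prop))
    simpa [pNorm_zero hp] using (this.tendsto x).mono_left nhdsWithin_le_nhds
  refine squeeze_zero' (Filter.Eventually.of_forall fun _ => dist_nonneg) ?_ hc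
  filter_upwards [self_mem_nhdsWithin] with y hy
  rw [Real.dist_eq]
  have h1 := abs_apply_le_dualNorm hp (F y - F x) i
  rw [Pi.sub_apply] at h1
  exact h1.trans (hF y hy x hx)

variable (hp : 1 ≤ p) {R : ℝ} (hR : ∀ x ∈ X, dualNorm p (F x) ≤ R)
include hp hR

lemma bddAbove_errVI (hX : IsCompact X) (x : Fin d → ℝ) :
    BddAbove {r | ∃ u ∈ X, r = F u ⬝ᵥ (x - u)} := by
  have hc : Continuous fun u : Fin d → ℝ => pNorm p (x - u) :=
    (continuous_pNorm hp).comp (by fun_prop)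
  obtain ⟨R', hR'⟩ := hX.bddAbove_image hc.continuousOn
  refine ⟨R * R', ?_⟩
  rintro r ⟨u, hu, rfl⟩
  exact (dotProduct_le hp _ _).trans (mul_le_mul (hR u hu) (hR' ⟨u, hu, rfl⟩) (pNorm_nonneg _)
    ((dualNorm_nonneg hp _).trans (hR u hu)))

/-- A supremum of affine functions whose slopes have conjugate norm at most R is R-Lipschitz. -/
lemma continuous_errVI (hX : IsCompact X) (hne : X.Nonempty) : Continuous (errVI X F) := by
  have key : ∀ x y, errVI X F x ≤ errVI X F y + R * pNorm p (x - y) := by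
    intro x y
    obtain ⟨u₀, hu₀⟩ := hne
    refine csSup_le ⟨_, u₀, hu₀, rfl⟩ ?_
    rintro r ⟨u, hu, rfl⟩
    have h1 : F u ⬝ᵥ (y - u) ≤ errVI X F y := le_csSup (bddAbove_errVI hp hR hX y) ⟨u, hu, rfl⟩
    have h2 := (dotProduct_le hp (F u) (x - y)).trans
      (mul_le_mul_of_nonneg_right (hR u hu) (pNorm_nonneg _))
    simp only [dotProduct_sub] at *
    linarith
  rw [continuous_iff_continuousAt]
  intro x
  rw [ContinuousAt, tendsto_iff_dist_tendsto_zero]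
  have hc : Filter.Tendsto (fun y => R * pNorm p (y - x)) (nhds x) (nhds 0) := by
    have : Continuous fun y => R * pNorm p (y - x) :=
      continuous_const.mul ((continuous_pNorm hp).comp (by fun_prop))
    simpa [pNorm_zero hp] using this.tendsto x
  refine squeeze_zero (fun _ => dist_nonneg) (fun y => ?_) hc
  rw [Real.dist_eq, abs_le]
  have h1 := key x y
  have h2 := key y x
  rw [pNorm_sub_comm] at h1
  constructor <;> linarith

end Merit

/-! ### Integrals of bounded functions and total variation -/

lemma integrable_of_abs_le {Ω : Type*} [MeasurableSpace Ω] {μ : Measure Ω} [IsFiniteMeasure μ]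
    {f : Ω → ℝ} (hf : Measurable f) {C : ℝ} (hC : ∀ ω, |f ω| ≤ C) : Integrable f μ :=
  Integrable.of_bound hf.aestronglyMeasurable C (Filter.Eventually.of_forall hC)

lemma abs_integral_le {Ω : Type*} [MeasurableSpace Ω] {μ : Measure Ω} [IsProbabilityMeasure μ]
    {f : Ω → ℝ} {C : ℝ} (hC : ∀ ω, |f ω| ≤ C) : |∫ ω, f ω ∂μ| ≤ C := by
  simpa using norm_integral_le_of_norm_le_const (f := f) (Filter.Eventually.of_forall hC) (μ := μ)

section VectorIntegral

variable {d : ℕ} {p : ℝ} {S : Type*} [MeasurableSpace S] {ν π : Measure S}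

lemma norm_le_dualNorm (hp : 1 ≤ p) (ξ : Fin d → ℝ) : ‖ξ‖ ≤ dualNorm p ξ :=
  (pi_norm_le_iff_of_nonneg (dualNorm_nonneg hp ξ)).2 fun i => abs_apply_le_dualNorm hp ξ i

lemma integrable_of_dualNorm_le [IsFiniteMeasure ν] (hp : 1 ≤ p) {f : S → Fin d → ℝ}
    (hf : Measurable f) {c : ℝ} (hc : ∀ y, dualNorm p (f y) ≤ c) : Integrable f ν :=
  Integrable.of_bound hf.aestronglyMeasurable c
    (Filter.Eventually.of_forall fun y => (norm_le_dualNorm hp _).trans (hc y))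

lemma integral_dotProduct {f : S → Fin d → ℝ} (hf : Integrable f ν) (z : Fin d → ℝ) :
    (∫ y, f y ∂ν) ⬝ᵥ z = ∫ y, f y ⬝ᵥ z ∂ν := by
  have hi : ∀ i, Integrable (fun y => f y i) ν := fun i => hf.eval i
  simp only [dotProduct]
  rw [integral_finsetSum _ fun i _ => (hi i).mul_const _]
  refine Finset.sum_congr rfl fun i _ => ?_
  rw [eval_integral hi, integral_mul_const]

lemma integrable_dotProduct {f : S → Fin d → ℝ} (hf : Integrable f ν) (z : Fin d → ℝ) :
    Integrable (fun y => f y ⬝ᵥ z) ν := by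
  simp only [dotProduct]
  exact integrable_finsetSum _ fun i _ => (hf.eval i).mul_const _

lemma dualNorm_integral_le [IsProbabilityMeasure ν] (hp : 1 ≤ p) {f : S → Fin d → ℝ}
    (hf : Measurable f) {c : ℝ} (hc : ∀ y, dualNorm p (f y) ≤ c) :
    dualNorm p (∫ y, f y ∂ν) ≤ c := by
  have hi := integrable_of_dualNorm_le (ν := ν) hp hf hc
  refine dualNorm_le hp fun z hz => ?_
  rw [integral_dotProduct hi]
  calc ∫ y, f y ⬝ᵥ z ∂ν ≤ ∫ _, c ∂ν :=
        integral_mono (integrable_dotProduct hi z) (integrable_const c)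
          fun y => (dotProduct_le_dualNorm hp _ hz).trans (hc y)
    _ = c := by simp

/-- Integrals of bounded functions differ by at most the total variation distance. -/
lemma integral_sub_integral_le [IsProbabilityMeasure ν] [IsProbabilityMeasure π] {δ : ℝ}
    (hδ : ∀ A, MeasurableSet A → |ν.real A - π.real A| ≤ δ) {u : S → ℝ} (hu : Measurable u)
    {c : ℝ} (hc : ∀ y, |u y| ≤ c) : ∫ y, u y ∂ν - ∫ y, u y ∂π ≤ 2 * c * δ := by
  obtain ⟨y₀⟩ : Nonempty S := ν.nonempty_of_neZero
  have hc0 : 0 ≤ c := (abs_nonneg _).trans (hc y₀)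
  -- After the shift by c the values lie in [0, 2c]. The layer-cake formula compares the measures of
  -- superlevel sets, and the length 2c of the range is the factor in the bound.
  set v : S → ℝ := fun y => u y + c with hv
  have hvm : Measurable v := hu.add_const c
  have hv0 : ∀ y, 0 ≤ v y := fun y => by linarith [(abs_le.1 (hc y)).1]
  have hv1 : ∀ y, v y ≤ 2 * c := fun y => by
    have := (abs_le.1 (hc y)).2
    simp only [hv]; linarith
  have hvi : ∀ (ρ : Measure S) [IsProbabilityMeasure ρ], ∫ y, v y ∂ρ = ∫ y, u y ∂ρ + c := by
    intro ρ _
    rw [hv, integral_add (integrable_of_abs_le hu hc) (integrable_const c)]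
    simp
  have hcake : ∀ (ρ : Measure S) [IsProbabilityMeasure ρ],
      ∫ y, v y ∂ρ = ∫ t in Set.Ioc 0 (2 * c), ρ.real {a | t ≤ v a} := by
    intro ρ _
    exact (integrable_of_abs_le hvm
      fun y => by rw [abs_of_nonneg (hv0 y)]; exact hv1 y).integral_eq_integral_Ioc_meas_le
      (Filter.Eventually.of_forall hv0) (Filter.Eventually.of_forall hv1)
  have hint : ∀ (ρ : Measure S) [IsProbabilityMeasure ρ],
      IntegrableOn (fun t => ρ.real {a | t ≤ v a}) (Set.Ioc 0 (2 * c)) volume := by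
    intro ρ _
    have hanti : Antitone fun t => ρ.real {a | t ≤ v a} := fun s t hst =>
      measureReal_mono fun a (ha : t ≤ v a) => hst.trans ha
    exact ((hanti.antitoneOn _).integrableOn_isCompact isCompact_Icc).mono_set
      Set.Ioc_subset_Icc_self
  have h : ∫ y, v y ∂ν - ∫ y, v y ∂π ≤ 2 * c * δ := by
    rw [hcake ν, hcake π, ← integral_sub (hint ν) (hint π)]
    calc _ ≤ ∫ _ in Set.Ioc 0 (2 * c), δ :=
          integral_mono ((hint ν).sub (hint π)) (integrable_const δ) fun t =>
            (le_abs_self _).trans (hδ _ (measurableSet_le measurable_const hvm))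
      _ = 2 * c * δ := by
          rw [setIntegral_const, Real.volume_real_Ioc_of_le (by linarith), smul_eq_mul, sub_zero]
  rw [hvi, hvi] at h
  linarith

lemma dualNorm_integral_le_of_tv [IsProbabilityMeasure ν] [IsProbabilityMeasure π] (hp : 1 ≤ p)
    {δ : ℝ} (hδ : ∀ A, MeasurableSet A → |ν.real A - π.real A| ≤ δ) {f : S → Fin d → ℝ}
    (hf : Measurable f) {c : ℝ} (hc : ∀ y, dualNorm p (f y) ≤ c) (h0 : ∫ y, f y ∂π = 0) :
    dualNorm p (∫ y, f y ∂ν) ≤ 2 * c * δ := by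
  refine dualNorm_le hp fun z hz => ?_
  have hm : Measurable fun y => f y ⬝ᵥ z := by
    simp only [dotProduct]
    exact Finset.measurable_sum _ fun i _ => ((measurable_pi_apply i).comp hf).mul_const _
  have hb : ∀ y, |f y ⬝ᵥ z| ≤ c := fun y => by
    refine abs_le'.2 ⟨(dotProduct_le_dualNorm hp _ hz).trans (hc y), ?_⟩
    rw [← neg_dotProduct]
    refine (dotProduct_le_dualNorm hp _ hz).trans ?_
    rw [dualNorm_neg hp]
    exact hc y
  have h1 := integral_sub_integral_le hδ hm hb
  rw [← integral_dotProduct (integrable_of_dualNorm_le hp hf hc),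
    ← integral_dotProduct (integrable_of_dualNorm_le hp hf hc), h0, zero_dotProduct, sub_zero] at h1
  exact h1

end VectorIntegral

/-! ### The Markov property over several steps -/

section MarkovProperty

variable {S Ω : Type*} [MeasurableSpace S] [MeasurableSpace Ω] {κ : Kernel S S} [IsMarkovKernel κ]

instance isMarkovKernel_pow (t : ℕ) : IsMarkovKernel (κ ^ t) := by
  induction t with
  | zero => rw [pow_zero]; exact inferInstanceAs (IsMarkovKernel Kernel.id)
  | succ t ih => rw [pow_succ]; exact inferInstanceAs (IsMarkovKernel ((κ ^ t) ∘ₖ κ))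

/-- The sequence `z` frozen from time `n` on. -/
def freeze {α : Type*} (n : ℕ) (z : ℕ → α) : ℕ → α := fun i => z (min i n)

lemma freeze_freeze {α : Type*} {m n : ℕ} (h : m ≤ n) (z : ℕ → α) :
    freeze m (freeze n z) = freeze m z := by
  funext i
  simp only [freeze]
  congr 1
  omega

lemma freeze_apply {α : Type*} {n i : ℕ} (h : i ≤ n) (z : ℕ → α) : freeze n z i = z i := by
  simp only [freeze, min_eq_left h]

lemma measurable_freeze (n : ℕ) : Measurable (freeze n : (ℕ → S) → ℕ → S) :=
  measurable_pi_lambda _ fun _ => measurable_pi_apply _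

variable {Z : ℕ → Ω → S} {μ : Measure Ω} [IsProbabilityMeasure μ]

omit [IsMarkovKernel κ] [IsProbabilityMeasure μ] in
lemma IsMarkovChain.measurable_path (hZ : IsMarkovChain κ Z μ) :
    Measurable fun ω t => Z t ω := measurable_pi_lambda _ hZ.measurable

/-- The multi-step Markov property. -/
lemma IsMarkovChain.lintegral_eq (hZ : IsMarkovChain κ Z μ) (n t : ℕ)
    {f : (ℕ → S) × S → ENNReal} (hf : Measurable f) :
    ∫⁻ ω, f (freeze n (fun i => Z i ω), Z (n + t) ω) ∂μ =
      ∫⁻ ω, ∫⁻ y, f (freeze n (fun i => Z i ω), y) ∂(κ ^ t) (Z n ω) ∂μ := by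
  induction t generalizing f with
  | zero =>
    refine lintegral_congr fun ω => ?_
    rw [pow_zero]
    change _ = ∫⁻ y, _ ∂(Kernel.id (Z n ω))
    rw [Kernel.id_apply, lintegral_dirac' _ (by exact hf.comp measurable_prodMk_left)]
    rfl
  | succ t ih =>
    have hlaw := (hZ.markov (n + t)).map_eq
    have hm := hZ.measurable
    -- The one-step kernel is conditioned on the history up to n + t; `e` extracts from that history
    -- the path frozen at n, on which f depends.
    let e : (Fin (n + t + 1) → S) → ℕ → S := fun G i => G ⟨min i n, by omega⟩
    have he : Measurable e := measurable_pi_lambda _ fun _ => measurable_pi_apply _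
    have hH : Measurable fun ω (i : Fin (n + t + 1)) => Z i ω :=
      measurable_pi_lambda _ fun i => hm i
    have hf' : Measurable fun q : (Fin (n + t + 1) → S) × S => f (e q.1, q.2) :=
      hf.comp ((he.comp measurable_fst).prodMk measurable_snd)
    have hg : Measurable fun q : (ℕ → S) × S => ∫⁻ y, f (q.1, y) ∂κ q.2 := by
      have : Measurable fun q : ((ℕ → S) × S) × S => f (q.1.1, q.2) :=
        hf.comp (measurable_fst.fst.prodMk measurable_snd)
      exact Measurable.lintegral_kernel_prod_right' (κ := κ.comap Prod.snd measurable_snd) this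
    have h1 : ∫⁻ ω, f (freeze n (fun i => Z i ω), Z (n + (t + 1)) ω) ∂μ =
        ∫⁻ ω, ∫⁻ y, f (freeze n (fun i => Z i ω), y) ∂κ (Z (n + t) ω) ∂μ := by
      have h2 := lintegral_map (μ := μ) hf' (hH.prodMk (hm (n + t + 1)))
      rw [hlaw, Measure.lintegral_compProd hf', lintegral_map _ hH] at h2
      · exact h2.symm
      · exact Measurable.lintegral_kernel_prod_right' hf'
    rw [h1, ih hg]
    refine lintegral_congr fun ω => ?_
    rw [pow_succ']
    change _ = ∫⁻ y, _ ∂((κ ∘ₖ (κ ^ t)) (Z n ω))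
    rw [Kernel.lintegral_comp _ _ _ (by exact hf.comp measurable_prodMk_left)]

lemma IsMarkovChain.map_eq_compProd (hZ : IsMarkovChain κ Z μ) (n t : ℕ) :
    μ.map (fun ω => (freeze n (fun i => Z i ω), Z (n + t) ω)) =
      (μ.map (fun ω => freeze n (fun i => Z i ω))) ⊗ₘ
        ((κ ^ t).comap (fun z : ℕ → S => z n) (measurable_pi_apply n)) := by
  have hs : Measurable fun ω => freeze n (fun i => Z i ω) :=
    (measurable_freeze n).comp hZ.measurable_path
  refine Measure.ext_of_lintegral _ fun f hf => ?_
  rw [lintegral_map hf (hs.prodMk (hZ.measurable _)), hZ.lintegral_eq n t hf,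
    Measure.lintegral_compProd hf, lintegral_map (Measurable.lintegral_kernel_prod_right' hf) hs]
  refine lintegral_congr fun ω => ?_
  rw [Kernel.comap_apply, freeze_apply le_rfl]

/-- If the expected value of `f` one transition of length `t` ahead of time `n` is at most `g`,
then so is its expectation along the chain. -/
lemma IsMarkovChain.integral_le (hZ : IsMarkovChain κ Z μ) (n t : ℕ) {f : (ℕ → S) → S → ℝ}
    {g : (ℕ → S) → ℝ} {C : ℝ} (hf : Measurable (Function.uncurry f)) (hfC : ∀ z y, |f z y| ≤ C)
    (hfs : ∀ z y, f (freeze n z) y = f z y) (hg : Measurable g) (hgC : ∀ z, |g z| ≤ C)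
    (hgs : ∀ z, g (freeze n z) = g z) (hfg : ∀ z, ∫ y, f z y ∂(κ ^ t) (z n) ≤ g z) :
    ∫ ω, f (fun i => Z i ω) (Z (n + t) ω) ∂μ ≤ ∫ ω, g (fun i => Z i ω) ∂μ := by
  have hs : Measurable fun ω => freeze n (fun i => Z i ω) :=
    (measurable_freeze n).comp hZ.measurable_path
  have hp : IsProbabilityMeasure (μ.map (fun ω => freeze n (fun i => Z i ω))) :=
    Measure.isProbabilityMeasure_map hs.aemeasurable
  have h1 : ∫ ω, f (fun i => Z i ω) (Z (n + t) ω) ∂μ =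
      ∫ q, Function.uncurry f q ∂(μ.map (fun ω => (freeze n (fun i => Z i ω), Z (n + t) ω))) := by
    rw [integral_map (hs.prodMk (hZ.measurable _)).aemeasurable hf.aestronglyMeasurable]
    simp only [Function.uncurry, hfs]
  have h2 : ∫ ω, g (fun i => Z i ω) ∂μ =
      ∫ z, g z ∂(μ.map (fun ω => freeze n (fun i => Z i ω))) := by
    rw [integral_map hs.aemeasurable hg.aestronglyMeasurable]
    simp only [hgs]
  have hfi : Integrable (Function.uncurry f) (μ.map (fun ω => freeze n (fun i => Z i ω)) ⊗ₘ
      ((κ ^ t).comap (fun z : ℕ → S => z n) (measurable_pi_apply n))) :=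
    integrable_of_abs_le hf fun q => hfC q.1 q.2
  rw [h1, h2, hZ.map_eq_compProd, Measure.integral_compProd hfi]
  refine integral_mono ?_ (integrable_of_abs_le hg hgC) fun z => ?_
  · exact integrable_of_abs_le hf.stronglyMeasurable.integral_kernel_prod_right'.measurable
      fun z => abs_integral_le fun y => hfC z y
  · simpa [Kernel.comap_apply] using hfg z

end MarkovProperty

/-! ### Truncated Poisson equation for the τ-step kernel -/

section PoissonSum

variable {d : ℕ} {p : ℝ} {S : Type*} [MeasurableSpace S] {κ : Kernel S S} [IsMarkovKernel κ]
  {π : Measure S} {τ : ℕ} {K : ℝ} {h : (ℕ → S) → S → Fin d → ℝ} {c : ℝ}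

omit [IsMarkovKernel κ] in
lemma IsUniformlyErgodic.const_nonneg [IsProbabilityMeasure π] (hκ : IsUniformlyErgodic κ π τ K) :
    0 ≤ K := by
  obtain ⟨y⟩ : Nonempty S := π.nonempty_of_neZero
  have h1 := (abs_nonneg _).trans (hκ.mixing 1 le_rfl y ∅ MeasurableSet.empty)
  exact nonneg_of_mul_nonneg_left h1 (by positivity)

/-- Partial sums `∑_{k ≤ l} κ^{τ k} h` of the solution of the Poisson equation for `κ^τ`. -/
noncomputable def poissonSum (κ : Kernel S S) (τ : ℕ) (h : (ℕ → S) → S → Fin d → ℝ) (l : ℕ)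
    (z : ℕ → S) (y : S) : Fin d → ℝ :=
  ∑ k ∈ Finset.range (l + 1), ∫ y', h z y' ∂(κ ^ (τ * k)) y

omit [IsMarkovKernel κ] in
lemma poissonSum_zero (hh : Measurable (Function.uncurry h)) (z : ℕ → S) (y : S) :
    poissonSum κ τ h 0 z y = h z y := by
  have hm : Measurable (h z) := hh.comp measurable_prodMk_left
  rw [poissonSum, zero_add, Finset.sum_range_one, mul_zero, pow_zero]
  change ∫ y', h z y' ∂(Kernel.id y) = _
  rw [Kernel.id_apply, integral_dirac' _ _ hm.stronglyMeasurable]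

lemma measurable_integral_pow (hh : Measurable (Function.uncurry h)) (n : ℕ) :
    Measurable fun q : (ℕ → S) × S => ∫ y', h q.1 y' ∂(κ ^ n) q.2 := by
  have : Measurable fun q : ((ℕ → S) × S) × S => h q.1.1 q.2 :=
    hh.comp (measurable_fst.fst.prodMk measurable_snd)
  exact (this.stronglyMeasurable.integral_kernel_prod_right'
    (κ := (κ ^ n).comap Prod.snd measurable_snd)).measurable

lemma measurable_poissonSum (hh : Measurable (Function.uncurry h)) (l : ℕ) :
    Measurable (Function.uncurry (poissonSum κ τ h l)) := by
  change Measurable fun q : (ℕ → S) × S =>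
    ∑ k ∈ Finset.range (l + 1), ∫ y', h q.1 y' ∂(κ ^ (τ * k)) q.2
  exact Finset.measurable_sum _ fun _ _ => measurable_integral_pow hh _

variable (hp : 1 ≤ p) (hh : Measurable (Function.uncurry h)) (hc : ∀ z y, dualNorm p (h z y) ≤ c)
include hp hh hc

/-- Applying κ^τ raises every power by one (Chapman–Kolmogorov), so exactly the k = 0 term of the
next partial sum is missing. -/
lemma integral_poissonSum (l : ℕ) (z : ℕ → S) (y : S) :
    ∫ y', poissonSum κ τ h l z y' ∂(κ ^ τ) y = poissonSum κ τ h (l + 1) z y - h z y := by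
  have hm : Measurable (h z) := hh.comp measurable_prodMk_left
  have h0 := poissonSum_zero (κ := κ) (τ := τ) hh z y
  rw [poissonSum, zero_add, Finset.sum_range_one] at h0
  simp only [poissonSum]
  rw [Finset.sum_range_succ', h0, add_sub_cancel_right, integral_finsetSum]
  · refine Finset.sum_congr rfl fun k _ => ?_
    rw [mul_add, mul_one, pow_add]
    have hi : Integrable (h z) (((κ ^ (τ * k)) ∘ₖ (κ ^ τ)) y) :=
      integrable_of_dualNorm_le hp hm (hc z)
    exact (Kernel.integral_comp hi).symm
  · intro k _
    have hmk : Measurable fun y' => ∫ y'', h z y'' ∂(κ ^ (τ * k)) y' :=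
      (measurable_integral_pow hh (τ * k)).comp measurable_prodMk_left
    exact integrable_of_dualNorm_le hp hmk fun y' => dualNorm_integral_le hp hm (hc z)

/-- The k = 0 term costs c. For k ≥ 1, centring under π and mixing at time τk give 2cK 2^{-k}, which
sums to at most 2Kc. Uniformity in l makes the limit l → ∞ unnecessary. -/
lemma dualNorm_poissonSum_le [IsProbabilityMeasure π] (hτ : 1 ≤ τ)
    (hκ : IsUniformlyErgodic κ π τ K) (h0 : ∀ z, ∫ y, h z y ∂π = 0) (l : ℕ) (z : ℕ → S) (y : S) :
    dualNorm p (poissonSum κ τ h l z y) ≤ (1 + 2 * K) * c := by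
  have hm : Measurable (h z) := hh.comp measurable_prodMk_left
  have hc0 : 0 ≤ c := (dualNorm_nonneg hp _).trans (hc z y)
  have hK := hκ.const_nonneg
  have hterm : ∀ k, dualNorm p (∫ y', h z y' ∂(κ ^ (τ * (k + 1))) y) ≤
      c * K * (1 / 2 : ℝ) ^ k := by
    intro k
    have hle : 1 ≤ τ * (k + 1) := Nat.one_le_iff_ne_zero.2 (by positivity)
    have h1 := dualNorm_integral_le_of_tv hp (fun A hA => hκ.mixing _ hle y A hA) hm (hc z) (h0 z)
    have hτ0 : (τ : ℝ) ≠ 0 := by positivity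
    have e : ((τ * (k + 1) : ℕ) : ℝ) / τ = ((k + 1 : ℕ) : ℝ) := by
      push_cast; field_simp
    rw [e, Real.rpow_natCast, pow_succ] at h1
    linarith
  rw [poissonSum, Finset.sum_range_succ']
  refine (dualNorm_add_le hp _ _).trans ?_
  have h1 : dualNorm p (∫ y', h z y' ∂(κ ^ (τ * 0)) y) ≤ c := dualNorm_integral_le hp hm (hc z)
  have h2 : ∑ k ∈ Finset.range l, c * K * (1 / 2 : ℝ) ^ k ≤ c * K * 2 := by
    rw [← Finset.mul_sum]
    exact mul_le_mul_of_nonneg_left (sum_geometric_two_le l) (by positivity)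
  have h3 := (dualNorm_sum_le hp (Finset.range l)
    fun k => ∫ y', h z y' ∂(κ ^ (τ * (k + 1))) y).trans (Finset.sum_le_sum fun k _ => hterm k)
  linarith

end PoissonSum

/-! ### Second moments of sums along the chain -/

section Batch

variable {d : ℕ} {p q : ℝ} {S Ω : Type*} [MeasurableSpace S] [MeasurableSpace Ω] {κ : Kernel S S}
  [IsMarkovKernel κ] {π : Measure S} [IsProbabilityMeasure π] {τ : ℕ} {K : ℝ}
  {h : (ℕ → S) → S → Fin d → ℝ} {c : ℝ} {Z : ℕ → Ω → S} {μ : Measure Ω} [IsProbabilityMeasure μ]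
  {N : ℕ}

/-- One-step variance increment of the squared `ℓ_q` norm under a centred perturbation. -/
lemma integral_pNorm_sq_add_le {ν : Measure S} [IsProbabilityMeasure ν] (hq : 2 ≤ q)
    {f : S → Fin d → ℝ} (hf : Measurable f) {E : ℝ} (hE : ∀ y, pNorm q (f y) ≤ E)
    (hi : pNorm q (∫ y, f y ∂ν) ≤ E) (b : Fin d → ℝ) :
    ∫ y, pNorm q (b + f y) ^ 2 ∂ν ≤ pNorm q (b + ∫ y, f y ∂ν) ^ 2 + 16 * q * E ^ 2 := by
  have hq1 : 1 ≤ q := by linarith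
  obtain ⟨y₀⟩ : Nonempty S := ν.nonempty_of_neZero
  have hE0 : 0 ≤ E := (pNorm_nonneg _).trans (hE y₀)
  have hfi : Integrable f ν := Integrable.of_bound hf.aestronglyMeasurable E
    (Filter.Eventually.of_forall fun y => ((pi_norm_le_iff_of_nonneg (pNorm_nonneg _)).2
      fun i => abs_apply_le_pNorm hq1 (f y) i).trans (hE y))
  set m := ∫ y, f y ∂ν with hm
  -- Expanding at the mean point makes the linear term integrate to zero. The deviation from m has
  -- norm at most 2E, whence 4q(2E)² = 16qE².
  obtain ⟨g, hg⟩ := pNorm_sq_smooth hq (b + m)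
  have hpt : ∀ y, pNorm q (b + f y) ^ 2 ≤
      (pNorm q (b + m) ^ 2 + 16 * q * E ^ 2 - m ⬝ᵥ g) + f y ⬝ᵥ g := fun y => by
    have h1 := hg (f y - m)
    have e : b + m + (f y - m) = b + f y := by abel
    rw [e] at h1
    have h2 : pNorm q (f y - m) ≤ 2 * E := by
      rw [sub_eq_add_neg]
      refine (pNorm_add_le hq1 _ _).trans ?_
      rw [pNorm_neg]; linarith [hE y]
    have h3 : pNorm q (f y - m) ^ 2 ≤ (2 * E) ^ 2 := pow_le_pow_left₀ (pNorm_nonneg _) h2 2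
    rw [dotProduct_comm g, sub_dotProduct] at h1
    nlinarith
  have hbi : Integrable (fun y => pNorm q (b + f y) ^ 2) ν := by
    refine integrable_of_abs_le (C := (pNorm q b + E) ^ 2) ?_ fun y => ?_
    · exact ((continuous_pNorm hq1).measurable.comp (measurable_const.add hf)).pow_const 2
    · rw [abs_of_nonneg (sq_nonneg _)]
      exact pow_le_pow_left₀ (pNorm_nonneg _)
        ((pNorm_add_le hq1 _ _).trans (by linarith [hE y])) 2
  calc ∫ y, pNorm q (b + f y) ^ 2 ∂ν
      ≤ ∫ y, (pNorm q (b + m) ^ 2 + 16 * q * E ^ 2 - m ⬝ᵥ g) + f y ⬝ᵥ g ∂ν :=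
        integral_mono hbi ((integrable_const _).add (integrable_dotProduct hfi g)) hpt
    _ = _ := by
        rw [integral_add (integrable_const _) (integrable_dotProduct hfi g),
          ← integral_dotProduct hfi, ← hm]
        simp

variable (hp : 1 ≤ p) (hτ : 1 ≤ τ) (hκ : IsUniformlyErgodic κ π τ K) (hZ : IsMarkovChain κ Z μ)
  (hh : Measurable (Function.uncurry h)) (hc : ∀ z y, dualNorm p (h z y) ≤ c)
  (h0 : ∀ z, ∫ y, h z y ∂π = 0) (hs : ∀ z y, h (freeze N z) y = h z y)
  (hq : 2 ≤ q) (hqp : ∀ ξ : Fin d → ℝ, pNorm q ξ ≤ Real.exp 1 * dualNorm p ξ)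
include hp hτ hκ hZ hh hc h0 hs hq hqp

/-- Second moment of a sum along every `τ`-th sample. -/
lemma integral_pNorm_sq_add_poissonSum_le {s : ℕ} (hNs : N ≤ s) (m l : ℕ) :
    ∫ ω, pNorm q (∑ k ∈ Finset.range m, h (fun i => Z i ω) (Z (s + k * τ) ω) +
        poissonSum κ τ h l (fun i => Z i ω) (Z (s + m * τ) ω)) ^ 2 ∂μ ≤
      (Real.exp 1 * ((1 + 2 * K) * c)) ^ 2 * (1 + 16 * q * m) := by
  have hq1 : 1 ≤ q := by linarith
  set E := Real.exp 1 * ((1 + 2 * K) * c) with hE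
  have hpE : ∀ l z y, pNorm q (poissonSum κ τ h l z y) ≤ E := fun l z y =>
    (hqp _).trans (mul_le_mul_of_nonneg_left (dualNorm_poissonSum_le hp hh hc hτ hκ h0 l z y)
      (Real.exp_pos 1).le)
  have hhE : ∀ z y, pNorm q (h z y) ≤ E := fun z y => by
    simpa [poissonSum_zero hh] using hpE 0 z y
  have hsum : ∀ m (z : ℕ → S) (y : ℕ → S),
      pNorm q (∑ k ∈ Finset.range m, h z (y k)) ≤ m * E := fun m z y => by
    induction m with
    | zero => simp [pNorm_zero hq1]
    | succ m ih =>
      rw [Finset.sum_range_succ]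
      refine (pNorm_add_le hq1 _ _).trans ?_
      push_cast
      linarith [hhE z (y m)]
  have hE0 : ∀ _ : S, 0 ≤ E := fun y => (pNorm_nonneg _).trans (hhE (fun _ => y) y)
  -- Given the path up to s + mτ, the sum of m + 1 terms plus the Poisson sum of index l at the next
  -- point has as its mean the sum of m terms plus the Poisson sum of index l + 1 at the current
  -- point: the Poisson equation cancels the last h. So l grows as m decreases, while E serves for
  -- all l, and each step costs 16qE².
  induction m generalizing l with
  | zero =>
    have hb : ∀ ω, pNorm q (∑ k ∈ Finset.range 0, h (fun i => Z i ω) (Z (s + k * τ) ω) +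
        poissonSum κ τ h l (fun i => Z i ω) (Z (s + 0 * τ) ω)) ^ 2 ≤ E ^ 2 := fun ω => by
      rw [Finset.sum_range_zero, zero_add]
      exact pow_le_pow_left₀ (pNorm_nonneg _) (hpE _ _ _) 2
    refine (le_abs_self _).trans ((abs_integral_le (C := E ^ 2) fun ω => ?_).trans (by simp))
    rw [abs_of_nonneg (sq_nonneg _)]
    exact hb ω
  | succ m ih =>
    have hsm : ∀ z : ℕ → S, ∀ j, s + j * τ ≤ s + m * τ → freeze (s + m * τ) z (s + j * τ) =
      z (s + j * τ) := fun z j hj => freeze_apply hj z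
    have hst : ∀ z : ℕ → S, ∀ y, h (freeze (s + m * τ) z) y = h z y := fun z y => by
      rw [← hs (freeze _ z), freeze_freeze (by omega), hs]
    have hpst : ∀ l, ∀ z : ℕ → S, ∀ y, poissonSum κ τ h l (freeze (s + m * τ) z) y =
        poissonSum κ τ h l z y := fun l z y => by
      simp only [poissonSum, hst]
    have hjm : ∀ m, Measurable fun z : ℕ → S => ∑ k ∈ Finset.range m, h z (z (s + k * τ)) :=
      fun m => Finset.measurable_sum _ fun k _ =>
        hh.comp (measurable_id.prodMk (measurable_pi_apply _))
    have hnm : Measurable (pNorm q : (Fin d → ℝ) → ℝ) := (continuous_pNorm hq1).measurable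
    have step := hZ.integral_le (s + m * τ) τ
      (f := fun z y => pNorm q (∑ k ∈ Finset.range (m + 1), h z (z (s + k * τ)) +
        poissonSum κ τ h l z y) ^ 2)
      (g := fun z => pNorm q (∑ k ∈ Finset.range m, h z (z (s + k * τ)) +
        poissonSum κ τ h (l + 1) z (z (s + m * τ))) ^ 2 + 16 * q * E ^ 2)
      (C := ((m + 1) * E + E) ^ 2 + 16 * q * E ^ 2) ?_ ?_ ?_ ?_ ?_ ?_ ?_
    · have e : s + (m + 1) * τ = s + m * τ + τ := by ring
      rw [e]
      refine step.trans ?_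
      rw [integral_add, integral_const]
      · have := ih (l + 1)
        simp only [probReal_univ, one_smul]
        push_cast
        nlinarith
      · refine integrable_of_abs_le (C := (m * E + E) ^ 2) ?_ fun ω => ?_
        · refine (hnm.comp (Measurable.add ?_ ?_)).pow_const 2
          · exact (hjm m).comp hZ.measurable_path
          · exact (measurable_poissonSum hh (l + 1)).comp
              (hZ.measurable_path.prodMk (hZ.measurable _))
        · rw [abs_of_nonneg (sq_nonneg _)]
          refine pow_le_pow_left₀ (pNorm_nonneg _) ((pNorm_add_le hq1 _ _).trans ?_) 2
          exact add_le_add (hsum m _ _) (hpE _ _ _)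
      · exact integrable_const _
    · refine (hnm.comp (Measurable.add ?_ (measurable_poissonSum hh l))).pow_const 2
      exact (hjm (m + 1)).comp measurable_fst
    · intro z y
      rw [abs_of_nonneg (sq_nonneg _)]
      have h1 : pNorm q (∑ k ∈ Finset.range (m + 1), h z (z (s + k * τ)) +
          poissonSum κ τ h l z y) ≤ (m + 1) * E + E := by
        refine (pNorm_add_le hq1 _ _).trans (add_le_add ?_ (hpE _ _ _))
        exact_mod_cast hsum (m + 1) z fun k => z (s + k * τ)
      have h2 := pow_le_pow_left₀ (pNorm_nonneg _) h1 2
      have : 0 ≤ 16 * q * E ^ 2 := by positivity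
      linarith
    · intro z y
      simp only [hpst, hst]
      congr 3
      refine Finset.sum_congr rfl fun k hk => ?_
      have : k ≤ m := Nat.lt_succ_iff.1 (Finset.mem_range.1 hk)
      rw [hsm z k (by gcongr)]
    · refine (((hnm.comp (Measurable.add (hjm m) ?_)).pow_const 2).add_const _)
      exact (measurable_poissonSum hh (l + 1)).comp (measurable_id.prodMk (measurable_pi_apply _))
    · intro z
      have hEz := hE0 (z 0)
      have h1 : pNorm q (∑ k ∈ Finset.range m, h z (z (s + k * τ)) +
          poissonSum κ τ h (l + 1) z (z (s + m * τ))) ≤ (m + 1) * E + E := by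
        refine (pNorm_add_le hq1 _ _).trans ?_
        have := hsum m z fun k => z (s + k * τ)
        have := hpE (l + 1) z (z (s + m * τ))
        linarith
      have h2 := pow_le_pow_left₀ (pNorm_nonneg _) h1 2
      have : 0 ≤ 16 * q * E ^ 2 := by positivity
      rw [abs_of_nonneg (by positivity)]
      linarith
    · intro z
      simp only [hpst, hst]
      congr 4
      · refine Finset.sum_congr rfl fun k hk => ?_
        have : k ≤ m := (Finset.mem_range.1 hk).le
        rw [hsm z k (by gcongr)]
      · rw [hsm z m le_rfl]
    · intro z
      have hEz := hE0 (z 0)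
      set ν := (κ ^ τ) (z (s + m * τ))
      have hint := integral_poissonSum (κ := κ) (τ := τ) hp hh hc l z (z (s + m * τ))
      have hmz : Measurable (poissonSum κ τ h l z) :=
        (measurable_poissonSum hh l).comp measurable_prodMk_left
      have hi : pNorm q (∫ y, poissonSum κ τ h l z y ∂ν) ≤ E :=
        (hqp _).trans (mul_le_mul_of_nonneg_left (dualNorm_integral_le hp hmz
          (dualNorm_poissonSum_le hp hh hc hτ hκ h0 l z)) (Real.exp_pos 1).le)
      refine (integral_pNorm_sq_add_le hq hmz (hpE l z) hi _).trans (le_of_eq ?_)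
      rw [hint, Finset.sum_range_succ]
      congr 3
      abel

omit hp hτ hκ hZ hh hc h0 hs hq hqp in
lemma sum_range_mul_eq_sum_sum {M : Type*} [AddCommMonoid M] (f : ℕ → M) (n τ : ℕ) :
    ∑ i ∈ Finset.range (n * τ), f i =
      ∑ r ∈ Finset.range τ, ∑ k ∈ Finset.range n, f (r + k * τ) := by
  induction n with
  | zero => simp
  | succ n ih =>
    simp_rw [Finset.sum_range_succ]
    rw [Finset.sum_add_distrib, ← ih, add_mul, one_mul, Finset.sum_range_add]
    simp_rw [add_comm]

omit hq hqp in
/-- Mean square of a sum of `n` consecutive centred samples after time `N`, for summands that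
may depend on the path up to time `N`. -/
theorem integral_dualNorm_sum_sq_le (hp2 : p ≤ 2) (n : ℕ) :
    ∫ ω, dualNorm p (∑ i ∈ Finset.Icc 1 n, h (fun i => Z i ω) (Z (N + i) ω)) ^ 2 ∂μ ≤
      68 * Real.exp 1 ^ 2 * (1 + 2 * K) ^ 2 * ((1 + Real.log d) * τ * n * c ^ 2) := by
  obtain ⟨q, hq, hqd, hqe⟩ := exists_pNorm_equiv_dualNorm d hp hp2
  have hq1 : 1 ≤ q := by linarith
  obtain ⟨y₀⟩ : Nonempty S := π.nonempty_of_neZero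
  have hc0 : 0 ≤ c := (dualNorm_nonneg hp _).trans (hc (fun _ => y₀) y₀)
  have hK := hκ.const_nonneg
  set E := Real.exp 1 * ((1 + 2 * K) * c) with hE
  have hEc : c ≤ E := by
    have h1 : (1 : ℝ) ≤ Real.exp 1 := Real.one_le_exp zero_le_one
    have h2 : c ≤ (1 + 2 * K) * c := by nlinarith
    nlinarith
  -- The n samples split into τ residue classes of b terms each and a remainder of fewer than τ
  -- terms.
  set b := n / τ with hb
  let f : ℕ → Ω → Fin d → ℝ := fun i ω => h (fun i => Z i ω) (Z (N + 1 + i) ω)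
  have hfm : ∀ i, Measurable (f i) := fun i =>
    hh.comp (hZ.measurable_path.prodMk (hZ.measurable _))
  have hfq : ∀ i ω, pNorm q (f i ω) ≤ E := fun i ω => by
    refine (hqe _).2.trans (mul_le_mul_of_nonneg_left ((hc _ _).trans ?_) (Real.exp_pos 1).le)
    nlinarith
  let s : ℕ → Ω → Fin d → ℝ := fun r ω => ∑ k ∈ Finset.range b, f (r + k * τ) ω
  have hsm : ∀ r, Measurable (s r) := fun r => Finset.measurable_sum _ fun k _ => hfm _
  have hsb : ∀ r ω, pNorm q (s r ω) ≤ b * E := fun r ω => by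
    have : ∀ m : ℕ, pNorm q (∑ k ∈ Finset.range m, f (r + k * τ) ω) ≤ m * E := fun m => by
      induction m with
      | zero => simp [pNorm_zero hq1]
      | succ m ih =>
        rw [Finset.sum_range_succ]
        refine (pNorm_add_le hq1 _ _).trans ?_
        push_cast
        linarith [hfq (r + m * τ) ω]
    exact this b
  have hsi : ∀ r, Integrable (fun ω => pNorm q (s r ω) ^ 2) μ := fun r => by
    refine integrable_of_abs_le (C := (b * E) ^ 2)
      (((continuous_pNorm hq1).measurable.comp (hsm r)).pow_const 2) fun ω => ?_
    rw [abs_of_nonneg (sq_nonneg _)]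
    exact pow_le_pow_left₀ (pNorm_nonneg _) (hsb r ω) 2
  have hsE : ∀ r, ∫ ω, pNorm q (s r ω) ^ 2 ∂μ ≤ E ^ 2 * (16 * q * b) := fun r => by
    rcases Nat.eq_zero_or_pos b with hb0 | hb0
    · simp [s, hb0, pNorm_zero hq1]
    · obtain ⟨m, hm⟩ : ∃ m, b = m + 1 := ⟨b - 1, by omega⟩
      -- At l = 0 the Poisson sum is h itself and supplies the last of the b = m + 1 terms.
      have key := integral_pNorm_sq_add_poissonSum_le hp hτ hκ hZ hh hc h0 hs hq
        (fun ξ => (hqe ξ).2) (s := N + 1 + r) (by omega) m 0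
      simp only [poissonSum_zero hh] at key
      simp only [s, f, hm, ← add_assoc, Finset.sum_range_succ]
      refine key.trans (mul_le_mul_of_nonneg_left ?_ (sq_nonneg E))
      push_cast
      nlinarith
  have hpt : ∀ ω, dualNorm p (∑ i ∈ Finset.Icc 1 n, h (fun i => Z i ω) (Z (N + i) ω)) ^ 2 ≤
      2 * τ * ∑ r ∈ Finset.range τ, pNorm q (s r ω) ^ 2 + 2 * (τ * n * c ^ 2) := fun ω => by
    have e1 : ∑ i ∈ Finset.Icc 1 n, h (fun i => Z i ω) (Z (N + i) ω) =
        ∑ i ∈ Finset.range n, f i ω := by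
      have : ∀ n, ∑ i ∈ Finset.Icc 1 n, h (fun i => Z i ω) (Z (N + i) ω) =
          ∑ i ∈ Finset.range n, f i ω := fun n => by
        induction n with
        | zero => simp
        | succ n ih =>
          rw [Finset.sum_Icc_succ_top (by omega), ih, Finset.sum_range_succ]
          simp only [f]
          rw [add_assoc N 1 n, add_comm 1 n]
      exact this n
    have e2 : ∑ i ∈ Finset.range n, f i ω = ∑ r ∈ Finset.range τ, s r ω +
        ∑ i ∈ Finset.range (n % τ), f (b * τ + i) ω := by
      conv_lhs => rw [← Nat.div_add_mod' n τ]
      rw [Finset.sum_range_add, sum_range_mul_eq_sum_sum]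
    have h1 : dualNorm p (∑ r ∈ Finset.range τ, s r ω) ≤
        ∑ r ∈ Finset.range τ, pNorm q (s r ω) :=
      (dualNorm_sum_le hp _ _).trans (Finset.sum_le_sum fun r _ => (hqe _).1)
    have h2 : (∑ r ∈ Finset.range τ, pNorm q (s r ω)) ^ 2 ≤
        τ * ∑ r ∈ Finset.range τ, pNorm q (s r ω) ^ 2 := by
      simpa using sq_sum_le_card_mul_sum_sq (s := Finset.range τ) (f := fun r => pNorm q (s r ω))
    have h3 : dualNorm p (∑ i ∈ Finset.range (n % τ), f (b * τ + i) ω) ≤ (n % τ : ℕ) * c := by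
      refine (dualNorm_sum_le hp _ _).trans ?_
      simpa using Finset.sum_le_card_nsmul (Finset.range (n % τ)) _ c
        fun i _ => hc (fun i => Z i ω) (Z (N + 1 + (b * τ + i)) ω)
    -- The remainder is bounded crudely; its square already has the target order τ n.
    have h4 : ((n % τ : ℕ) : ℝ) ^ 2 ≤ τ * n := by
      rw [sq]
      have a1 : ((n % τ : ℕ) : ℝ) ≤ τ := by exact_mod_cast (Nat.mod_lt n hτ).le
      have a2 : ((n % τ : ℕ) : ℝ) ≤ n := by exact_mod_cast Nat.mod_le n τ
      gcongr
    rw [e1, e2]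
    have h5 := pow_le_pow_left₀ (dualNorm_nonneg hp _) (dualNorm_add_le hp
      (∑ r ∈ Finset.range τ, s r ω) (∑ i ∈ Finset.range (n % τ), f (b * τ + i) ω)) 2
    have h6 := pow_le_pow_left₀ (dualNorm_nonneg hp _) h1 2
    have h7 := pow_le_pow_left₀ (dualNorm_nonneg hp _) h3 2
    have h8 := mul_le_mul_of_nonneg_right h4 (sq_nonneg c)
    rw [mul_pow] at h7
    nlinarith [sq_nonneg (dualNorm p (∑ r ∈ Finset.range τ, s r ω) -
      dualNorm p (∑ i ∈ Finset.range (n % τ), f (b * τ + i) ω))]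
  have hint : Integrable (fun ω => 2 * (τ : ℝ) * ∑ r ∈ Finset.range τ, pNorm q (s r ω) ^ 2) μ :=
    (integrable_finsetSum _ fun r _ => hsi r).const_mul _
  calc _ ≤ ∫ ω, (2 * τ * ∑ r ∈ Finset.range τ, pNorm q (s r ω) ^ 2 + 2 * (τ * n * c ^ 2)) ∂μ :=
        integral_mono_of_nonneg (Filter.Eventually.of_forall fun ω => sq_nonneg _)
          (hint.add (integrable_const _)) (Filter.Eventually.of_forall hpt)
    _ = 2 * τ * ∑ r ∈ Finset.range τ, ∫ ω, pNorm q (s r ω) ^ 2 ∂μ + 2 * (τ * n * c ^ 2) := by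
        rw [integral_add hint (integrable_const _), integral_const_mul,
          integral_finsetSum _ fun r _ => hsi r]
        simp
    _ ≤ 2 * τ * (τ * (E ^ 2 * (16 * q * b))) + 2 * (τ * n * c ^ 2) := by
        gcongr
        simpa using Finset.sum_le_card_nsmul (Finset.range τ) _ _ fun r _ => hsE r
    _ ≤ 2 * τ * n * E ^ 2 * (16 * q) + 2 * τ * n * E ^ 2 := by
        have hbn : (b : ℝ) * τ ≤ n := by exact_mod_cast Nat.div_mul_le_self n τ
        have a1 := mul_le_mul_of_nonneg_left hbn
          (show 0 ≤ 2 * (τ : ℝ) * E ^ 2 * (16 * q) by positivity)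
        have a2 : c ^ 2 ≤ E ^ 2 := pow_le_pow_left₀ hc0 hEc 2
        have a3 := mul_le_mul_of_nonneg_left a2 (show 0 ≤ 2 * (τ : ℝ) * n by positivity)
        linarith
    -- Since q ≤ 2(1 + log d), one has 16q + 1 ≤ 34(1 + log d); this is half of the constant 68.
    _ ≤ 2 * τ * n * E ^ 2 * (34 * (1 + Real.log d)) := by
        have := Real.log_natCast_nonneg d
        rw [← mul_add_one (2 * (τ : ℝ) * n * E ^ 2)]
        refine mul_le_mul_of_nonneg_left ?_ (by positivity)
        linarith
    _ = _ := by rw [hE]; ring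

end Batch

/-! ### Measurability of the estimators at random indices -/

section Measurability

lemma measurable_comp_nat {A E : Type*} [MeasurableSpace A] [MeasurableSpace E] {f : ℕ → A → E}
    (hf : ∀ k, Measurable (f k)) {n : A → ℕ} (hn : Measurable n) :
    Measurable fun a => f (n a) a :=
  (measurable_from_prod_countable_right (f := fun q : ℕ × A => f q.1 q.2) hf).comp
    (hn.prodMk measurable_id)

variable {d : ℕ} {S A : Type*} [MeasurableSpace S] [MeasurableSpace A] {X : Set (Fin d → ℝ)}
  {G : (Fin d → ℝ) → S → (Fin d → ℝ)} {Z : A → ℕ → S} {x : A → Fin d → ℝ} {N n J : A → ℕ}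

lemma measurable_comp_of_continuousOn {E : Type*} [TopologicalSpace E] [MeasurableSpace E]
    [BorelSpace E] {F : (Fin d → ℝ) → E} (hF : ContinuousOn F X)
    (hx : Measurable x) (hxX : ∀ a, x a ∈ X) : Measurable fun a => F (x a) := by
  have h1 := (continuousOn_iff_continuous_domRestrict.1 hF).measurable
  have h2 : Measurable fun a => (⟨x a, hxX a⟩ : X) := hx.subtype_mk
  exact h1.comp h2

lemma measurable_dotProduct {f g : A → Fin d → ℝ} (hf : Measurable f) (hg : Measurable g) :
    Measurable fun a => f a ⬝ᵥ g a := by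
  simp only [dotProduct]
  exact Finset.measurable_sum _ fun i _ =>
    ((measurable_pi_apply i).comp hf).mul ((measurable_pi_apply i).comp hg)

variable (hG : Measurable fun q : X × S => G q.1 q.2) (hZ : Measurable Z) (hx : Measurable x)
  (hxX : ∀ a, x a ∈ X)
include hG hZ hx hxX

lemma measurable_batchMean (hN : Measurable N) (hn : Measurable n) :
    Measurable fun a => batchMean G (Z a) (N a) (n a) (x a) := by
  have h1 : ∀ m : ℕ, Measurable fun a => G (x a) (Z a m) := fun m => by
    have h2 : Measurable fun a => ((⟨x a, hxX a⟩ : X), Z a m) :=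
      Measurable.prodMk hx.subtype_mk ((measurable_pi_apply m).comp hZ)
    exact hG.comp h2
  have h3 : ∀ m k : ℕ, Measurable fun a => batchMean G (Z a) m k (x a) := fun m k => by
    have h4 : Measurable fun a => ∑ i ∈ Finset.Icc 1 k, G (x a) (Z a (m + i)) :=
      Finset.measurable_sum _ fun i _ => h1 _
    exact h4.const_smul (k : ℝ)⁻¹
  exact measurable_comp_nat (f := fun k a => batchMean G (Z a) (N a) k (x a))
    (fun k => measurable_comp_nat (f := fun m a => batchMean G (Z a) m k (x a))
      (fun m => h3 m k) hN) hn

lemma measurable_multilevel (B M : ℕ) (hN : Measurable N) (hJ : Measurable J) :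
    Measurable fun a => multilevel G (Z a) B M (N a) (J a) (x a) := by
  have hb : ∀ k, Measurable fun a => batchMean G (Z a) (N a) k (x a) := fun k =>
    measurable_batchMean hG hZ hx hxX hN measurable_const
  refine measurable_comp_nat (f := fun k a => multilevel G (Z a) B M (N a) k (x a)) (fun k => ?_) hJ
  unfold multilevel
  by_cases hk : 2 ^ k ≤ M
  · simp only [hk, if_true]
    exact (hb _).add (((hb (2 ^ k * B)).sub (hb (2 ^ (k - 1) * B))).const_smul ((2 : ℝ) ^ k))
  · simp only [hk, if_false]
    exact (hb _).add measurable_const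

end Measurability

/-! ### Adaptedness and measurability of the iterates -/

section Algorithm

variable {d : ℕ} {p : ℝ} {S : Type*} {X : Set (Fin d → ℝ)}
  {w : (Fin d → ℝ) → ℝ} {dw F : (Fin d → ℝ) → (Fin d → ℝ)} {G : (Fin d → ℝ) → S → (Fin d → ℝ)}
  {γ : ℝ} {B M : ℕ} {x0 : Fin d → ℝ}

/-- The auxiliary mirror descent sequence driven by the errors `F(x^{t+1/2}) - g^t`. -/
noncomputable def ghost (X : Set (Fin d → ℝ)) (w : (Fin d → ℝ) → ℝ)
    (dw F : (Fin d → ℝ) → (Fin d → ℝ)) (G : (Fin d → ℝ) → S → (Fin d → ℝ)) (γ : ℝ) (B M : ℕ)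
    (x0 : Fin d → ℝ) (z : ℕ → S) (j : ℕ → ℕ) : ℕ → Fin d → ℝ
  | 0 => x0
  | t + 1 => prox X w dw (ghost X w dw F G γ B M x0 z j t)
      (γ • (F (halfIter X w dw G γ B M x0 z j t) -
        multilevel G z B M ((iter X w dw G γ B M x0 z j t).2 + B) (j t)
          (halfIter X w dw G γ B M x0 z j t)))

lemma batchMean_congr {z z' : ℕ → S} {N n : ℕ} (h : ∀ i ≤ N + n, z i = z' i) (x : Fin d → ℝ) :
    batchMean G z N n x = batchMean G z' N n x := by
  unfold batchMean
  congr 1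
  refine Finset.sum_congr rfl fun i hi => ?_
  rw [h _ (by have := (Finset.mem_Icc.1 hi).2; omega)]

lemma multilevel_congr {z z' : ℕ → S} {N J : ℕ} (h : ∀ i ≤ N + 2 ^ J * B, z i = z' i)
    (x : Fin d → ℝ) : multilevel G z B M N J x = multilevel G z' B M N J x := by
  have h1 : B ≤ 2 ^ J * B := Nat.le_mul_of_pos_left _ (by positivity)
  have h2 : 2 ^ (J - 1) * B ≤ 2 ^ J * B :=
    Nat.mul_le_mul_right _ (Nat.pow_le_pow_right two_pos (Nat.sub_le _ _))
  unfold multilevel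
  rw [batchMean_congr (n := B) fun i hi => h i (by omega), batchMean_congr (n := 2 ^ J * B) h,
    batchMean_congr (n := 2 ^ (J - 1) * B) fun i hi => h i (by omega)]

/-- The two noise sequences are unrelated: sampling times are functions of the levels only, hence
constants once the levels are frozen. -/
lemma iter_snd_congr {z z' : ℕ → S} {j j' : ℕ → ℕ} {t : ℕ} (hj : ∀ i < t, j i = j' i) :
    (iter X w dw G γ B M x0 z j t).2 = (iter X w dw G γ B M x0 z' j' t).2 := by
  induction t with
  | zero => rfl
  | succ t ih => simp only [iter, ih fun i hi => hj i (by omega), hj t (by omega)]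

/-- Adaptedness to the chain: the step to t + 1 reads no sample after N_{t+1}, so the induction
hypothesis sees only earlier samples. -/
lemma iter_fst_congr {z z' : ℕ → S} {j j' : ℕ → ℕ} {t : ℕ} (hj : ∀ i < t, j i = j' i)
    (hz : ∀ i ≤ (iter X w dw G γ B M x0 z j t).2, z i = z' i) :
    (iter X w dw G γ B M x0 z j t).1 = (iter X w dw G γ B M x0 z' j' t).1 := by
  induction t with
  | zero => rfl
  | succ t ih =>
    have hj' : ∀ i < t, j i = j' i := fun i hi => hj i (by omega)
    have e2 := iter_snd_congr (X := X) (w := w) (dw := dw) (G := G) (γ := γ) (B := B) (M := M)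
      (x0 := x0) (z := z) (z' := z') hj'
    simp only [iter] at hz
    have e1 := ih hj' fun i hi => hz i (by omega)
    simp only [iter, halfStep, ← e1, ← e2, ← hj t (by omega)]
    rw [batchMean_congr (n := B) fun i hi => hz i (by omega)]
    rw [multilevel_congr (B := B) (J := j t) fun i hi => hz i (by omega)]

lemma halfIter_congr {z z' : ℕ → S} {j j' : ℕ → ℕ} {t : ℕ} (hj : ∀ i < t, j i = j' i)
    (hz : ∀ i ≤ (iter X w dw G γ B M x0 z j t).2 + B, z i = z' i) :
    halfIter X w dw G γ B M x0 z j t = halfIter X w dw G γ B M x0 z' j' t := by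
  have e2 := iter_snd_congr (X := X) (w := w) (dw := dw) (G := G) (γ := γ) (B := B) (M := M)
    (x0 := x0) (z := z) (z' := z') hj
  have e1 := iter_fst_congr (X := X) (w := w) (dw := dw) (G := G) (γ := γ) (B := B) (M := M)
    (x0 := x0) (z := z) (z' := z') hj fun i hi => hz i (by omega)
  simp only [halfIter, halfStep, ← e1, ← e2]
  rw [batchMean_congr (n := B) hz]

/-- The level J_t first acts on the iterate of index t + 1. The noise is held fixed, since this
serves only to separate J_t from the rest. -/
lemma ghost_congr {z : ℕ → S} {j j' : ℕ → ℕ} {t : ℕ} (hj : ∀ i < t, j i = j' i) :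
    ghost X w dw F G γ B M x0 z j t = ghost X w dw F G γ B M x0 z j' t := by
  induction t with
  | zero => rfl
  | succ t ih =>
    have hj' : ∀ i < t, j i = j' i := fun i hi => hj i (by omega)
    simp only [ghost]
    rw [ih hj', hj t (by omega), iter_snd_congr (z' := z) hj',
      halfIter_congr (z' := z) hj' fun _ _ => rfl]

variable (hw : IsMirrorMap p X w dw) (hXc : IsCompact X) (hx0 : x0 ∈ X)
include hw hXc hx0

lemma iter_mem (z : ℕ → S) (j : ℕ → ℕ) (t : ℕ) : (iter X w dw G γ B M x0 z j t).1 ∈ X := by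
  induction t with
  | zero => exact hx0
  | succ t ih => exact hw.prox_mem hXc ih

lemma halfIter_mem (z : ℕ → S) (j : ℕ → ℕ) (t : ℕ) : halfIter X w dw G γ B M x0 z j t ∈ X :=
  hw.prox_mem hXc (iter_mem hw hXc hx0 z j t)

lemma ghost_mem (z : ℕ → S) (j : ℕ → ℕ) (t : ℕ) : ghost X w dw F G γ B M x0 z j t ∈ X := by
  induction t with
  | zero => exact hx0
  | succ t ih => exact hw.prox_mem hXc ih

variable {A : Type*} [MeasurableSpace S] [MeasurableSpace A] (hX : Convex ℝ X) (hp : 1 ≤ p)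
  (hG : Measurable fun q : X × S => G q.1 q.2) {Z : A → ℕ → S} (hZ : Measurable Z)
  {J : A → ℕ → ℕ} (hJ : Measurable J)
include hX hp hG hZ

omit hx0 in
lemma measurable_halfStep {x : A → Fin d → ℝ} {N : A → ℕ} (hx : Measurable x)
    (hxX : ∀ a, x a ∈ X) (hN : Measurable N) :
    Measurable fun a => halfStep X w dw G γ B (Z a) (x a) (N a) :=
  hw.measurable_prox hXc hX hp hx hxX
    ((measurable_batchMean hG hZ hx hxX hN measurable_const).const_smul γ)

include hJ

lemma measurable_iter (t : ℕ) : Measurable fun a => iter X w dw G γ B M x0 (Z a) (J a) t := by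
  induction t with
  | zero => exact measurable_const
  | succ t ih =>
    have hmem := fun a => iter_mem (G := G) (γ := γ) (B := B) (M := M) hw hXc hx0 (Z a) (J a) t
    have hJt : Measurable fun a => J a t := (measurable_pi_apply t).comp hJ
    have hpow : Measurable fun a => 2 ^ (J a t) * B :=
      (measurable_of_countable fun k => 2 ^ k * B).comp hJt
    have hh := measurable_halfStep (γ := γ) (B := B) hw hXc hX hp hG hZ ih.fst hmem ih.snd
    have hml := measurable_multilevel hG hZ hh (fun a => hw.prox_mem hXc (hmem a)) B M
      (ih.snd.add_const B) hJt
    exact (hw.measurable_prox hXc hX hp ih.fst hmem (hml.const_smul γ)).prodMk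
      ((ih.snd.add_const B).add hpow)

lemma measurable_halfIter (t : ℕ) :
    Measurable fun a => halfIter X w dw G γ B M x0 (Z a) (J a) t := by
  have h := measurable_iter (γ := γ) (B := B) (M := M) hw hXc hx0 hX hp hG hZ hJ t
  exact measurable_halfStep hw hXc hX hp hG hZ h.fst (fun a => iter_mem hw hXc hx0 _ _ t) h.snd

lemma measurable_ghost (hF : ContinuousOn F X) (t : ℕ) :
    Measurable fun a => ghost X w dw F G γ B M x0 (Z a) (J a) t := by
  induction t with
  | zero => exact measurable_const
  | succ t ih =>
    have hJt : Measurable fun a => J a t := (measurable_pi_apply t).comp hJ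
    have hi := measurable_iter (γ := γ) (B := B) (M := M) hw hXc hx0 hX hp hG hZ hJ t
    have hh := measurable_halfIter (γ := γ) (B := B) (M := M) hw hXc hx0 hX hp hG hZ hJ t
    have hmem := fun a => halfIter_mem (G := G) (γ := γ) (B := B) (M := M) hw hXc hx0 (Z a) (J a) t
    exact hw.measurable_prox hXc hX hp ih (fun a => ghost_mem hw hXc hx0 _ _ t)
      (((measurable_comp_of_continuousOn hF hh hmem).sub
        (measurable_multilevel hG hZ hh hmem B M (hi.snd.add_const B) hJt)).const_smul γ)

end Algorithm

/-! ### Pathwise errors of the estimators -/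

section Noise

variable {d : ℕ} {p : ℝ} {S : Type*} {X : Set (Fin d → ℝ)} {F : (Fin d → ℝ) → (Fin d → ℝ)}
  {G : (Fin d → ℝ) → S → (Fin d → ℝ)} {σ : ℝ}

lemma batchMean_sub {n : ℕ} (hn : n ≠ 0) (z : ℕ → S) (N : ℕ) (x : Fin d → ℝ) :
    batchMean G z N n x - F x = (n : ℝ)⁻¹ • ∑ i ∈ Finset.Icc 1 n, (G x (z (N + i)) - F x) := by
  rw [batchMean, Finset.sum_sub_distrib, smul_sub, Finset.sum_const, Nat.card_Icc,
    Nat.add_sub_cancel, ← Nat.cast_smul_eq_nsmul ℝ, inv_smul_smul₀ (by exact_mod_cast hn)]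

lemma dualNorm_batchMean_sub_le (hp : 1 ≤ p)
    (hσ : ∀ x ∈ X, ∀ z, dualNorm p (G x z - F x) ^ 2 ≤ σ ^ 2) {n : ℕ} (hn : n ≠ 0) (z : ℕ → S)
    (N : ℕ) {x : Fin d → ℝ} (hx : x ∈ X) : dualNorm p (batchMean G z N n x - F x) ≤ |σ| := by
  have hn0 : (0 : ℝ) < n := by exact_mod_cast Nat.pos_of_ne_zero hn
  rw [batchMean_sub hn]
  refine (dualNorm_smul_le hp _ _).trans ?_
  rw [abs_of_pos (inv_pos.2 hn0), inv_mul_le_iff₀ hn0]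
  refine (dualNorm_sum_le hp _ _).trans ?_
  simpa using Finset.sum_le_card_nsmul (Finset.Icc 1 n) _ |σ| fun i _ =>
    (le_abs_self _).trans (sq_le_sq.1 (hσ x hx (z (N + i))))

/-- The error of the multilevel estimator in terms of those of its batch means. -/
lemma dualNorm_multilevel_sub_sq_le (hp : 1 ≤ p) (z : ℕ → S) (B M N J : ℕ) (x : Fin d → ℝ) :
    dualNorm p (multilevel G z B M N J x - F x) ^ 2 ≤
      3 * (dualNorm p (batchMean G z N B x - F x) ^ 2 +
        if 2 ^ J ≤ M then (4 : ℝ) ^ J * (dualNorm p (batchMean G z N (2 ^ J * B) x - F x) ^ 2 +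
          dualNorm p (batchMean G z N (2 ^ (J - 1) * B) x - F x) ^ 2) else 0) := by
  unfold multilevel
  split_ifs with h
  · set a := batchMean G z N B x
    set b := batchMean G z N (2 ^ J * B) x
    set c := batchMean G z N (2 ^ (J - 1) * B) x
    have e : a + (2 : ℝ) ^ J • (b - c) - F x =
        (a - F x) + (2 : ℝ) ^ J • ((b - F x) + (F x - c)) := by
      rw [sub_add_sub_cancel]; abel
    have h1 := dualNorm_add_le hp (a - F x) ((2 : ℝ) ^ J • ((b - F x) + (F x - c)))
    have h2 := dualNorm_smul_le hp ((2 : ℝ) ^ J) ((b - F x) + (F x - c))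
    have h3 := dualNorm_add_le hp (b - F x) (F x - c)
    rw [dualNorm_sub_comm hp (F x) c] at h3
    rw [abs_of_pos (by positivity)] at h2
    rw [← e] at h1
    have h4 := mul_le_mul_of_nonneg_left h3 (show (0 : ℝ) ≤ 2 ^ J by positivity)
    have h5 : dualNorm p (a + (2 : ℝ) ^ J • (b - c) - F x) ≤ dualNorm p (a - F x) +
        (2 ^ J * dualNorm p (b - F x) + 2 ^ J * dualNorm p (c - F x)) := by linarith
    have h6 := pow_le_pow_left₀ (dualNorm_nonneg hp _) h5 2
    have e4 : (4 : ℝ) ^ J = (2 ^ J) ^ 2 := by rw [← pow_mul, mul_comm, pow_mul]; norm_num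
    rw [e4]
    set u := dualNorm p (a - F x)
    set v := dualNorm p (b - F x)
    set y := dualNorm p (c - F x)
    nlinarith [sq_nonneg (u - 2 ^ J * v), sq_nonneg (u - 2 ^ J * y),
      sq_nonneg (2 ^ J * v - 2 ^ J * y)]
  · rw [add_zero, add_zero]
    nlinarith [sq_nonneg (dualNorm p (batchMean G z N B x - F x))]

end Noise

/-! ### Independence of the levels and averages over them -/

section Independence

variable {Ω α β : Type*} [MeasurableSpace Ω] [MeasurableSpace α] [MeasurableSpace β]
  {μ : Measure Ω} [IsProbabilityMeasure μ]

/-- Fubini for the product law: a bound proved for every frozen value of U passes to the random one.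
It is used with the levels as U and the chain as V. -/
lemma integral_le_of_indepFun {U : Ω → α} {V : Ω → β} (hUV : IndepFun U V μ) (hU : Measurable U)
    (hV : Measurable V) {Φ : α → β → ℝ} {ψ : α → ℝ} {C : ℝ}
    (hΦ : Measurable (Function.uncurry Φ)) (hΦC : ∀ a b, |Φ a b| ≤ C) (hψ : Measurable ψ)
    (hψC : ∀ a, |ψ a| ≤ C) (h : ∀ a, ∫ ω, Φ a (V ω) ∂μ ≤ ψ a) :
    ∫ ω, Φ (U ω) (V ω) ∂μ ≤ ∫ ω, ψ (U ω) ∂μ := by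
  have h1 : IsProbabilityMeasure (μ.map U) := Measure.isProbabilityMeasure_map hU.aemeasurable
  have h2 : IsProbabilityMeasure (μ.map V) := Measure.isProbabilityMeasure_map hV.aemeasurable
  have hi : Integrable (Function.uncurry Φ) ((μ.map U).prod (μ.map V)) :=
    integrable_of_abs_le hΦ fun q => hΦC q.1 q.2
  have e1 : ∫ ω, Φ (U ω) (V ω) ∂μ = ∫ q, Function.uncurry Φ q ∂((μ.map U).prod (μ.map V)) := by
    rw [← (indepFun_iff_map_prod_eq_prod_map_map hU.aemeasurable hV.aemeasurable).1 hUV,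
      integral_map (hU.prodMk hV).aemeasurable hΦ.aestronglyMeasurable]
    rfl
  have e2 : ∫ ω, ψ (U ω) ∂μ = ∫ a, ψ a ∂(μ.map U) :=
    (integral_map hU.aemeasurable hψ.aestronglyMeasurable).symm
  rw [e1, e2, integral_prod _ hi]
  refine integral_mono hi.integral_prod_left (integrable_of_abs_le hψ hψC) fun a => ?_
  have hm : Measurable (Φ a) := hΦ.comp measurable_prodMk_left
  change ∫ b, Φ a b ∂(μ.map V) ≤ ψ a
  rw [integral_map hV.aemeasurable hm.aestronglyMeasurable]
  exact h a

/-- The sequence `j` with the entries from `t` on replaced by `0`. -/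
def trunc (t : ℕ) (j : ℕ → ℕ) : ℕ → ℕ := fun i => if i < t then j i else 0

lemma trunc_apply {t i : ℕ} (h : i < t) (j : ℕ → ℕ) : trunc t j i = j i := if_pos h

lemma measurable_trunc (t : ℕ) : Measurable (trunc t) :=
  measurable_pi_lambda _ fun i => by
    by_cases h : i < t
    · simp only [trunc, h, if_true]; exact measurable_pi_apply i
    · simp only [trunc, h, if_false]; exact measurable_const

lemma indepFun_prodMk_of_indepFun {γ : Type*} [MeasurableSpace γ] {U : Ω → α} {V : Ω → β}
    {W : Ω → γ} (hU : Measurable U) (hV : Measurable V) (hW : Measurable W)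
    (hUV : IndepFun U V μ) (hUVW : IndepFun (fun ω => (U ω, V ω)) W μ) :
    IndepFun U (fun ω => (V ω, W ω)) μ := by
  have hVW : IndepFun V W μ := hUVW.comp measurable_snd measurable_id
  rw [indepFun_iff_map_prod_eq_prod_map_map hU.aemeasurable (hV.prodMk hW).aemeasurable,
    (indepFun_iff_map_prod_eq_prod_map_map hV.aemeasurable hW.aemeasurable).1 hVW]
  have h1 := (indepFun_iff_map_prod_eq_prod_map_map (hU.prodMk hV).aemeasurable
    hW.aemeasurable).1 hUVW
  rw [(indepFun_iff_map_prod_eq_prod_map_map hU.aemeasurable hV.aemeasurable).1 hUV] at h1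
  have h2 := congrArg (Measure.map MeasurableEquiv.prodAssoc) h1
  have : IsProbabilityMeasure (μ.map U) := Measure.isProbabilityMeasure_map hU.aemeasurable
  have : IsProbabilityMeasure (μ.map V) := Measure.isProbabilityMeasure_map hV.aemeasurable
  have : IsProbabilityMeasure (μ.map W) := Measure.isProbabilityMeasure_map hW.aemeasurable
  rw [Measure.prodAssoc_prod, Measure.map_map MeasurableEquiv.prodAssoc.measurable
    ((hU.prodMk hV).prodMk hW)] at h2
  exact h2

variable {J : ℕ → Ω → ℕ}

omit [IsProbabilityMeasure μ] in
lemma IsGeomLevels.measurable_path (hJ : IsGeomLevels J μ) : Measurable fun ω t => J t ω :=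
  measurable_pi_lambda _ hJ.measurable

/-- With V the whole chain, J_t is independent of everything that determines x^{t+1/2}, v^t and all
batch errors at time t. -/
lemma IsGeomLevels.indepFun_trunc (hJ : IsGeomLevels J μ) {V : Ω → β} (hV : Measurable V)
    (hJV : IndepFun (fun ω t => J t ω) V μ) (t : ℕ) :
    IndepFun (J t) (fun ω => (trunc t (fun i => J i ω), V ω)) μ := by
  have hm := hJ.measurable_path
  refine indepFun_prodMk_of_indepFun (hJ.measurable t) ((measurable_trunc t).comp hm) hV ?_ ?_
  · have h := hJ.indep.indepFun_finset {t} (Finset.range t) (by simp) hJ.measurable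
    let f : (({t} : Finset ℕ) → ℕ) → ℕ := fun a => a ⟨t, Finset.mem_singleton_self t⟩
    let g : (Finset.range t → ℕ) → ℕ → ℕ := fun a i =>
      if hi : i < t then a ⟨i, Finset.mem_range.2 hi⟩ else 0
    have hf : Measurable f := measurable_pi_apply _
    have hg : Measurable g := measurable_pi_lambda _ fun i => by
      by_cases hi : i < t
      · simp only [g, hi, dite_true]; exact measurable_pi_apply _
      · simp only [g, hi, dite_false]; exact measurable_const
    have h2 := h.comp hf hg
    have e : (g ∘ fun ω (i : Finset.range t) => J i ω) = fun ω => trunc t (fun i => J i ω) := by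
      funext ω i
      by_cases hi : i < t <;> simp [g, trunc, hi]
    rw [e] at h2
    exact h2
  · exact hJV.comp (φ := fun j : ℕ → ℕ => (j t, trunc t j))
      ((measurable_pi_apply t).prodMk (measurable_trunc t)) measurable_id

omit [IsProbabilityMeasure μ] in
lemma IsGeomLevels.integral_ite (hJ : IsGeomLevels J μ) (t : ℕ) {k : ℕ} (hk : 1 ≤ k) :
    ∫ ω, (if J t ω = k then (2 : ℝ) ^ k else 0) ∂μ = 1 := by
  have hs : MeasurableSet {ω | J t ω = k} := hJ.measurable t (measurableSet_singleton k)
  have e : (fun ω => if J t ω = k then (2 : ℝ) ^ k else 0) =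
      Set.indicator {ω | J t ω = k} fun _ => (2 : ℝ) ^ k := by
    funext ω
    by_cases h : J t ω = k <;> simp [h]
  rw [e, integral_indicator hs, setIntegral_const, hJ.law t k hk, smul_eq_mul, ← mul_pow]
  norm_num

lemma IsGeomLevels.integrable_ite (hJ : IsGeomLevels J μ) (t k : ℕ) :
    Integrable (fun ω => if J t ω = k then (2 : ℝ) ^ k else 0) μ := by
  refine integrable_of_abs_le (C := (2 : ℝ) ^ k)
    ((measurable_of_countable fun i : ℕ => if i = k then (2 : ℝ) ^ k else 0).comp
      (hJ.measurable t)) fun ω => ?_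
  split_ifs <;> simp

/-- Each level 1 ≤ k ≤ log₂ M contributes 2^k 2^{-k} = 1. The extra 1 covers the null event J_t = 0,
which the pointwise bound does not exclude. -/
lemma IsGeomLevels.integral_two_pow_le (hJ : IsGeomLevels J μ) (t M : ℕ) :
    ∫ ω, (if 2 ^ J t ω ≤ M then (2 : ℝ) ^ J t ω else 0) ∂μ ≤ 1 + Nat.log 2 M := by
  have hpt : ∀ ω, (if 2 ^ J t ω ≤ M then (2 : ℝ) ^ J t ω else 0) ≤
      1 + ∑ k ∈ Finset.Icc 1 (Nat.log 2 M), if J t ω = k then (2 : ℝ) ^ k else 0 := fun ω => by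
    have h0 : 0 ≤ ∑ k ∈ Finset.Icc 1 (Nat.log 2 M), if J t ω = k then (2 : ℝ) ^ k else 0 :=
      Finset.sum_nonneg fun k _ => by split_ifs <;> positivity
    rw [Finset.sum_ite_eq] at h0 ⊢
    split_ifs with h1 h2 h2
    · linarith
    · have : Nat.log 2 M < J t ω ∨ J t ω = 0 := by
        rw [Finset.mem_Icc] at h2; omega
      rcases this with h | h
      · exact absurd (Nat.le_log_of_pow_le one_lt_two h1) (by omega)
      · simp [h]
    · linarith [pow_pos (two_pos (α := ℝ)) (J t ω)]
    · norm_num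
  have hi : Integrable (fun ω => ∑ k ∈ Finset.Icc 1 (Nat.log 2 M),
      if J t ω = k then (2 : ℝ) ^ k else 0) μ :=
    integrable_finsetSum _ fun k _ => hJ.integrable_ite t k
  calc _ ≤ ∫ ω, (1 + ∑ k ∈ Finset.Icc 1 (Nat.log 2 M),
          if J t ω = k then (2 : ℝ) ^ k else 0) ∂μ := by
        refine integral_mono_of_nonneg (Filter.Eventually.of_forall fun ω => ?_)
          ((integrable_const _).add hi) (Filter.Eventually.of_forall hpt)
        simp only [Pi.zero_apply]
        split_ifs <;> positivity
    _ = _ := by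
        rw [integral_add (integrable_const _) hi, integral_finsetSum _ fun k _ =>
          hJ.integrable_ite t k, Finset.sum_congr rfl fun k hk =>
          hJ.integral_ite t (Finset.mem_Icc.1 hk).1]
        simp

end Independence

lemma abs_dotProduct_le {d : ℕ} {p : ℝ} (hp : 1 ≤ p) (ξ z : Fin d → ℝ) :
    |ξ ⬝ᵥ z| ≤ dualNorm p ξ * pNorm p z := by
  refine abs_le'.2 ⟨dotProduct_le hp ξ z, ?_⟩
  rw [← neg_dotProduct, ← dualNorm_neg hp ξ]
  exact dotProduct_le hp _ _

/-! ### Batch error at a point determined by the past -/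

section BatchError

variable {d : ℕ} {p : ℝ} {S Ω : Type*} [MeasurableSpace S] [MeasurableSpace Ω] {κ : Kernel S S}
  [IsMarkovKernel κ] {π : Measure S} [IsProbabilityMeasure π] {τ : ℕ} {K : ℝ}
  {Z : ℕ → Ω → S} {μ : Measure Ω} [IsProbabilityMeasure μ] {X : Set (Fin d → ℝ)}
  {F : (Fin d → ℝ) → (Fin d → ℝ)} {G : (Fin d → ℝ) → S → (Fin d → ℝ)} {σ Λ : ℝ}

/-- Mean square error of a batch mean at a point determined by the past of the chain. -/
lemma integral_dualNorm_batchMean_sq_le (hp : 1 ≤ p) (hp2 : p ≤ 2) (hτ : 1 ≤ τ)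
    (hκ : IsUniformlyErgodic κ π τ K) (hZ : IsMarkovChain κ Z μ)
    (hG : Measurable fun q : X × S => G q.1 q.2) (hF : ContinuousOn F X)
    (hmean : ∀ x ∈ X, ∫ z, G x z ∂π = F x)
    (hσ : ∀ x ∈ X, ∀ z, dualNorm p (G x z - F x) ^ 2 ≤ σ ^ 2)
    (hΛ : Λ = 68 * Real.exp 1 ^ 2 * (1 + 2 * K) ^ 2 * ((1 + Real.log d) * τ * σ ^ 2))
    {φ : (ℕ → S) → Fin d → ℝ} (hφ : Measurable φ) (hφX : ∀ z, φ z ∈ X) {N n : ℕ}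
    (hφs : ∀ z, φ (freeze N z) = φ z) (hn : n ≠ 0) :
    ∫ ω, dualNorm p (batchMean G (fun i => Z i ω) N n (φ fun i => Z i ω) -
      F (φ fun i => Z i ω)) ^ 2 ∂μ ≤ Λ / n := by
  have hn0 : (0 : ℝ) < n := by exact_mod_cast Nat.pos_of_ne_zero hn
  let h : (ℕ → S) → S → Fin d → ℝ := fun z y => G (φ z) y - F (φ z)
  have hGm : Measurable fun q : (ℕ → S) × S => G (φ q.1) q.2 := by
    have h2 : Measurable fun q : (ℕ → S) × S => ((⟨φ q.1, hφX q.1⟩ : X), q.2) :=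
      Measurable.prodMk (hφ.comp measurable_fst).subtype_mk measurable_snd
    exact hG.comp h2
  have hFm : Measurable fun q : (ℕ → S) × S => F (φ q.1) :=
    measurable_comp_of_continuousOn hF (hφ.comp measurable_fst) fun q => hφX q.1
  have hhm : Measurable (Function.uncurry h) := hGm.sub hFm
  have hc : ∀ z y, dualNorm p (h z y) ≤ |σ| := fun z y =>
    (le_abs_self _).trans (sq_le_sq.1 (hσ _ (hφX z) y))
  have h0 : ∀ z, ∫ y, h z y ∂π = 0 := fun z => by
    have hi : Integrable (h z) π :=
      integrable_of_dualNorm_le hp (hhm.comp measurable_prodMk_left) (hc z)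
    have hGi : Integrable (fun y => G (φ z) y) π := by
      have := hi.add (integrable_const (F (φ z)))
      refine this.congr (Filter.Eventually.of_forall fun y => ?_)
      simp [h]
    simp only [h]
    rw [integral_sub hGi (integrable_const _), hmean _ (hφX z)]
    simp
  have key := integral_dualNorm_sum_sq_le hp hτ hκ hZ hhm hc h0
    (N := N) (fun z y => by simp only [h, hφs]) hp2 n
  rw [sq_abs] at key
  have hpt : ∀ ω, dualNorm p (batchMean G (fun i => Z i ω) N n (φ fun i => Z i ω) -
      F (φ fun i => Z i ω)) ^ 2 ≤ ((n : ℝ)⁻¹) ^ 2 *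
      dualNorm p (∑ i ∈ Finset.Icc 1 n, h (fun i => Z i ω) (Z (N + i) ω)) ^ 2 := fun ω => by
    rw [batchMean_sub hn, ← mul_pow]
    refine pow_le_pow_left₀ (dualNorm_nonneg hp _) ?_ 2
    refine (dualNorm_smul_le hp _ _).trans_eq ?_
    rw [abs_of_pos (inv_pos.2 hn0)]
  have hi : Integrable (fun ω => ((n : ℝ)⁻¹) ^ 2 *
      dualNorm p (∑ i ∈ Finset.Icc 1 n, h (fun i => Z i ω) (Z (N + i) ω)) ^ 2) μ := by
    refine (integrable_of_abs_le (C := (n * |σ|) ^ 2) ?_ fun ω => ?_).const_mul _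
    · refine ((continuous_dualNorm hp).measurable.comp ?_).pow_const 2
      exact Finset.measurable_sum _ fun i _ => hhm.comp
        (hZ.measurable_path.prodMk (hZ.measurable _))
    · rw [abs_of_nonneg (sq_nonneg _)]
      refine pow_le_pow_left₀ (dualNorm_nonneg hp _) ((dualNorm_sum_le hp _ _).trans ?_) 2
      simpa using Finset.sum_le_card_nsmul (Finset.Icc 1 n) _ |σ| fun i _ =>
        hc (fun i => Z i ω) (Z (N + i) ω)
  refine (integral_mono_of_nonneg (Filter.Eventually.of_forall fun ω => sq_nonneg _) hi
    (Filter.Eventually.of_forall hpt)).trans ?_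
  rw [integral_const_mul]
  refine (mul_le_mul_of_nonneg_left key (by positivity)).trans_eq ?_
  rw [hΛ]
  field_simp

end BatchError

/-! ### Oracle errors along the trajectory and their mean squares -/

section Errors

variable {d : ℕ} {S : Type*} (X : Set (Fin d → ℝ)) (w : (Fin d → ℝ) → ℝ)
  (dw F : (Fin d → ℝ) → (Fin d → ℝ)) (G : (Fin d → ℝ) → S → (Fin d → ℝ)) (γ : ℝ) (B M : ℕ)
  (x0 : Fin d → ℝ) (z : ℕ → S) (j : ℕ → ℕ) (t : ℕ)

/-- The error of the batch mean used in the extrapolation step. -/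
noncomputable def initErr : Fin d → ℝ :=
  batchMean G z (iter X w dw G γ B M x0 z j t).2 B (iter X w dw G γ B M x0 z j t).1 -
    F (iter X w dw G γ B M x0 z j t).1

/-- The error at `x^{t+1/2}` of the batch mean of size `n`. -/
noncomputable def midErr (n : ℕ) : Fin d → ℝ :=
  batchMean G z ((iter X w dw G γ B M x0 z j t).2 + B) n (halfIter X w dw G γ B M x0 z j t) -
    F (halfIter X w dw G γ B M x0 z j t)

/-- The error at `x^{t+1/2}` of the multilevel estimator. -/
noncomputable def multilevelErr : Fin d → ℝ :=
  multilevel G z B M ((iter X w dw G γ B M x0 z j t).2 + B) (j t)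
    (halfIter X w dw G γ B M x0 z j t) - F (halfIter X w dw G γ B M x0 z j t)

end Errors

section Expectation

variable {d : ℕ} {p : ℝ} {S Ω : Type*} [MeasurableSpace S] [MeasurableSpace Ω] {κ : Kernel S S}
  [IsMarkovKernel κ] {π : Measure S} [IsProbabilityMeasure π] {τ : ℕ} {K : ℝ}
  {Z : ℕ → Ω → S} {J : ℕ → Ω → ℕ} {μ : Measure Ω} [IsProbabilityMeasure μ] {X : Set (Fin d → ℝ)}
  {w : (Fin d → ℝ) → ℝ} {dw F : (Fin d → ℝ) → (Fin d → ℝ)} {G : (Fin d → ℝ) → S → (Fin d → ℝ)}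
  {σ Λ γ : ℝ} {B M : ℕ} {x0 : Fin d → ℝ}

local notation "traj" => iter X w dw G γ B M x0
local notation "mid" => halfIter X w dw G γ B M x0
local notation "aux" => ghost X w dw F G γ B M x0

local notation "batchErr" => midErr X w dw F G γ B M x0
local notation "levelErr" => multilevelErr X w dw F G γ B M x0
local notation "startErr" => initErr X w dw F G γ B M x0

variable (hp : 1 ≤ p) (hX : Convex ℝ X) (hXc : IsCompact X) (hw : IsMirrorMap p X w dw)
  (hx0 : x0 ∈ X) (hG : Measurable fun q : X × S => G q.1 q.2) (hF : ContinuousOn F X)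
  (hσ : ∀ x ∈ X, ∀ z, dualNorm p (G x z - F x) ^ 2 ≤ σ ^ 2)

include hp hX hXc hw hx0 hG hF

lemma measurable_batchErr {A : Type*} [MeasurableSpace A] {ζ : A → ℕ → S} (hζ : Measurable ζ)
    {j : A → ℕ → ℕ} (hj : Measurable j) (t n : ℕ) :
    Measurable fun a => batchErr (ζ a) (j a) t n := by
  have hi := measurable_iter (γ := γ) (B := B) (M := M) hw hXc hx0 hX hp hG hζ hj t
  have hh := measurable_halfIter (γ := γ) (B := B) (M := M) hw hXc hx0 hX hp hG hζ hj t
  have hm := fun a => halfIter_mem (G := G) (γ := γ) (B := B) (M := M) hw hXc hx0 (ζ a) (j a) t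
  exact (measurable_batchMean hG hζ hh hm (hi.snd.add_const B) measurable_const).sub
    (measurable_comp_of_continuousOn hF hh hm)

lemma measurable_initErr {A : Type*} [MeasurableSpace A] {ζ : A → ℕ → S}
    (hζ : Measurable ζ) {j : A → ℕ → ℕ} (hj : Measurable j) (t : ℕ) :
    Measurable fun a => startErr (ζ a) (j a) t := by
  have hi := measurable_iter (γ := γ) (B := B) (M := M) hw hXc hx0 hX hp hG hζ hj t
  have hm := fun a => iter_mem (G := G) (γ := γ) (B := B) (M := M) hw hXc hx0 (ζ a) (j a) t
  exact (measurable_batchMean hG hζ hi.fst hm hi.snd measurable_const).sub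
    (measurable_comp_of_continuousOn hF hi.fst hm)

lemma measurable_multilevelErr {A : Type*} [MeasurableSpace A] {ζ : A → ℕ → S}
    (hζ : Measurable ζ) {j : A → ℕ → ℕ} (hj : Measurable j) (t : ℕ) :
    Measurable fun a => levelErr (ζ a) (j a) t := by
  have hi := measurable_iter (γ := γ) (B := B) (M := M) hw hXc hx0 hX hp hG hζ hj t
  have hh := measurable_halfIter (γ := γ) (B := B) (M := M) hw hXc hx0 hX hp hG hζ hj t
  have hm := fun a => halfIter_mem (G := G) (γ := γ) (B := B) (M := M) hw hXc hx0 (ζ a) (j a) t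
  exact (measurable_multilevel hG hζ hh hm B M (hi.snd.add_const B)
    ((measurable_pi_apply t).comp hj)).sub (measurable_comp_of_continuousOn hF hh hm)

omit [MeasurableSpace S] hX hXc hw hx0 hG hF in
lemma dualNorm_levelErr_sq_le_batchErr (z : ℕ → S) (j : ℕ → ℕ) (t : ℕ) :
    dualNorm p (levelErr z j t) ^ 2 ≤ 3 * (dualNorm p (batchErr z j t B) ^ 2 +
      if 2 ^ j t ≤ M then (4 : ℝ) ^ j t * (dualNorm p (batchErr z j t (2 ^ j t * B)) ^ 2 +
        dualNorm p (batchErr z j t (2 ^ (j t - 1) * B)) ^ 2) else 0) :=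
  dualNorm_multilevel_sub_sq_le hp z B M _ (j t) (mid z j t)

omit [MeasurableSpace S] hX hG hF in
include hσ in
lemma dualNorm_batchErr_le {n : ℕ} (hn : n ≠ 0) (z : ℕ → S) (j : ℕ → ℕ) (t : ℕ) :
    dualNorm p (batchErr z j t n) ≤ |σ| :=
  dualNorm_batchMean_sub_le hp hσ hn _ _ (halfIter_mem hw hXc hx0 _ _ _)

omit [MeasurableSpace S] hX hG hF in
include hσ in
lemma dualNorm_multilevelErr_sq_le (hB : B ≠ 0) (z : ℕ → S) (j : ℕ → ℕ) (t : ℕ) :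
    dualNorm p (levelErr z j t) ^ 2 ≤
      3 * (1 + 2 * (M : ℝ) ^ 2) * σ ^ 2 := by
  have hs : ∀ n, n ≠ 0 → dualNorm p (batchErr z j t n) ^ 2 ≤ σ ^ 2 := fun n hn => by
    rw [← sq_abs σ]
    exact pow_le_pow_left₀ (dualNorm_nonneg hp _) (dualNorm_batchErr_le hp hXc hw hx0 hσ hn z j t) 2
  refine (dualNorm_levelErr_sq_le_batchErr hp z j t).trans ?_
  have h1 := hs B hB
  have h2 := hs (2 ^ j t * B) (by positivity)
  have h3 := hs (2 ^ (j t - 1) * B) (by positivity)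
  have : 0 ≤ (M : ℝ) ^ 2 * σ ^ 2 := by positivity
  split_ifs with h
  · have hM : (4 : ℝ) ^ j t ≤ (M : ℝ) ^ 2 := by
      have h4 : ((2 : ℝ) ^ j t) ≤ M := by exact_mod_cast h
      calc (4 : ℝ) ^ j t = (2 ^ j t) ^ 2 := by rw [← pow_mul, mul_comm, pow_mul]; norm_num
        _ ≤ _ := pow_le_pow_left₀ (by positivity) h4 2
    have h5 : (4 : ℝ) ^ j t * (dualNorm p (batchErr z j t (2 ^ j t * B)) ^ 2 +
        dualNorm p (batchErr z j t (2 ^ (j t - 1) * B)) ^ 2) ≤ (M : ℝ) ^ 2 * (σ ^ 2 + σ ^ 2) :=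
      mul_le_mul hM (add_le_add h2 h3) (by positivity) (by positivity)
    linarith
  · linarith

variable (hp2 : p ≤ 2) (hτ : 1 ≤ τ) (hκ : IsUniformlyErgodic κ π τ K) (hZ : IsMarkovChain κ Z μ)
  (hmean : ∀ x ∈ X, ∫ z, G x z ∂π = F x)
  (hΛ : Λ = 68 * Real.exp 1 ^ 2 * (1 + 2 * K) ^ 2 * ((1 + Real.log d) * τ * σ ^ 2))
include hp2 hτ hκ hZ hmean hΛ hσ

/-- With frozen levels N_t + B is a deterministic time, and x^{t+1/2} depends on the chain only up
to it, so the bound for past-determined points applies. -/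
lemma integral_batchErr_sq_le (j : ℕ → ℕ) (t : ℕ) {n : ℕ} (hn : n ≠ 0) :
    ∫ ω, dualNorm p (batchErr (fun i => Z i ω) j t n) ^ 2 ∂μ ≤ Λ / n := by
  obtain ⟨y₀⟩ : Nonempty S := π.nonempty_of_neZero
  have hN : ∀ z : ℕ → S, (traj z j t).2 = (traj (fun _ => y₀) j t).2 := fun z =>
    iter_snd_congr fun _ _ => rfl
  simp only [midErr, hN]
  refine integral_dualNorm_batchMean_sq_le (φ := fun z => mid z j t) hp hp2 hτ hκ hZ hG hF hmean
    hσ hΛ ?_ (fun z => halfIter_mem hw hXc hx0 z j t) (fun z => ?_) hn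
  · exact measurable_halfIter hw hXc hx0 hX hp hG measurable_id measurable_const t
  · exact halfIter_congr (fun _ _ => rfl) fun i hi => freeze_apply (by rwa [hN] at hi) z

lemma integral_startErr_sq_le (j : ℕ → ℕ) (t : ℕ) (hB : B ≠ 0) :
    ∫ ω, dualNorm p (startErr (fun i => Z i ω) j t) ^ 2 ∂μ ≤ Λ / B := by
  obtain ⟨y₀⟩ : Nonempty S := π.nonempty_of_neZero
  have hN : ∀ z : ℕ → S, (traj z j t).2 = (traj (fun _ => y₀) j t).2 := fun z =>
    iter_snd_congr fun _ _ => rfl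
  simp only [initErr, hN]
  refine integral_dualNorm_batchMean_sq_le (φ := fun z => (traj z j t).1) hp hp2 hτ hκ hZ hG hF
    hmean hσ hΛ ?_ (fun z => iter_mem hw hXc hx0 z j t) (fun z => ?_) hB
  · exact (measurable_iter hw hXc hx0 hX hp hG measurable_id measurable_const t).fst
  · exact iter_fst_congr (fun _ _ => rfl) fun i hi => freeze_apply (by rwa [hN] at hi) z

/-- The two batches at level k have mean square errors adding up to at most 3Λ/(2^k B); the squared
weight 4^k leaves 3 · 2^k Λ/B, to be offset later by the probability 2^{-k}. -/
lemma integral_multilevelErr_sq_le_of_levels (hB : B ≠ 0) (j : ℕ → ℕ) (t : ℕ) :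
    ∫ ω, dualNorm p (levelErr (fun i => Z i ω) j t) ^ 2 ∂μ ≤
      3 * (Λ / B) * (1 + 3 * if 2 ^ j t ≤ M then (2 : ℝ) ^ j t else 0) := by
  have hB0 : (0 : ℝ) < B := by exact_mod_cast Nat.pos_of_ne_zero hB
  have hint : ∀ n, n ≠ 0 →
      Integrable (fun ω => dualNorm p (batchErr (fun i => Z i ω) j t n) ^ 2) μ := fun n hn => by
    refine integrable_of_abs_le (C := |σ| ^ 2) (((continuous_dualNorm hp).measurable.comp
      (measurable_batchErr hp hX hXc hw hx0 hG hF hZ.measurable_path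
        measurable_const t n)).pow_const 2) fun ω => ?_
    rw [abs_of_nonneg (sq_nonneg _)]
    exact pow_le_pow_left₀ (dualNorm_nonneg hp _) (dualNorm_batchErr_le hp hXc hw hx0 hσ hn _ j t) 2
  have hE : ∀ n, n ≠ 0 → ∫ ω, dualNorm p (batchErr (fun i => Z i ω) j t n) ^ 2 ∂μ ≤ Λ / n :=
    fun n hn => integral_batchErr_sq_le hp hX hXc hw hx0 hG hF hσ hp2 hτ hκ hZ hmean hΛ j t hn
  have hΛ0 : 0 ≤ Λ := by
    have := Real.log_natCast_nonneg d
    rw [hΛ]; positivity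
  have hn1 : 2 ^ j t * B ≠ 0 := by positivity
  have hn2 : 2 ^ (j t - 1) * B ≠ 0 := by positivity
  have hpt := fun ω => dualNorm_levelErr_sq_le_batchErr (X := X) (w := w) (dw := dw) (F := F)
    (G := G) (γ := γ) (B := B) (M := M) (x0 := x0) hp (fun i => Z i ω) j t
  split_ifs at hpt ⊢ with h
  · have h12 : Integrable (fun ω => dualNorm p (batchErr (fun i => Z i ω) j t (2 ^ j t * B)) ^ 2 +
        dualNorm p (batchErr (fun i => Z i ω) j t (2 ^ (j t - 1) * B)) ^ 2) μ :=
      (hint _ hn1).add (hint _ hn2)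
    refine (integral_mono_of_nonneg (Filter.Eventually.of_forall fun ω => sq_nonneg _)
      (((hint B hB).add (h12.const_mul ((4 : ℝ) ^ j t))).const_mul 3)
      (Filter.Eventually.of_forall hpt)).trans ?_
    simp only [Pi.add_apply]
    rw [integral_const_mul, integral_add (hint B hB) (h12.const_mul _), integral_const_mul,
      integral_add (hint _ hn1) (hint _ hn2)]
    have a1 := hE B hB
    have a2 := hE _ hn1
    have a3 := hE _ hn2
    push_cast at a2 a3
    have e : Λ / (2 ^ (j t - 1) * B) ≤ 2 * (Λ / (2 ^ j t * B)) := by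
      -- At j t = 0 truncated subtraction makes both batches equal, and the factor 2 is slack;
      -- otherwise equality holds.
      rcases Nat.eq_zero_or_pos (j t) with h0 | h0
      · rw [h0]
        have : 0 ≤ Λ / (2 ^ 0 * B) := by positivity
        simpa using (by linarith : Λ / (2 ^ 0 * B) ≤ 2 * (Λ / (2 ^ 0 * B)))
      · obtain ⟨k, hk⟩ : ∃ k, j t = k + 1 := ⟨j t - 1, by omega⟩
        rw [hk, Nat.add_sub_cancel, pow_succ]
        apply le_of_eq
        field_simp
    have e4 : (4 : ℝ) ^ j t * (3 * (Λ / (2 ^ j t * B))) = 3 * (Λ / B) * 2 ^ j t := by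
      have : (4 : ℝ) ^ j t = 2 ^ j t * 2 ^ j t := by rw [← mul_pow]; norm_num
      rw [this]
      field_simp
    have a23 : ∫ ω, dualNorm p (batchErr (fun i => Z i ω) j t (2 ^ j t * B)) ^ 2 ∂μ +
        ∫ ω, dualNorm p (batchErr (fun i => Z i ω) j t (2 ^ (j t - 1) * B)) ^ 2 ∂μ ≤
        3 * (Λ / (2 ^ j t * B)) := by linarith
    have a4 := mul_le_mul_of_nonneg_left a23 (show (0 : ℝ) ≤ 4 ^ j t by positivity)
    rw [e4] at a4
    linarith [add_le_add a1 a4]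
  · have hi := (hint B hB).const_mul 3
    simp only [add_zero] at hpt
    refine (integral_mono_of_nonneg (Filter.Eventually.of_forall fun ω => sq_nonneg _) hi
      (Filter.Eventually.of_forall hpt)).trans ?_
    rw [integral_const_mul]
    linarith [hE B hB]

variable (hJ : IsGeomLevels J μ)
  (hJZ : IndepFun (fun ω t => J t ω) (fun ω t => Z t ω) μ)
include hJ hJZ

lemma integral_multilevelErr_sq_le (hB : B ≠ 0) (t : ℕ) :
    ∫ ω, dualNorm p (levelErr (fun i => Z i ω) (fun i => J i ω) t) ^ 2 ∂μ ≤
      3 * (Λ / B) * (4 + 3 * Nat.log 2 M) := by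
  have hB0 : (0 : ℝ) < B := by exact_mod_cast Nat.pos_of_ne_zero hB
  have hΛ0 : 0 ≤ Λ / B := by
    have := Real.log_natCast_nonneg d
    rw [hΛ]; positivity
  have hite : ∀ k : ℕ, 0 ≤ (if 2 ^ k ≤ M then (2 : ℝ) ^ k else 0) ∧
      (if 2 ^ k ≤ M then (2 : ℝ) ^ k else 0) ≤ M := fun k => by
    split_ifs with h
    · exact ⟨by positivity, by exact_mod_cast h⟩
    · simp
  have hψm : Measurable fun k : ℕ => 3 * (Λ / B) * (1 + 3 * if 2 ^ k ≤ M then (2 : ℝ) ^ k else 0) :=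
    measurable_of_countable _
  have key := integral_le_of_indepFun hJZ hJ.measurable_path hZ.measurable_path
    (Φ := fun (j : ℕ → ℕ) (z : ℕ → S) => dualNorm p (levelErr z j t) ^ 2)
    (ψ := fun j => 3 * (Λ / B) * (1 + 3 * if 2 ^ j t ≤ M then (2 : ℝ) ^ j t else 0))
    (C := 3 * (1 + 2 * (M : ℝ) ^ 2) * σ ^ 2 + 3 * (Λ / B) * (1 + 3 * M)) ?_ ?_ ?_ ?_
    (integral_multilevelErr_sq_le_of_levels hp hX hXc hw hx0 hG hF hσ hp2 hτ hκ hZ hmean hΛ hB · t)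
  · refine key.trans ?_
    have hi : Integrable (fun ω => if 2 ^ J t ω ≤ M then (2 : ℝ) ^ J t ω else 0) μ :=
      integrable_of_abs_le (C := M) ((measurable_of_countable fun k : ℕ =>
        if 2 ^ k ≤ M then (2 : ℝ) ^ k else 0).comp (hJ.measurable t)) fun ω => by
          rw [abs_of_nonneg (hite _).1]; exact (hite _).2
    rw [integral_const_mul, integral_add (integrable_const _) (hi.const_mul 3), integral_const_mul]
    have := hJ.integral_two_pow_le t M
    refine mul_le_mul_of_nonneg_left ?_ (by positivity)
    simp only [integral_const, probReal_univ, one_smul]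
    linarith
  · exact ((continuous_dualNorm hp).measurable.comp (measurable_multilevelErr hp hX hXc hw hx0 hG hF
      measurable_snd measurable_fst t)).pow_const 2
  · intro j z
    rw [abs_of_nonneg (sq_nonneg _)]
    have h1 := dualNorm_multilevelErr_sq_le (γ := γ) (M := M) hp hXc hw hx0 hσ hB z j t
    have h2 : 0 ≤ 3 * (Λ / B) * (1 + 3 * M) := by positivity
    linarith
  · exact hψm.comp (measurable_pi_apply t)
  · intro j
    have h1 := hite (j t)
    have h2 : 0 ≤ 3 * (1 + 2 * (M : ℝ) ^ 2) * σ ^ 2 := by positivity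
    rw [abs_of_nonneg (mul_nonneg (by positivity) (by linarith))]
    have := mul_le_mul_of_nonneg_left (show (1 + 3 * if 2 ^ j t ≤ M then (2 : ℝ) ^ j t else 0) ≤
      1 + 3 * M by linarith) (show 0 ≤ 3 * (Λ / B) by positivity)
    linarith

lemma integral_startErr_sq_le_of_indep (hB : B ≠ 0) (t : ℕ) :
    ∫ ω, dualNorm p (startErr (fun i => Z i ω) (fun i => J i ω) t) ^ 2 ∂μ ≤ Λ / B := by
  have hΛ0 : 0 ≤ Λ / B := by
    have := Real.log_natCast_nonneg d
    rw [hΛ]; positivity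
  have key := integral_le_of_indepFun hJZ hJ.measurable_path hZ.measurable_path
    (Φ := fun (j : ℕ → ℕ) (z : ℕ → S) => dualNorm p (startErr z j t) ^ 2)
    (ψ := fun _ => Λ / B) (C := σ ^ 2 + Λ / B) ?_ ?_ measurable_const ?_
    (integral_startErr_sq_le hp hX hXc hw hx0 hG hF hσ hp2 hτ hκ hZ hmean hΛ · t hB)
  · simpa using key
  · exact ((continuous_dualNorm hp).measurable.comp (measurable_initErr hp hX hXc hw hx0 hG hF
      measurable_snd measurable_fst t)).pow_const 2
  · intro j z
    rw [abs_of_nonneg (sq_nonneg _)]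
    have := pow_le_pow_left₀ (dualNorm_nonneg hp _) (dualNorm_batchMean_sub_le hp hσ hB z
      (traj z j t).2 (iter_mem (G := G) (γ := γ) (B := B) (M := M) hw hXc hx0 z j t)) 2
    rw [sq_abs] at this
    exact this.trans (le_add_of_nonneg_right hΛ0)
  · intro _
    rw [abs_of_nonneg hΛ0]
    linarith [sq_nonneg σ]

end Expectation

/-! ### The pairing with the ghost sequence and its telescoping over levels -/

section Algebra

variable {d : ℕ} {S : Type*} {X : Set (Fin d → ℝ)} {w : (Fin d → ℝ) → ℝ}
  {dw F : (Fin d → ℝ) → (Fin d → ℝ)} {G : (Fin d → ℝ) → S → (Fin d → ℝ)}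
  {γ : ℝ} {B M : ℕ} {x0 : Fin d → ℝ}

/-- The pairing of the multilevel error with a vector, split over the levels. -/
lemma multilevelErr_dotProduct (hM : M ≠ 0) (z : ℕ → S) (j : ℕ → ℕ) (t : ℕ) (y : Fin d → ℝ) :
    multilevelErr X w dw F G γ B M x0 z j t ⬝ᵥ y =
      midErr X w dw F G γ B M x0 z j t B ⬝ᵥ y +
        ∑ k ∈ Finset.range (Nat.log 2 M), (if j t = k + 1 then (2 : ℝ) ^ (k + 1) else 0) *
          (midErr X w dw F G γ B M x0 z j t (2 ^ (k + 1) * B) ⬝ᵥ y -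
            midErr X w dw F G γ B M x0 z j t (2 ^ k * B) ⬝ᵥ y) := by
  simp only [multilevelErr, multilevel, midErr, ← sub_dotProduct, sub_sub_sub_cancel_right]
  rw [add_sub_right_comm, add_dotProduct]
  congr 1
  rcases Nat.eq_zero_or_pos (j t) with h0 | h0
  · rw [Finset.sum_eq_zero fun k _ => by rw [if_neg (by omega), zero_mul]]
    simp [h0]
  · obtain ⟨i, hi⟩ : ∃ i, j t = i + 1 := ⟨j t - 1, by omega⟩
    rw [hi, Nat.add_sub_cancel]
    simp only [add_left_inj, ite_mul, zero_mul, Finset.sum_ite_eq, Finset.mem_range]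
    have : 2 ^ (i + 1) ≤ M ↔ i < Nat.log 2 M :=
      (Nat.le_log_iff_pow_le one_lt_two hM).symm
    by_cases h : i < Nat.log 2 M
    · rw [if_pos (this.2 h), if_pos h, smul_dotProduct, smul_eq_mul]
    · rw [if_neg (mt this.1 h), if_neg h, zero_dotProduct]

end Algebra

section Expectation

variable {d : ℕ} {p : ℝ} {S Ω : Type*} [MeasurableSpace S] [MeasurableSpace Ω] {κ : Kernel S S}
  [IsMarkovKernel κ] {π : Measure S} [IsProbabilityMeasure π] {τ : ℕ} {K : ℝ}
  {Z : ℕ → Ω → S} {J : ℕ → Ω → ℕ} {μ : Measure Ω} [IsProbabilityMeasure μ] {X : Set (Fin d → ℝ)}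
  {w : (Fin d → ℝ) → ℝ} {dw F : (Fin d → ℝ) → (Fin d → ℝ)} {G : (Fin d → ℝ) → S → (Fin d → ℝ)}
  {σ Λ γ : ℝ} {B M : ℕ} {x0 : Fin d → ℝ}

local notation "traj" => iter X w dw G γ B M x0
local notation "mid" => halfIter X w dw G γ B M x0
local notation "aux" => ghost X w dw F G γ B M x0
local notation "batchErr" => midErr X w dw F G γ B M x0
local notation "levelErr" => multilevelErr X w dw F G γ B M x0

variable (hp : 1 ≤ p) (hX : Convex ℝ X) (hXc : IsCompact X) (hw : IsMirrorMap p X w dw)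
  (hx0 : x0 ∈ X) (hG : Measurable fun q : X × S => G q.1 q.2) (hF : ContinuousOn F X)
  (hσ : ∀ x ∈ X, ∀ z, dualNorm p (G x z - F x) ^ 2 ≤ σ ^ 2)
include hp hX hXc hw hx0

lemma measurable_batchErr_dotProduct (hG : Measurable fun q : X × S => G q.1 q.2)
    (hF : ContinuousOn F X) {A : Type*} [MeasurableSpace A] {ζ : A → ℕ → S} (hζ : Measurable ζ)
    {j : A → ℕ → ℕ} (hj : Measurable j) (t n : ℕ) :
    Measurable fun a => batchErr (ζ a) (j a) t n ⬝ᵥ (mid (ζ a) (j a) t - aux (ζ a) (j a) t) :=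
  measurable_dotProduct (measurable_batchErr hp hX hXc hw hx0 hG hF hζ hj t n)
    ((measurable_halfIter hw hXc hx0 hX hp hG hζ hj t).sub
      (measurable_ghost hw hXc hx0 hX hp hG hζ hj hF t))

omit [MeasurableSpace S] hp in
lemma pNorm_halfIter_sub_ghost_sq_le (z : ℕ → S) (j : ℕ → ℕ) (t : ℕ) :
    pNorm p (mid z j t - aux z j t) ^ 2 ≤ 2 * diamSq X w dw :=
  hw.pNorm_sub_sq_le hXc hX (halfIter_mem hw hXc hx0 z j t) (ghost_mem hw hXc hx0 z j t)

include hσ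

omit [MeasurableSpace S] in
lemma abs_batchErr_dotProduct_le {n : ℕ} (hn : n ≠ 0) (z : ℕ → S) (j : ℕ → ℕ) (t : ℕ) :
    |batchErr z j t n ⬝ᵥ (mid z j t - aux z j t)| ≤ |σ| * (1 + 2 * diamSq X w dw) := by
  refine (abs_dotProduct_le hp _ _).trans (mul_le_mul
    (dualNorm_batchErr_le hp hXc hw hx0 hσ hn z j t) ?_ (pNorm_nonneg _) (abs_nonneg σ))
  nlinarith [pNorm_halfIter_sub_ghost_sq_le (F := F) (G := G) (γ := γ) (B := B) (M := M)
    hX hXc hw hx0 z j t, sq_nonneg (pNorm p (mid z j t - aux z j t) - 1)]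

include hG hF

lemma integrable_batchErr_dotProduct (hZ : Measurable fun ω t => Z t ω) (hJ : IsGeomLevels J μ)
    {n : ℕ} (hn : n ≠ 0) (t : ℕ) :
    Integrable (fun ω => batchErr (fun i => Z i ω) (fun i => J i ω) t n ⬝ᵥ
      (mid (fun i => Z i ω) (fun i => J i ω) t - aux (fun i => Z i ω) (fun i => J i ω) t)) μ :=
  integrable_of_abs_le (measurable_batchErr_dotProduct hp hX hXc hw hx0 hG hF hZ
    hJ.measurable_path t n) fun _ => abs_batchErr_dotProduct_le hp hX hXc hw hx0 hσ hn _ _ t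

lemma integrable_batchErr_sq (hZ : Measurable fun ω t => Z t ω) (hJ : IsGeomLevels J μ)
    {n : ℕ} (hn : n ≠ 0) (t : ℕ) :
    Integrable (fun ω => dualNorm p (batchErr (fun i => Z i ω) (fun i => J i ω) t n) ^ 2) μ := by
  refine integrable_of_abs_le (C := |σ| ^ 2) (((continuous_dualNorm hp).measurable.comp
    (measurable_batchErr hp hX hXc hw hx0 hG hF hZ
      hJ.measurable_path t n)).pow_const 2) fun ω => ?_
  rw [abs_of_nonneg (sq_nonneg _)]
  exact pow_le_pow_left₀ (dualNorm_nonneg hp _) (dualNorm_batchErr_le hp hXc hw hx0 hσ hn _ _ t) 2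

/-- Averaging over the level `J t`, the multilevel error pairs with past vectors like the error of
its largest batch. -/
lemma integral_levelErr_dotProduct (hZ : Measurable fun ω t => Z t ω) (hJ : IsGeomLevels J μ)
    (hJZ : IndepFun (fun ω t => J t ω) (fun ω t => Z t ω) μ) (hB : B ≠ 0) (hM : M ≠ 0) (t : ℕ) :
    Integrable (fun ω => levelErr (fun i => Z i ω) (fun i => J i ω) t ⬝ᵥ
      (mid (fun i => Z i ω) (fun i => J i ω) t - aux (fun i => Z i ω) (fun i => J i ω) t)) μ ∧
    ∫ ω, levelErr (fun i => Z i ω) (fun i => J i ω) t ⬝ᵥ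
      (mid (fun i => Z i ω) (fun i => J i ω) t - aux (fun i => Z i ω) (fun i => J i ω) t) ∂μ =
    ∫ ω, batchErr (fun i => Z i ω) (fun i => J i ω) t (2 ^ Nat.log 2 M * B) ⬝ᵥ
      (mid (fun i => Z i ω) (fun i => J i ω) t -
        aux (fun i => Z i ω) (fun i => J i ω) t) ∂μ := by
  let c : ℕ → (ℕ → ℕ) × (ℕ → S) → ℝ := fun k q =>
    batchErr q.2 q.1 t (2 ^ k * B) ⬝ᵥ (mid q.2 q.1 t - aux q.2 q.1 t)
  let U : Ω → (ℕ → ℕ) × (ℕ → S) := fun ω => (fun i => J i ω, fun i => Z i ω)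
  let V : Ω → (ℕ → ℕ) × (ℕ → S) := fun ω => (trunc t fun i => J i ω, fun i => Z i ω)
  have hn : ∀ k, 2 ^ k * B ≠ 0 := fun k => by positivity
  have hcm : ∀ k, Measurable (c k) := fun k => measurable_batchErr_dotProduct hp hX hXc hw hx0 hG hF
    measurable_snd measurable_fst t _
  -- Replacing the levels by their truncation before t leaves every pairing unchanged and makes it a
  -- function of `V`, which is independent of J_t.
  have hUV : ∀ k ω, c k (U ω) = c k (V ω) := fun k ω => by
    have hj : ∀ i < t, J i ω = trunc t (fun i => J i ω) i := fun i hi =>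
      (trunc_apply hi fun i => J i ω).symm
    simp only [c, U, V, midErr]
    rw [halfIter_congr (z' := fun i => Z i ω) hj fun _ _ => rfl,
      iter_snd_congr (z' := fun i => Z i ω) hj, ghost_congr hj]
  have hci : ∀ k, Integrable (fun ω => c k (U ω)) μ := fun k =>
    integrable_batchErr_dotProduct hp hX hXc hw hx0 hG hF hσ hZ hJ (hn k) t
  have hcb : ∀ k q, |c k q| ≤ |σ| * (1 + 2 * diamSq X w dw) := fun k q =>
    abs_batchErr_dotProduct_le hp hX hXc hw hx0 hσ (hn k) _ _ t
  have hVm : Measurable V := ((measurable_trunc t).comp hJ.measurable_path).prodMk hZ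
  have hind : IndepFun (J t) V μ := hJ.indepFun_trunc hZ hJZ t
  let f : ℕ → ℕ → ℝ := fun k i => if i = k + 1 then (2 : ℝ) ^ (k + 1) else 0
  -- The weight 2^{k+1} on the event J_t = k + 1 has mean 1, so by independence it disappears and
  -- the differences telescope in k.
  have hterm : ∀ k, ∫ ω, f k (J t ω) * (c (k + 1) (U ω) - c k (U ω)) ∂μ =
      ∫ ω, c (k + 1) (U ω) ∂μ - ∫ ω, c k (U ω) ∂μ := fun k => by
    rw [← integral_sub (hci _) (hci _)]
    simp only [hUV]
    refine (hind.integral_fun_comp_mul_comp (f := f k) (g := fun q => c (k + 1) q - c k q)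
      (hJ.measurable t).aemeasurable hVm.aemeasurable
      (measurable_of_countable _).aestronglyMeasurable
      ((hcm _).sub (hcm _)).aestronglyMeasurable).trans ?_
    simp only [f]
    rw [hJ.integral_ite t (Nat.le_add_left 1 k), one_mul]
  have hint : ∀ k, Integrable (fun ω => f k (J t ω) * (c (k + 1) (U ω) - c k (U ω))) μ :=
    fun k => by
      refine ((hci (k + 1)).sub (hci k)).bdd_mul (c := (2 : ℝ) ^ (k + 1))
        ((measurable_of_countable (f k)).comp (hJ.measurable t)).aestronglyMeasurable
        (Filter.Eventually.of_forall fun ω => ?_)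
      simp only [f]
      split_ifs <;> simp
  have hpt : ∀ ω, levelErr (fun i => Z i ω) (fun i => J i ω) t ⬝ᵥ
      (mid (fun i => Z i ω) (fun i => J i ω) t - aux (fun i => Z i ω) (fun i => J i ω) t) =
      c 0 (U ω) + ∑ k ∈ Finset.range (Nat.log 2 M),
        f k (J t ω) * (c (k + 1) (U ω) - c k (U ω)) := fun ω => by
    rw [multilevelErr_dotProduct hM]
    simp only [c, U, f, pow_zero, one_mul]
  simp only [hpt]
  have hs := integrable_finsetSum (Finset.range (Nat.log 2 M)) fun k _ => hint k
  refine ⟨(hci 0).add hs, ?_⟩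
  rw [integral_add (hci 0) hs, integral_finsetSum _ fun k _ => hint k,
    Finset.sum_congr rfl fun k _ => hterm k,
    Finset.sum_range_sub fun k => ∫ ω, c k (U ω) ∂μ, add_sub_cancel]

variable (hp2 : p ≤ 2) (hτ : 1 ≤ τ) (hκ : IsUniformlyErgodic κ π τ K) (hZ : IsMarkovChain κ Z μ)
  (hmean : ∀ x ∈ X, ∫ z, G x z ∂π = F x)
  (hΛ : Λ = 68 * Real.exp 1 ^ 2 * (1 + 2 * K) ^ 2 * ((1 + Real.log d) * τ * σ ^ 2))
  (hJ : IsGeomLevels J μ) (hJZ : IndepFun (fun ω t => J t ω) (fun ω t => Z t ω) μ)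
include hp2 hτ hκ hZ hmean hΛ hJ hJZ

lemma integral_batchErr_sq_le_of_indep {n : ℕ} (hn : n ≠ 0) (t : ℕ) :
    ∫ ω, dualNorm p (batchErr (fun i => Z i ω) (fun i => J i ω) t n) ^ 2 ∂μ ≤ Λ / n := by
  have hΛ0 : 0 ≤ Λ / n := by
    have := Real.log_natCast_nonneg d
    rw [hΛ]; positivity
  have key := integral_le_of_indepFun hJZ hJ.measurable_path hZ.measurable_path
    (Φ := fun (j : ℕ → ℕ) (z : ℕ → S) => dualNorm p (batchErr z j t n) ^ 2)
    (ψ := fun _ => Λ / n) (C := |σ| ^ 2 + Λ / n) ?_ ?_ measurable_const ?_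
    (integral_batchErr_sq_le hp hX hXc hw hx0 hG hF hσ hp2 hτ hκ hZ hmean hΛ · t hn)
  · simpa using key
  · exact ((continuous_dualNorm hp).measurable.comp (measurable_batchErr hp hX hXc hw hx0 hG hF
      measurable_snd measurable_fst t n)).pow_const 2
  · intro j z
    rw [abs_of_nonneg (sq_nonneg _)]
    exact (pow_le_pow_left₀ (dualNorm_nonneg hp _)
      (dualNorm_batchErr_le hp hXc hw hx0 hσ hn z j t) 2).trans (le_add_of_nonneg_right hΛ0)
  · intro _
    rw [abs_of_nonneg hΛ0]
    exact le_add_of_nonneg_left (sq_nonneg _)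

/-- The bias term: pairing the multilevel error with a past vector costs only the error of the
largest batch. -/
lemma neg_integral_levelErr_dotProduct_le (hB : B ≠ 0) (hM : M ≠ 0) (t : ℕ) {s : ℝ} (hs : 0 < s) :
    -∫ ω, levelErr (fun i => Z i ω) (fun i => J i ω) t ⬝ᵥ
      (mid (fun i => Z i ω) (fun i => J i ω) t - aux (fun i => Z i ω) (fun i => J i ω) t) ∂μ ≤
      diamSq X w dw / s + s * (Λ / (M * B)) := by
  have hB0 : (0 : ℝ) < B := by exact_mod_cast Nat.pos_of_ne_zero hB
  have hM0 : (0 : ℝ) < M := by exact_mod_cast Nat.pos_of_ne_zero hM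
  have hΛ0 : 0 ≤ Λ := by
    have := Real.log_natCast_nonneg d
    rw [hΛ]; positivity
  have hn : 2 ^ Nat.log 2 M * B ≠ 0 := by positivity
  rw [(integral_levelErr_dotProduct hp hX hXc hw hx0 hG hF hσ hZ.measurable_path hJ hJZ hB hM t).2,
    ← integral_neg]
  have hpt : ∀ ω, -(batchErr (fun i => Z i ω) (fun i => J i ω) t (2 ^ Nat.log 2 M * B) ⬝ᵥ
      (mid (fun i => Z i ω) (fun i => J i ω) t - aux (fun i => Z i ω) (fun i => J i ω) t)) ≤
      diamSq X w dw / s + s / 2 * dualNorm p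
        (batchErr (fun i => Z i ω) (fun i => J i ω) t (2 ^ Nat.log 2 M * B)) ^ 2 := fun ω => by
    have h1 := (neg_le_abs _).trans (abs_dotProduct_le hp
      (batchErr (fun i => Z i ω) (fun i => J i ω) t (2 ^ Nat.log 2 M * B))
      (mid (fun i => Z i ω) (fun i => J i ω) t - aux (fun i => Z i ω) (fun i => J i ω) t))
    have h2 := pNorm_halfIter_sub_ghost_sq_le (F := F) (G := G) (γ := γ) (B := B) (M := M)
      hX hXc hw hx0 (fun i => Z i ω) (fun i => J i ω) t
    set a := dualNorm p (batchErr (fun i => Z i ω) (fun i => J i ω) t (2 ^ Nat.log 2 M * B))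
    set b := pNorm p
      (mid (fun i => Z i ω) (fun i => J i ω) t - aux (fun i => Z i ω) (fun i => J i ω) t)
    refine h1.trans ?_
    have h3 : b ^ 2 / (2 * s) ≤ diamSq X w dw / s := by
      rw [div_le_div_iff₀ (by positivity) hs]
      nlinarith
    have h4 : a * b ≤ b ^ 2 / (2 * s) + s / 2 * a ^ 2 := by
      have : b ^ 2 / (2 * s) + s / 2 * a ^ 2 - a * b = (b - s * a) ^ 2 / (2 * s) := by
        field_simp
        ring
      have h5 : 0 ≤ (b - s * a) ^ 2 / (2 * s) := by positivity
      linarith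
    linarith
  have hi := integrable_batchErr_sq (γ := γ) (B := B) (M := M) hp hX hXc hw hx0 hG hF hσ
    hZ.measurable_path hJ hn t
  have hE := integral_batchErr_sq_le_of_indep (γ := γ) (B := B) (M := M) hp hX hXc hw hx0 hG hF hσ
    hp2 hτ hκ hZ hmean hΛ hJ hJZ hn t
  refine (integral_mono (integrable_batchErr_dotProduct hp hX hXc hw hx0 hG hF hσ
    hZ.measurable_path hJ hn t).neg ((integrable_const _).add (hi.const_mul _)) hpt).trans ?_
  simp only [Pi.add_apply]
  rw [integral_add (integrable_const _) (hi.const_mul _), integral_const_mul]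
  simp only [integral_const, probReal_univ, one_smul]
  -- The largest batch has more than MB/2 samples; this factor 2 cancels the s/2 from Young's
  -- inequality.
  have hlog : (M : ℝ) ≤ 2 * 2 ^ Nat.log 2 M := by
    have := (Nat.lt_pow_succ_log_self one_lt_two M).le
    rw [pow_succ, mul_comm] at this
    exact_mod_cast this
  have h6 : Λ / ((2 ^ Nat.log 2 M * B : ℕ) : ℝ) ≤ 2 * (Λ / (M * B)) := by
    push_cast
    rw [← mul_div_assoc, div_le_div_iff₀ (by positivity) (by positivity)]
    have := mul_le_mul_of_nonneg_left hlog (mul_nonneg hΛ0 hB0.le)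
    nlinarith
  have := mul_le_mul_of_nonneg_left (hE.trans h6) (half_pos hs).le
  linarith

end Expectation

/-! ### Pathwise regret bound -/

section Regret

variable {d : ℕ} {p : ℝ} {S : Type*} {X : Set (Fin d → ℝ)}
  {w : (Fin d → ℝ) → ℝ} {dw F : (Fin d → ℝ) → (Fin d → ℝ)} {G : (Fin d → ℝ) → S → (Fin d → ℝ)}
  {γ L : ℝ} {B M : ℕ} {x0 : Fin d → ℝ}

local notation "mid" => halfIter X w dw G γ B M x0
local notation "aux" => ghost X w dw F G γ B M x0
local notation "levelErr" => multilevelErr X w dw F G γ B M x0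
local notation "startErr" => initErr X w dw F G γ B M x0

lemma avgIter_mem (hX : Convex ℝ X) (hXc : IsCompact X) (hw : IsMirrorMap p X w dw)
    (hx0 : x0 ∈ X) {T : ℕ} (hT : T ≠ 0) (z : ℕ → S) (j : ℕ → ℕ) :
    avgIter X w dw G γ B M x0 z j T ∈ X := by
  rw [avgIter, Finset.smul_sum]
  refine hX.sum_mem (fun _ _ => by positivity) ?_ fun t _ => halfIter_mem hw hXc hx0 z j t
  have : (T : ℝ) ≠ 0 := by exact_mod_cast hT
  simp [this]

/-- The pathwise bound on the merit function of the averaged iterate. -/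
lemma mul_errVI_avgIter_le (hp : 1 ≤ p) (hX : Convex ℝ X) (hXc : IsCompact X)
    (hw : IsMirrorMap p X w dw) (hx0 : x0 ∈ X) (hL : 0 < L)
    (hF : ∀ x ∈ X, ∀ y ∈ X, dualNorm p (F x - F y) ≤ L * pNorm p (x - y))
    (hmono : ∀ x ∈ X, ∀ y ∈ X, 0 ≤ (F x - F y) ⬝ᵥ (x - y)) (hγ : 0 < γ) (hγL : γ ≤ 1 / (2 * L))
    {T : ℕ} (hT : T ≠ 0) (z : ℕ → S) (j : ℕ → ℕ) :
    γ * T * errVI X F (avgIter X w dw G γ B M x0 z j T) ≤ 2 * diamSq X w dw +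
      ∑ t ∈ Finset.range T,
        (3 * γ ^ 2 * (dualNorm p (levelErr z j t) ^ 2 + dualNorm p (startErr z j t) ^ 2) +
          γ * -(levelErr z j t ⬝ᵥ (mid z j t - aux z j t))) := by
  have hT0 : (0 : ℝ) < T := by exact_mod_cast Nat.pos_of_ne_zero hT
  rw [← le_div_iff₀' (by positivity)]
  -- The bound is free of u and holds on each path, so it covers a maximiser depending on the noise.
  -- Each of the two telescoping Bregman sums contributes at most one D².
  refine csSup_le ⟨_, x0, hx0, rfl⟩ ?_
  rintro r ⟨u, hu, rfl⟩
  rw [le_div_iff₀' (by positivity)]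
  let x : ℕ → Fin d → ℝ := fun t => (iter X w dw G γ B M x0 z j t).1
  have hstep : ∀ t, γ * (F u ⬝ᵥ (mid z j t - u)) ≤
      (bregman w dw (x t) u - bregman w dw (x (t + 1)) u) +
      (bregman w dw (aux z j t) u - bregman w dw (aux z j (t + 1)) u) +
      (3 * γ ^ 2 * (dualNorm p (levelErr z j t) ^ 2 + dualNorm p (startErr z j t) ^ 2) +
        γ * -(levelErr z j t ⬝ᵥ (mid z j t - aux z j t))) := fun t => by
    have h := hw.mirrorProx_step hXc hX hp hL hF hmono hγ hγL
      (iter_mem (G := G) (γ := γ) (B := B) (M := M) hw hXc hx0 z j t)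
      (ghost_mem (F := F) (G := G) (γ := γ) (B := B) (M := M) hw hXc hx0 z j t) hu
      (h := mid z j t)
      (g₁ := batchMean G z (iter X w dw G γ B M x0 z j t).2 B (iter X w dw G γ B M x0 z j t).1)
      (g := multilevel G z B M ((iter X w dw G γ B M x0 z j t).2 + B) (j t) (mid z j t)) rfl
    rw [← neg_dotProduct, multilevelErr, neg_sub]
    refine h.trans_eq ?_
    rw [add_assoc]
    rfl
  have hbreg : ∀ y ∈ X, 0 ≤ bregman w dw y u := fun y hy =>
    (by positivity : 0 ≤ pNorm p (y - u) ^ 2 / 2).trans (hw.half_sq_le_bregman hX hy hu)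
  have hsum : γ * T * (F u ⬝ᵥ (avgIter X w dw G γ B M x0 z j T - u)) =
      ∑ t ∈ Finset.range T, γ * (F u ⬝ᵥ (mid z j t - u)) := by
    simp only [dotProduct_sub, mul_sub, Finset.sum_sub_distrib, avgIter, dotProduct_smul,
      dotProduct_sum, smul_eq_mul, Finset.mul_sum]
    congr 1
    · refine Finset.sum_congr rfl fun t _ => ?_
      field_simp
    · simp only [Finset.sum_const, Finset.card_range, nsmul_eq_mul]
      ring
  rw [hsum]
  refine (Finset.sum_le_sum fun t _ => hstep t).trans ?_
  rw [Finset.sum_add_distrib, Finset.sum_add_distrib,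
    Finset.sum_range_sub' (fun t => bregman w dw (x t) u),
    Finset.sum_range_sub' (fun t => bregman w dw (aux z j t) u)]
  have b1 := hbreg (x T) (iter_mem hw hXc hx0 z j T)
  have b2 := hbreg (aux z j T) (ghost_mem hw hXc hx0 z j T)
  have b3 : bregman w dw (x 0) u ≤ diamSq X w dw := hw.bregman_le_diamSq hXc hx0 hu
  have b4 : bregman w dw (aux z j 0) u ≤ diamSq X w dw := hw.bregman_le_diamSq hXc hx0 hu
  linarith

end Regret

/-- For M = 1 the logarithms vanish and T ≥ 1 absorbs the constant 39; for M ≥ 2 it is absorbed by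
log M ≥ log 2 > 2/3, which also converts the base-2 logarithm. -/
lemma level_sum_le {M : ℕ} {T : ℝ} (hM : 1 ≤ M) (hT : 1 ≤ T) :
    39 + 27 * (Nat.log 2 M : ℝ) + T / M ≤ 110 * (T / M + Real.log M) := by
  have hM0 : (0 : ℝ) < M := by exact_mod_cast hM
  rcases hM.eq_or_lt with rfl | h
  · norm_num
    linarith
  · have h0 : 0 ≤ T / M := by positivity
    have h2 : Real.log 2 ≤ Real.log M := Real.log_le_log two_pos (by exact_mod_cast h)
    have h1 : (Nat.log 2 M : ℝ) * Real.log 2 ≤ Real.log M := by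
      rw [← Real.log_pow]
      exact Real.log_le_log (by positivity) (by exact_mod_cast Nat.pow_log_le_self 2 (by omega))
    have h3 := Real.log_two_gt_d9
    have h4 : (Nat.log 2 M : ℝ) * (2 / 3) ≤ Nat.log 2 M * Real.log 2 :=
      mul_le_mul_of_nonneg_left (by linarith) (Nat.cast_nonneg _)
    linarith

/-! ### Expectation of the merit function -/

section Bound

variable {d : ℕ} {p : ℝ} {S Ω : Type*} [MeasurableSpace S] [MeasurableSpace Ω] {κ : Kernel S S}
  [IsMarkovKernel κ] {π : Measure S} [IsProbabilityMeasure π] {τ : ℕ} {K : ℝ}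
  {Z : ℕ → Ω → S} {J : ℕ → Ω → ℕ} {μ : Measure Ω} [IsProbabilityMeasure μ] {X : Set (Fin d → ℝ)}
  {w : (Fin d → ℝ) → ℝ} {dw F : (Fin d → ℝ) → (Fin d → ℝ)} {G : (Fin d → ℝ) → S → (Fin d → ℝ)}
  {σ Λ γ L : ℝ} {B M : ℕ} {x0 : Fin d → ℝ}

lemma integrable_errVI_avgIter (hp : 1 ≤ p) (hX : Convex ℝ X) (hXc : IsCompact X)
    (hw : IsMirrorMap p X w dw) (hx0 : x0 ∈ X) (hG : Measurable fun q : X × S => G q.1 q.2)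
    (hL : 0 < L) (hF : ∀ x ∈ X, ∀ y ∈ X, dualNorm p (F x - F y) ≤ L * pNorm p (x - y))
    (hZ : Measurable fun ω t => Z t ω) (hJ : Measurable fun ω t => J t ω) {T : ℕ} (hT : T ≠ 0) :
    Integrable (fun ω => errVI X F (avgIter X w dw G γ B M x0
      (fun t => Z t ω) (fun t => J t ω) T)) μ := by
  obtain ⟨R, -, hR⟩ := exists_dualNorm_le_of_lipschitz hp hXc hL hF hx0
  have hc := continuous_errVI hp hR hXc ⟨x0, hx0⟩
  obtain ⟨C, hC⟩ := hXc.exists_bound_of_continuousOn hc.continuousOn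
  have hm : Measurable fun ω => avgIter X w dw G γ B M x0
      (fun t => Z t ω) (fun t => J t ω) T := by
    have : Measurable fun ω => ∑ t ∈ Finset.range T,
        halfIter X w dw G γ B M x0 (fun t => Z t ω) (fun t => J t ω) t :=
      Finset.measurable_sum _ fun t _ => measurable_halfIter hw hXc hx0 hX hp hG hZ hJ t
    exact this.const_smul (T : ℝ)⁻¹
  exact integrable_of_abs_le (hc.measurable.comp hm) fun ω =>
    hC _ (avgIter_mem hX hXc hw hx0 hT _ _)

local notation "mid" => halfIter X w dw G γ B M x0
local notation "aux" => ghost X w dw F G γ B M x0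
local notation "levelErr" => multilevelErr X w dw F G γ B M x0
local notation "startErr" => initErr X w dw F G γ B M x0

/-- The expected merit function of the averaged iterate, in terms of the variance bound `Λ` for
single samples. -/
lemma integral_errVI_avgIter_le (hp : 1 ≤ p) (hX : Convex ℝ X) (hXc : IsCompact X)
    (hw : IsMirrorMap p X w dw) (hx0 : x0 ∈ X) (hG : Measurable fun q : X × S => G q.1 q.2)
    (hσ : ∀ x ∈ X, ∀ z, dualNorm p (G x z - F x) ^ 2 ≤ σ ^ 2)
    (hp2 : p ≤ 2) (hτ : 1 ≤ τ) (hκ : IsUniformlyErgodic κ π τ K) (hZ : IsMarkovChain κ Z μ)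
    (hmean : ∀ x ∈ X, ∫ z, G x z ∂π = F x)
    (hΛ : Λ = 68 * Real.exp 1 ^ 2 * (1 + 2 * K) ^ 2 * ((1 + Real.log d) * τ * σ ^ 2))
    (hJ : IsGeomLevels J μ) (hJZ : IndepFun (fun ω t => J t ω) (fun ω t => Z t ω) μ)
    (hL : 0 < L) (hF : ∀ x ∈ X, ∀ y ∈ X, dualNorm p (F x - F y) ≤ L * pNorm p (x - y))
    (hmono : ∀ x ∈ X, ∀ y ∈ X, 0 ≤ (F x - F y) ⬝ᵥ (x - y)) (hγ : 0 < γ) (hγL : γ ≤ 1 / (2 * L))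
    (hB : B ≠ 0) (hM : M ≠ 0) {T : ℕ} (hT : T ≠ 0) :
    ∫ ω, errVI X F (avgIter X w dw G γ B M x0 (fun t => Z t ω) (fun t => J t ω) T) ∂μ ≤
      3 * (diamSq X w dw / (γ * T)) + γ * (Λ / B) * (39 + 27 * Nat.log 2 M + T / M) := by
  have hT0 : (0 : ℝ) < T := by exact_mod_cast Nat.pos_of_ne_zero hT
  have hB0 : (0 : ℝ) < B := by exact_mod_cast Nat.pos_of_ne_zero hB
  have hM0 : (0 : ℝ) < M := by exact_mod_cast Nat.pos_of_ne_zero hM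
  have hFc := continuousOn_of_lipschitz hp hF
  have hZm := hZ.measurable_path
  have hi := integrable_errVI_avgIter (γ := γ) (B := B) (M := M) (μ := μ) hp hX hXc hw hx0 hG hL hF
    hZm hJ.measurable_path hT
  have i1 : ∀ t, Integrable (fun ω =>
      dualNorm p (levelErr (fun i => Z i ω) (fun i => J i ω) t) ^ 2) μ := fun t => by
    refine integrable_of_abs_le (C := 3 * (1 + 2 * (M : ℝ) ^ 2) * σ ^ 2)
      (((continuous_dualNorm hp).measurable.comp (measurable_multilevelErr hp hX hXc hw hx0 hG hFc
        hZm hJ.measurable_path t)).pow_const 2) fun ω => ?_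
    rw [abs_of_nonneg (sq_nonneg _)]
    exact dualNorm_multilevelErr_sq_le hp hXc hw hx0 hσ hB _ _ t
  have i2 : ∀ t, Integrable (fun ω =>
      dualNorm p (startErr (fun i => Z i ω) (fun i => J i ω) t) ^ 2) μ := fun t => by
    refine integrable_of_abs_le (C := |σ| ^ 2) (((continuous_dualNorm hp).measurable.comp
      (measurable_initErr hp hX hXc hw hx0 hG hFc hZm hJ.measurable_path t)).pow_const 2)
      fun ω => ?_
    rw [abs_of_nonneg (sq_nonneg _)]
    exact pow_le_pow_left₀ (dualNorm_nonneg hp _) (dualNorm_batchMean_sub_le hp hσ hB _ _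
      (iter_mem hw hXc hx0 _ _ t)) 2
  have i3 : ∀ t, Integrable (fun ω => levelErr (fun i => Z i ω) (fun i => J i ω) t ⬝ᵥ
      (mid (fun i => Z i ω) (fun i => J i ω) t -
        aux (fun i => Z i ω) (fun i => J i ω) t)) μ := fun t =>
    (integral_levelErr_dotProduct hp hX hXc hw hx0 hG hFc hσ hZm hJ hJZ hB hM t).1
  have i12 := fun t => ((i1 t).add (i2 t)).const_mul (3 * γ ^ 2)
  have i3' := fun t => (i3 t).neg.const_mul γ
  have hterm : ∀ t, ∫ ω, (3 * γ ^ 2 * (dualNorm p (levelErr (fun i => Z i ω) (fun i => J i ω) t) ^ 2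
        + dualNorm p (startErr (fun i => Z i ω) (fun i => J i ω) t) ^ 2) +
      γ * -(levelErr (fun i => Z i ω) (fun i => J i ω) t ⬝ᵥ
        (mid (fun i => Z i ω) (fun i => J i ω) t -
          aux (fun i => Z i ω) (fun i => J i ω) t))) ∂μ ≤
      3 * γ ^ 2 * (3 * (Λ / B) * (4 + 3 * Nat.log 2 M) + Λ / B) +
        γ * (diamSq X w dw / (γ * T) + γ * T * (Λ / (M * B))) := fun t => by
    have e1 := integral_multilevelErr_sq_le (γ := γ) (M := M) hp hX hXc hw hx0 hG hFc hσ hp2 hτ hκ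
      hZ hmean hΛ hJ hJZ hB t
    have e2 := integral_startErr_sq_le_of_indep (γ := γ) (M := M) hp hX hXc hw hx0 hG hFc hσ hp2 hτ
      hκ hZ hmean hΛ hJ hJZ hB t
    -- With s = γT the deterministic parts, multiplied by γ and summed over T steps, add up to a
    -- single further D².
    have e3 := neg_integral_levelErr_dotProduct_le (γ := γ) hp hX hXc hw hx0 hG hFc hσ hp2 hτ hκ hZ
      hmean hΛ hJ hJZ hB hM t (s := γ * T) (by positivity)
    refine (integral_add (i12 t) (i3' t)).trans_le ?_
    simp only [Pi.add_apply, Pi.neg_apply]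
    rw [integral_const_mul, integral_const_mul, integral_add (i1 t) (i2 t), integral_neg]
    exact add_le_add (mul_le_mul_of_nonneg_left (add_le_add e1 e2) (by positivity))
      (mul_le_mul_of_nonneg_left e3 hγ.le)
  have hint := fun t => (i12 t).add (i3' t)
  have hsum := integrable_finsetSum (Finset.range T) fun t _ => hint t
  have main := integral_mono (hi.const_mul (γ * T))
    ((integrable_const (2 * diamSq X w dw)).add hsum)
    fun ω => mul_errVI_avgIter_le (G := G) (B := B) (M := M) hp hX hXc hw hx0 hL hF hmono hγ hγL hT
      (fun i => Z i ω) (fun i => J i ω)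
  rw [integral_const_mul] at main
  replace main := main.trans_eq (integral_add (integrable_const _) hsum)
  rw [integral_finsetSum _ fun t _ => hint t] at main
  replace main := main.trans (add_le_add_right (Finset.sum_le_sum fun t _ => hterm t) _)
  simp only [integral_const, probReal_univ, one_smul, Finset.sum_const, Finset.card_range,
    nsmul_eq_mul] at main
  rw [← le_div_iff₀' (by positivity)] at main
  refine main.trans_eq ?_
  field_simp
  ring

end Bound

end MMP

theorem theorem4 (K : ℝ) :
    ∃ C : ℝ, 0 < C ∧
      ∀ (d : ℕ) (p : ℝ), 1 ≤ p → p ≤ 2 →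
      -- the state space of the noise, its transition kernel and its stationary law
      ∀ (S : Type*) [TopologicalSpace S] [PolishSpace S] [MeasurableSpace S] [BorelSpace S]
        (κ : Kernel S S) [IsMarkovKernel κ] (π : Measure S) [IsProbabilityMeasure π]
        (τ : ℕ), 1 ≤ τ → MMP.IsUniformlyErgodic κ π τ K →
      -- the Markov chain and the levels of the multilevel estimator
      ∀ (Ω : Type*) [MeasurableSpace Ω] (μ : Measure Ω) [IsProbabilityMeasure μ]
        (Z : ℕ → Ω → S) (J : ℕ → Ω → ℕ), MMP.IsMarkovChain κ Z μ → MMP.IsGeomLevels J μ →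
        IndepFun (fun ω t => J t ω) (fun ω t => Z t ω) μ →
      -- the feasible set and the mirror map
      ∀ (X : Set (Fin d → ℝ)) (w : (Fin d → ℝ) → ℝ) (dw : (Fin d → ℝ) → (Fin d → ℝ)),
        IsCompact X → Convex ℝ X → MMP.IsMirrorMap p X w dw →
      -- the operator `F` and its noisy oracle `G`
      ∀ (F : (Fin d → ℝ) → (Fin d → ℝ)) (G : (Fin d → ℝ) → S → (Fin d → ℝ)) (L σ : ℝ),
        Measurable (fun q : X × S => G q.1 q.2) →
        0 < L →
        (∀ x ∈ X, ∀ y ∈ X, MMP.dualNorm p (F x - F y) ≤ L * MMP.pNorm p (x - y)) →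
        (∀ x ∈ X, ∀ y ∈ X, 0 ≤ (F x - F y) ⬝ᵥ (x - y)) →
        (∀ x ∈ X, ∫ z, G x z ∂π = F x) →
        (∀ x ∈ X, ∀ z, MMP.dualNorm p (G x z - F x) ^ 2 ≤ σ ^ 2) →
      -- the parameters of the algorithm
      ∀ (γ : ℝ) (B M T : ℕ) (x0 : Fin d → ℝ),
        0 < γ → γ ≤ 1 / (2 * L) → 1 ≤ B → 1 ≤ M → 1 ≤ T → x0 ∈ X →
        Integrable (fun ω => MMP.errVI X F (MMP.avgIter X w dw G γ B M x0
          (fun t => Z t ω) (fun t => J t ω) T)) μ ∧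
        ∫ ω, MMP.errVI X F (MMP.avgIter X w dw G γ B M x0
          (fun t => Z t ω) (fun t => J t ω) T) ∂μ ≤
          C * (MMP.diamSq X w dw / (γ * T) +
            (1 + Real.log d) *
              (γ * τ * (B : ℝ)⁻¹ * ((T : ℝ) / M + Real.log M) * σ ^ 2)) := by
  -- The 3 counts the copies of D²: main sequence, ghost sequence and Young's inequality. The factor
  -- 68 e² (1 + 2K)² comes from Λ, and 110 from `level_sum_le`.
  refine ⟨3 + 110 * (68 * Real.exp 1 ^ 2 * (1 + 2 * K) ^ 2), by positivity, ?_⟩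
  intro d p hp hp2 S _ _ _ _ κ _ π _ τ hτ hκ Ω _ μ _ Z J hZ hJ hJZ X w dw hXc hX hw F G L σ hG hL hF
    hmono hmean hσ γ B M T x0 hγ hγL hB hM hT hx0
  have hT0 : (1 : ℝ) ≤ T := by exact_mod_cast hT
  refine ⟨MMP.integrable_errVI_avgIter hp hX hXc hw hx0 hG hL hF hZ.measurable_path
    hJ.measurable_path (by omega), ?_⟩
  refine (MMP.integral_errVI_avgIter_le hp hX hXc hw hx0 hG hσ hp2 hτ hκ hZ hmean rfl hJ hJZ hL hF
    hmono hγ hγL (by omega) (by omega) (by omega)).trans ?_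
  have hD : 0 ≤ MMP.diamSq X w dw / (γ * T) :=
    div_nonneg (hw.diamSq_nonneg hXc ⟨x0, hx0⟩) (by positivity)
  have hd := Real.log_natCast_nonneg d
  have hlM := Real.log_natCast_nonneg M
  set c := 68 * Real.exp 1 ^ 2 * (1 + 2 * K) ^ 2
  have hc : 0 ≤ c := by positivity
  set Y := (1 + Real.log d) * (γ * τ * (B : ℝ)⁻¹ * ((T : ℝ) / M + Real.log M) * σ ^ 2) with hY
  have hY0 : 0 ≤ Y := by positivity
  have key : γ * (c * ((1 + Real.log d) * τ * σ ^ 2) / B) *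
      (39 + 27 * (Nat.log 2 M : ℝ) + T / M) ≤ 110 * c * Y := by
    refine (mul_le_mul_of_nonneg_left (MMP.level_sum_le hM hT0) (by positivity)).trans_eq ?_
    rw [hY]
    ring
  linarith [mul_nonneg hc hD]
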